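/- All graphs are finite, simple, connected and nonempty. A labelled graph is a pair $(G,x)$ with $x:V(G)\to\{0,1\}^*$, and a distributed language is a set of labelled graphs. Nodes have pairwise distinct identifiers $\mathsf{id}(v)\in\mathbb N$. A (computable) local algorithm has a constant radius $r$; at each node $v$ it computes an output from the subgraph induced by the nodes at distance at most $r$ from $v$, with root $v$ and with all data held by these nodes, as a function of this rooted graph with its data. An algorithm decides a language $L$ if on every labelled graph $(G,x)$, for every assignment of identifiers (and, in networks labelled with an oracle, for every assignment of the oracle's labels), every node outputs yes or no, and $(G,x)\in L$ if and only if all nodes output yes. $\mathsf{LD}$ is the class of languages decided by local algorithms when each node $v$ holds $\mathsf{id}(v)$ and $x(v)$. A scalar oracle $f$ is an arbitrary, possibly uncomputable, function that assigns to each $n\ge 1$ a list $f(n)=(f^{(n)}_1,\dots,f^{(n)}_n)$ of bit strings with $f^{(n)}_1\le\dots\le f^{(n)}_n$, where bit strings are identified with natural numbers through the length-lexicographic enumeration of $\{0,1\}^*$. In an $n$-node network labelled with $f$, the $n$ entries of $f(n)$ are given to the nodes in an arbitrary one-to-one manner, as additional data. $\mathsf{LDO}^f$ is the class of languages decided in networks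 labelled with $f$ by local algorithms that are identifier-oblivious, i.e. the output of every node is the same regardless of the identifiers. The oracle $f$ is large if $$\forall c>0\ \exists k\ge 1\ \forall n\ge k:\ f^{(n)}_k\ge c,$$ and small if it is not large. Lemma. For every small scalar oracle $f$ (even an uncomputable one) there exists a distributed language $L\in\mathsf{LD}\setminus\mathsf{LDO}^f$. -/

import Mathlib

namespace LocalDecision

/-- Elements of `{0,1}*`. -/
abbrev BitString := List Bool

/-- The position of a bit string in the enumeration of `{0,1}*` by length and then
lexicographically (`ε ↦ 0`, `0 ↦ 1`, `1 ↦ 2`, `00 ↦ 3`, …). This is the bijection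
`{0,1}* ≃ ℕ` through which bit strings are compared with each other and with numbers. -/
def rank (w : BitString) : ℕ :=
  w.foldl (fun n b => 2 * n + 1 + b.toNat) 0

/-- A labelled graph `(G, x)`: a finite simple connected (hence nonempty) graph `G`,
on the node set `{0, …, order - 1}`, and a bit string for each node. -/
structure LabelledGraph where
  order : ℕ
  graph : SimpleGraph (Fin order)
  connected : graph.Connected
  label : Fin order → BitString

/-- The nodes of a labelled graph. -/
abbrev LabelledGraph.Node (G : LabelledGraph) : Type := Fin G.order

/-- A distributed language is a set of labelled graphs. -/
abbrev DistLanguage := Set LabelledGraph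

/-! ### Local algorithms -/

/-- A written description of a finite rooted graph whose nodes carry data in `D`: the list of
the node data, the root first, and the adjacency matrix with respect to this list. -/
abbrev Description (D : Type) := List D × List (List Bool)

/-- `l` lists the nodes of the radius-`r` neighbourhood of `v`, without repetition and with
`v` in the first place. -/
structure ListsBall (G : LabelledGraph) (r : ℕ) (v : G.Node) (l : List G.Node) : Prop where
  head : l.head? = some v
  nodup : l.Nodup
  mem_iff : ∀ u, u ∈ l ↔ G.graph.dist v u ≤ r

open Classical in
/-- The description of the subgraph induced by the nodes in `l`, where node `u` carries the
data `d u`. -/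
noncomputable def describe {D : Type} (G : LabelledGraph) (d : G.Node → D)
    (l : List G.Node) : Description D :=
  (l.map d, l.map fun u => l.map fun w => decide (G.graph.Adj u w))

/-- A computable algorithm with constant running time `radius`: a program that is run at each
node on a description of its radius-`radius` neighbourhood. The answer `true` is *yes* and
`false` is *no*. The program may diverge on descriptions which do not arise. -/
structure LocalAlgorithm (D : Type) [Primcodable D] where
  radius : ℕ
  run : Description D →. Bool
  computable : Partrec run

/-- In the network `G` with node data `d`, the algorithm halts at `v` with output `b`.
The output is a function of the neighbourhood itself, so it has to be the same
for all orders in which the nodes of the neighbourhood can be listed. -/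
def LocalAlgorithm.Outputs {D : Type} [Primcodable D] (A : LocalAlgorithm D)
    (G : LabelledGraph) (d : G.Node → D) (v : G.Node) (b : Bool) : Prop :=
  ∀ l : List G.Node, ListsBall G A.radius v l → b ∈ A.run (describe G d l)

/-- In the network `G` with node data `d`, the algorithm halts with output *yes* or *no* at
every node, and `G ∈ L` if and only if all nodes output *yes*. -/
def LocalAlgorithm.CorrectOn {D : Type} [Primcodable D] (A : LocalAlgorithm D)
    (L : DistLanguage) (G : LabelledGraph) (d : G.Node → D) : Prop :=
  ∃ out : G.Node → Bool, (∀ v, A.Outputs G d v (out v)) ∧ (G ∈ L ↔ ∀ v, out v = true)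

/-! ### Local decision with identifiers -/

/-- What a node `v` holds in a network without oracle: the pair `(id(v), x(v))`. -/
def plainData (G : LabelledGraph) (ident : G.Node → ℕ) : G.Node → ℕ × BitString :=
  fun v => (ident v, G.label v)

/-- The class `LD`: languages decided by a local algorithm under all assignments of pairwise
distinct identifiers. -/
def LD : Set DistLanguage :=
  {L | ∃ A : LocalAlgorithm (ℕ × BitString), ∀ (G : LabelledGraph) (ident : G.Node → ℕ),
    Function.Injective ident → A.CorrectOn L G (plainData G ident)}

/-! ### Scalar oracles -/

/-- A scalar oracle `f`: for each `n` a list `f(n) = (f₁, …, fₙ)` of `n` bit strings, in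
nondecreasing order. No computability is assumed. (The value at `n = 0` is the empty list.) -/
structure ScalarOracle where
  val : (n : ℕ) → Fin n → BitString
  sorted : ∀ n, Monotone fun i => rank (val n i)

/-- The `k`-th label of `f(n)`, for `1 ≤ k ≤ n`. -/
def ScalarOracle.kth (f : ScalarOracle) (n k : ℕ) (hk : 1 ≤ k) (hn : k ≤ n) : BitString :=
  f.val n ⟨k - 1, by omega⟩

/-- `f` is large: for all `c > 0` there is `k ≥ 1` with `f(n)ₖ ≥ c` for all `n ≥ k`. -/
def ScalarOracle.IsLarge (f : ScalarOracle) : Prop :=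
  ∀ c : ℕ, 0 < c → ∃ (k : ℕ) (hk : 1 ≤ k), ∀ (n : ℕ) (hn : k ≤ n), c ≤ rank (f.kth n k hk hn)

/-- `f` is small if it is not large. -/
def ScalarOracle.IsSmall (f : ScalarOracle) : Prop := ¬ f.IsLarge

/-- What a node `v` holds in a network labelled with the oracle `f`: its identifier, its input
label, and the label of `f(n)` that the one-to-one assignment `σ` gives to it. -/
def oracleData (f : ScalarOracle) (G : LabelledGraph) (σ : G.Node ≃ Fin G.order)
    (ident : G.Node → ℕ) : G.Node → ℕ × BitString × BitString :=
  fun v => (ident v, G.label v, f.val G.order (σ v))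

/-- The algorithm is identifier-oblivious in networks labelled with `f`: the output of every
node is the same regardless of the identifiers. -/
def LocalAlgorithm.IsOblivious (A : LocalAlgorithm (ℕ × BitString × BitString))
    (f : ScalarOracle) : Prop :=
  ∀ (G : LabelledGraph) (σ : G.Node ≃ Fin G.order) (ident ident' : G.Node → ℕ),
    Function.Injective ident → Function.Injective ident' →
      ∀ (v : G.Node) (b : Bool),
        A.Outputs G (oracleData f G σ ident) v b ↔ A.Outputs G (oracleData f G σ ident') v b

/-- The class `LDO^f`: languages decided by an identifier-oblivious local algorithm in networks
labelled with `f`, for every assignment of the oracle's labels to the nodes. -/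
def LDOWith (f : ScalarOracle) : Set DistLanguage :=
  {L | ∃ A : LocalAlgorithm (ℕ × BitString × BitString), A.IsOblivious f ∧
    ∀ (G : LabelledGraph) (σ : G.Node ≃ Fin G.order) (ident : G.Node → ℕ),
      Function.Injective ident → A.CorrectOn L G (oracleData f G σ ident)}

end LocalDecision

/-!
The language that separates `LD` from `LDO^f` consists of graphs that show complete runs of a fixed
machine `M`. The machine halts on `e` if and only if the program with number `e`, run on itself,
terminates (`exists_machine`). A run is written into a binary tree whose rows are paths: row `t` has
`2 ^ t` nodes and holds the configuration at time `t`, one cell per node. The input `e` enters as a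
counter at the left border, which is counted down while the input is loaded, so all labels except
`e` and the counter come from a finite set. A graph is in the language if its tables satisfy local
rules (`Valid`) and the program `e`, which is part of all labels of a table, does not output `0`.

Identifiers help as follows. The rules force a table to show a run from the root on, with rows that
get strictly longer, so a valid table contains more nodes than the running time of the machine
(`halts_of_valid`). One of these nodes has an identifier that is at least this time. A node that
finds that its identifier bounds the running time may safely run the program `e` and say *no* if the
output is `0`; nodes that do not find this only check the rules (`tableLanguage_mem_LD`).

An identifier-oblivious algorithm `A` of radius `r` sees only views, up to isomorphism
(`exists_out_view`). A small oracle repeats some label `s` arbitrarily often, so in networks with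
sufficiently many additional nodes (the pads) all nodes of the tables may receive the same label `s`
(`exists_pads`), and the oracle reveals nothing. Consider the program `e` that runs `A` on the views
that occur in its own network and outputs `0` if and only if all of them are accepted
(`exists_adversary`). It has to know these views without knowing how long it runs. Views that show
neither the root nor a large counter are finitely many (`finite_commonViews`), and all of them are
present in finitely many additional tables, of other halting runs, that are attached to the root
(`exists_inputs`); these tables hide whether a view belongs to the run on `e`. Views with a large
counter lie near the left border in the loading phase and are explicit, by a shift along the border
(`HasView.shift`). Since `A` decides the language, the network of `e` is accepted by all nodes if
and only if `e` does not output `0`, which is a contradiction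
(`tableLanguage_not_mem_LDOWith`).
-/

open Turing

namespace LocalDecision

/-! ### A machine with one growing tape -/

/-- A machine that controls one list of letters, in which it can look for and delete the first
letter of a kind, and to which it can prepend a letter. The input, a number, is first loaded in
unary as copies of the letter `inp`. -/
structure Machine (Q Γ : Type) where
  /-- the state after the input has been loaded -/
  start : Q
  /-- the letter in which the input is written -/
  inp : Γ
  /-- the halting states -/
  halts : Q → Bool
  /-- the letters that a state looks for -/
  pops : Q → Γ → Bool
  /-- the letter that is prepended, as a function of the letter that has been found -/
  push : Q → Option Γ → Option Γ
  /-- the next state, as a function of the letter that has been found -/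
  next : Q → Option Γ → Q

/-- A configuration: the control state (`none` while the input is being loaded), the counter of
input letters still to be loaded, and the list of letters, in which `none` is a blank cell. -/
abbrev Conf (Q Γ : Type) := Option Q × ℕ × List (Option Γ)

namespace Machine

variable {Q Γ : Type} (M : Machine Q Γ)

/-- In control state `c`, the cell content `a` is a letter to be found. -/
def hit (c : Option Q) (a : Option Γ) : Bool :=
  match c, a with
  | some q, some b => M.pops q b
  | _, _ => false

/-- The first letter that the control state looks for, if there is one. -/
def firstHit (c : Option Q) : List (Option Γ) → Option Γ
  | [] => none
  | a :: l => if M.hit c a then a else firstHit c l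

/-- The list after the first letter that the control state looks for has been deleted. -/
def eraseHit (c : Option Q) : List (Option Γ) → List (Option Γ)
  | [] => []
  | a :: l => if M.hit c a then none :: l else a :: eraseHit c l

/-- The next control state, where `z` says that the counter is zero and `g` is the letter that
has been found. -/
def nextCtl (c : Option Q) (z : Bool) (g : Option Γ) : Option Q :=
  match c with
  | none => if z then some M.start else none
  | some q => some (M.next q g)

/-- The letter that is prepended. -/
def pushed (c : Option Q) (z : Bool) (g : Option Γ) : Option Γ :=
  match c with
  | none => if z then none else some M.inp
  | some q => M.push q g

/-- A blank is inserted behind each cell. This doubling has no effect on the computation; it makes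
the list at time `t` fit the `t`-th row of a binary tree. -/
def spread (l : List (Option Γ)) : List (Option Γ) := l.flatMap fun a => [a, none]

/-- One step of the machine. -/
def step (C : Conf Q Γ) : Conf Q Γ :=
  (M.nextCtl C.1 (C.2.1 == 0) (M.firstHit C.1 C.2.2), C.2.1 - 1,
    M.pushed C.1 (C.2.1 == 0) (M.firstHit C.1 C.2.2) :: spread (M.eraseHit C.1 C.2.2))

/-- The configuration at time `t` on input `m`. -/
def conf (m : ℕ) (t : ℕ) : Conf Q Γ := M.step^[t] (none, m, [])

/-- The control state is a halting state. -/
def stopped (c : Option Q) : Bool := c.elim false M.halts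

theorem conf_succ (m t : ℕ) : M.conf m (t + 1) = M.step (M.conf m t) :=
  Function.iterate_succ_apply' _ _ _

/-- The machine reaches a halting state on input `m`. -/
def Halts (m : ℕ) : Prop := ∃ t, M.stopped (M.conf m t).1 = true

theorem firstHit_none (l : List (Option Γ)) : M.firstHit none l = none := by
  induction l with
  | nil => rfl
  | cons a l ih => simp [firstHit, hit, ih]

theorem eraseHit_none (l : List (Option Γ)) : M.eraseHit none l = l := by
  induction l with
  | nil => rfl
  | cons a l ih => simp [eraseHit, hit, ih]

/-- The machine restricted to a set of states that is closed under transitions. -/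
def restrict (P : Set Q) (h0 : M.start ∈ P) (h : ∀ q ∈ P, ∀ g, M.next q g ∈ P) : Machine P Γ where
  start := ⟨M.start, h0⟩
  inp := M.inp
  halts q := M.halts q
  pops q := M.pops q
  push q := M.push q
  next q g := ⟨M.next q g, h q q.2 g⟩

theorem restrict_step (P : Set Q) (h0 h) (C : Conf P Γ) :
    Prod.map (Option.map Subtype.val) id ((M.restrict P h0 h).step C) =
      M.step (Prod.map (Option.map Subtype.val) id C) := by
  obtain ⟨c, j, l⟩ := C
  have hhit : ∀ a, (M.restrict P h0 h).hit c a = M.hit (c.map Subtype.val) a := by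
    intro a; cases c <;> cases a <;> rfl
  have h1 : ∀ l, (M.restrict P h0 h).firstHit c l = M.firstHit (c.map Subtype.val) l := by
    intro l
    induction l with
    | nil => rfl
    | cons a l ih => simp only [firstHit, hhit, ih]
  have h2 : ∀ l, (M.restrict P h0 h).eraseHit c l = M.eraseHit (c.map Subtype.val) l := by
    intro l
    induction l with
    | nil => rfl
    | cons a l ih => simp only [eraseHit, hhit, ih]
  simp only [step, h1, h2, Prod.map_apply, id]
  congr 1
  · cases c
    · simp only [nextCtl, Option.map_none]; split <;> rfl
    · rfl
  · cases c <;> rfl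

theorem restrict_halts (P : Set Q) (h0 h) (m : ℕ) :
    (M.restrict P h0 h).Halts m ↔ M.Halts m := by
  have : ∀ t, Prod.map (Option.map Subtype.val) id ((M.restrict P h0 h).conf m t) = M.conf m t := by
    intro t
    induction t with
    | zero => rfl
    | succ t ih => rw [conf_succ, conf_succ, restrict_step, ih]
  refine exists_congr fun t => ?_
  rw [← this t]
  rcases (M.restrict P h0 h).conf m t with ⟨_ | q, _⟩ <;> rfl

end Machine

/-! ### Simulation of partial recursive functions by machines -/

section TM2

open Turing.PartrecToTM2

/-- The statements of Mathlib's stack machine for partial recursive functions. -/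
abbrev StackStmt := TM2.Stmt (fun _ : K' => Γ') Λ' (Option Γ')

/-- The program of Mathlib's stack machine for partial recursive functions. -/
def stackProg : Λ' → StackStmt := tr

/-- The control states of the simulation of Mathlib's stack machine. The first four convert the
unary input into the input of the stack machine; in state `run q s` the stack machine is about to
execute the statement `q` with the content `s` of its internal register. -/
inductive Ctl
  | pushCons | pushOne | unload | move
  | run (q : StackStmt) (s : Option Γ')
  | done

/-- The letters of the simulation: `some (k, a)` is an entry `a` of the stack `k`, and `none` is an
input letter that has not been converted yet. All stacks share one list. -/
abbrev Letter := Option (K' × Γ')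

variable (c : ToPartrec.Code)

/-- The machine that simulates the stack machine for the program `c`. On input `m` it starts the
stack machine with the number `2 ^ m`, whose binary representation is obtained from the unary
input by replacing letters one by one. -/
noncomputable def stackMachine : Machine Ctl Letter where
  start := .pushCons
  inp := none
  halts := fun
    | .done => true
    | _ => false
  pops := fun q a => match q, a with
    | .unload, none => true
    | .run (.pop k _ _) _, some a => decide (a.1 = k)
    | .run (.peek k _ _) _, some a => decide (a.1 = k)
    | _, _ => false
  push := fun q x => match q with
    | .pushCons => some (some (.main, .cons))
    | .pushOne => some (some (.main, .bit1))
    | .move => some (some (.main, .bit0))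
    | .run (.push k f _) s => some (some (k, f s))
    | .run (.peek _ _ _) _ => x
    | _ => none
  next := fun q x => match q with
    | .pushCons => .pushOne
    | .pushOne => .unload
    | .unload => if x.isSome then .move else .run (stackProg (trNormal c .halt)) none
    | .move => .unload
    | .run (.push _ _ q) s => .run q s
    | .run (.peek _ f q) s => .run q (f s (x.join.map Prod.snd))
    | .run (.pop _ f q) s => .run q (f s (x.join.map Prod.snd))
    | .run (.load f q) s => .run q (f s)
    | .run (.branch f q₁ q₂) s => .run (cond (f s) q₁ q₂) s
    | .run (.goto l) s => .run (stackProg (l s)) s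
    | .run .halt _ => .done
    | .done => .done

/-- The contents of the stack `k`. -/
def stackOf (l : List (Option Letter)) (k : K') : List Γ' :=
  l.filterMap fun a => a.join.bind fun a => if a.1 = k then some a.2 else none

theorem stackOf_cons (a) (l : List (Option Letter)) (k : K') :
    stackOf (a :: l) k =
      (a.join.bind fun a => if a.1 = k then some a.2 else none).toList ++ stackOf l k := by
  unfold stackOf
  rw [List.filterMap_cons]
  split <;> simp_all

theorem stackOf_spread (l : List (Option Letter)) : stackOf (Machine.spread l) = stackOf l := by
  funext k
  unfold stackOf Machine.spread
  rw [List.filterMap_flatMap]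
  induction l with
  | nil => rfl
  | cons a l ih =>
    rw [List.flatMap_cons, ih, List.filterMap_cons]
    simp only [List.filterMap_cons]
    split <;> simp_all

/-- Deleting the first entry of the stack `k` pops this stack. -/
theorem stackOf_hit {C : Ctl} (k : K')
    (hC : ∀ a : Letter, (stackMachine c).pops C a = a.elim false fun a => decide (a.1 = k))
    (l : List (Option Letter)) :
    ((stackMachine c).firstHit (some C) l).join.map Prod.snd = (stackOf l k).head? ∧
    stackOf ((stackMachine c).eraseHit (some C) l) =
      Function.update (stackOf l) k (stackOf l k).tail := by
  induction l with
  | nil =>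
    refine ⟨rfl, ?_⟩
    funext k'
    by_cases hk : k' = k
    · subst hk; simp [stackOf, Machine.eraseHit]
    · simp [stackOf, Machine.eraseHit, hk]
  | cons a l ih =>
    by_cases h : (stackMachine c).hit (some C) a = true
    · obtain ⟨b, rfl⟩ : ∃ b, a = some (some (k, b)) := by
        rcases a with _ | _ | ⟨k', b⟩
        · simp [Machine.hit] at h
        · simp [Machine.hit, hC] at h
        · simp [Machine.hit, hC] at h
          subst h; exact ⟨b, rfl⟩
      simp only [Machine.firstHit, Machine.eraseHit, h, if_true]
      refine ⟨by simp [stackOf_cons], ?_⟩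
      funext k'
      by_cases hk : k' = k
      · subst hk; simp [stackOf_cons]
      · simp [stackOf_cons, hk, Ne.symm hk]
    · have ha : (a.join.bind fun a => if a.1 = k then some a.2 else none) = none := by
        rcases a with _ | _ | ⟨k', b⟩
        · rfl
        · rfl
        · simp [Machine.hit, hC] at h
          simp [h]
      simp only [Machine.firstHit, Machine.eraseHit, h]
      obtain ⟨h1, h2⟩ := ih
      refine ⟨by simpa [stackOf_cons, ha] using h1, ?_⟩
      funext k'
      have := congrFun h2 k'
      by_cases hk : k' = k
      · subst hk
        simp only [Bool.false_eq_true, if_false, stackOf_cons, ha, Function.update_self] at this ⊢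
        simpa using this
      · simp only [Bool.false_eq_true, if_false, stackOf_cons, Function.update_of_ne hk] at this ⊢
        rw [this]

theorem firstHit_cases {C : Ctl} (k : K')
    (hC : ∀ a : Letter, (stackMachine c).pops C a = a.elim false fun a => decide (a.1 = k))
    (l : List (Option Letter)) :
    (stackMachine c).firstHit (some C) l = none ∨
      ∃ b, (stackMachine c).firstHit (some C) l = some (some (k, b)) := by
  induction l with
  | nil => exact Or.inl rfl
  | cons a l ih =>
    rcases a with _ | _ | ⟨k', b⟩
    · simpa [Machine.firstHit, Machine.hit] using ih
    · simpa [Machine.firstHit, Machine.hit, hC] using ih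
    · by_cases h : k' = k
      · subst h; exact Or.inr ⟨b, by simp [Machine.firstHit, Machine.hit, hC]⟩
      · simpa [Machine.firstHit, Machine.hit, hC, h] using ih

/-- Peeking is popping followed by pushing the same letter. -/
theorem stackOf_peek {C : Ctl} (k : K')
    (hC : ∀ a : Letter, (stackMachine c).pops C a = a.elim false fun a => decide (a.1 = k))
    (l : List (Option Letter)) :
    stackOf ((stackMachine c).firstHit (some C) l :: (stackMachine c).eraseHit (some C) l) =
      stackOf l := by
  obtain ⟨h1, h2⟩ := stackOf_hit c k hC l
  funext k'
  rw [stackOf_cons, h2]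
  rcases firstHit_cases c k hC l with h | ⟨b, h⟩
  · rw [h] at h1 ⊢
    have : stackOf l k = [] := by simpa using h1.symm
    by_cases hk : k' = k
    · subst hk; simp [this]
    · simp [hk]
  · rw [h] at h1 ⊢
    have h1' : (stackOf l k).head? = some b := h1.symm
    by_cases hk : k' = k
    · subst hk
      simpa using List.cons_head?_tail (Option.mem_def.2 h1')
    · simp [hk, Ne.symm hk]

theorem firstHit_nopop {C : Ctl} (hC : ∀ a : Letter, (stackMachine c).pops C a = false)
    (l : List (Option Letter)) :
    (stackMachine c).firstHit (some C) l = none ∧ (stackMachine c).eraseHit (some C) l = l := by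
  have hh : ∀ a, (stackMachine c).hit (some C) a = false := by
    intro a; cases a <;> simp [Machine.hit, hC]
  induction l with
  | nil => exact ⟨rfl, rfl⟩
  | cons a l ih => simp [Machine.firstHit, Machine.eraseHit, hh, ih.1, ih.2]

/-- One step in a state `run q s` executes one statement of the stack machine. A `goto` enters a
new label, and the size of the statement decreases otherwise. -/
theorem run_step (q : StackStmt) (s : Option Γ') (l : List (Option Letter)) :
    (∃ q' s' l', (stackMachine c).step (some (.run q s), 0, l) = (some (.run q' s'), 0, l') ∧
      (TM2.stepAux q s (stackOf l) = TM2.stepAux q' s' (stackOf l') ∧ sizeOf q' < sizeOf q ∨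
       ∃ lab, TM2.stepAux q s (stackOf l) = ⟨some lab, s', stackOf l'⟩ ∧ q' = stackProg lab)) ∨
    ((∃ l', (stackMachine c).step (some (.run q s), 0, l) = (some .done, 0, l')) ∧
      (TM2.stepAux q s (stackOf l)).l = none) := by
  cases q with
  | push k f q =>
    obtain ⟨h1, h2⟩ := firstHit_nopop c (C := .run (.push k f q) s) (fun a => by cases a <;> rfl) l
    refine Or.inl ⟨q, s, _, by rw [Machine.step, h1, h2]; rfl, Or.inl ⟨?_, ?_⟩⟩
    · rw [TM2.stepAux]
      congr 1
      funext k'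
      rw [stackOf_cons, stackOf_spread]
      by_cases hk : k' = k
      · subst hk; simp [stackMachine, Machine.pushed]
      · simp [stackMachine, Machine.pushed, hk, Ne.symm hk]
    · simp
  | pop k f q =>
    have hC : ∀ a : Letter, (stackMachine c).pops (.run (.pop k f q) s) a =
      a.elim false fun a => decide (a.1 = k) := fun a => by cases a <;> rfl
    obtain ⟨h1, h2⟩ := stackOf_hit c k hC l
    refine Or.inl ⟨q, _, _, by rw [Machine.step]; rfl, Or.inl ⟨?_, ?_⟩⟩
    · rw [TM2.stepAux, ← h1]
      congr 1
      rw [← h2, ← stackOf_spread ((stackMachine c).eraseHit _ _)]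
      funext k'
      rw [stackOf_cons]
      rfl
    · simp
  | peek k f q =>
    have hC : ∀ a : Letter, (stackMachine c).pops (.run (.peek k f q) s) a =
      a.elim false fun a => decide (a.1 = k) := fun a => by cases a <;> rfl
    obtain ⟨h1, h2⟩ := stackOf_hit c k hC l
    refine Or.inl ⟨q, _, _, by rw [Machine.step]; rfl, Or.inl ⟨?_, ?_⟩⟩
    · rw [TM2.stepAux, ← h1]
      congr 1
      rw [← stackOf_peek c k hC l]
      funext k'
      rw [stackOf_cons, stackOf_cons, stackOf_spread]
      rfl
    · simp
  | load f q =>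
    obtain ⟨h1, h2⟩ := firstHit_nopop c (C := .run (.load f q) s) (fun a => by cases a <;> rfl) l
    refine Or.inl ⟨q, f s, _, by rw [Machine.step, h1, h2]; rfl, Or.inl ⟨?_, by simp⟩⟩
    rw [TM2.stepAux]
    congr 1
    funext k'
    rw [stackOf_cons, stackOf_spread]
    rfl
  | branch f q₁ q₂ =>
    obtain ⟨h1, h2⟩ := firstHit_nopop c (C := .run (.branch f q₁ q₂) s)
      (fun a => by cases a <;> rfl) l
    refine Or.inl ⟨cond (f s) q₁ q₂, s, _, by rw [Machine.step, h1, h2]; rfl, Or.inl ⟨?_, ?_⟩⟩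
    · have : stackOf ((stackMachine c).pushed (some (.run (.branch f q₁ q₂) s)) true none ::
          Machine.spread l) = stackOf l := by
        funext k'
        rw [stackOf_cons, stackOf_spread]
        rfl
      rw [TM2.stepAux]
      erw [this]
      cases f s <;> rfl
    · simp only [TM2.Stmt.branch.sizeOf_spec]; cases f s <;> dsimp only [cond] <;> omega
  | goto lab =>
    obtain ⟨h1, h2⟩ := firstHit_nopop c (C := .run (.goto lab) s) (fun a => by cases a <;> rfl) l
    refine Or.inl ⟨stackProg (lab s), s, _, by rw [Machine.step, h1, h2]; rfl,
      Or.inr ⟨lab s, ?_, rfl⟩⟩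
    rw [TM2.stepAux]
    congr 1
    funext k'
    rw [stackOf_cons, stackOf_spread]
    rfl
  | halt =>
    exact Or.inr ⟨⟨_, by rw [Machine.step]; rfl⟩, rfl⟩

/-- The machine halts from the configuration `C`. -/
def HaltsFrom (C : Conf Ctl Letter) : Prop :=
  ∃ t, (stackMachine c).stopped ((stackMachine c).step^[t] C).1 = true

theorem haltsFrom_step {C : Conf Ctl Letter} (h : (stackMachine c).stopped C.1 = false) :
    HaltsFrom c ((stackMachine c).step C) ↔ HaltsFrom c C := by
  constructor
  · rintro ⟨t, ht⟩; exact ⟨t + 1, ht⟩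
  · rintro ⟨_ | t, ht⟩
    · simp [h] at ht
    · exact ⟨t, ht⟩

theorem haltsFrom_run (q : StackStmt) (s : Option Γ') (l : List (Option Letter)) :
    HaltsFrom c (some (.run q s), 0, l) ↔
      (StateTransition.eval (TM2.step stackProg) (TM2.stepAux q s (stackOf l))).Dom := by
  constructor
  · rintro ⟨t, ht⟩
    induction t generalizing q s l with
    | zero => cases ht
    | succ t ih =>
      rw [Function.iterate_succ_apply] at ht
      rcases run_step c q s l with ⟨q', s', l', h, h' | ⟨lab, h', rfl⟩⟩ | ⟨_, h⟩
      · rw [h'.1]; rw [h] at ht; exact ih _ _ _ ht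
      · rw [h] at ht
        have := ih _ _ _ ht
        rw [h', StateTransition.reaches_eval (f := TM2.step stackProg)
          (b := TM2.stepAux (stackProg lab) s' (stackOf l')) (.single rfl)]
        exact this
      · generalize TM2.stepAux q s (stackOf l) = C at h
        obtain ⟨_, v, S⟩ := C
        cases h
        exact Part.dom_iff_mem.2 ⟨_, StateTransition.mem_eval.2 ⟨.refl, rfl⟩⟩
  · intro h
    obtain ⟨b, hb⟩ : ∃ b, b ∈ StateTransition.eval (TM2.step stackProg)
      (TM2.stepAux q s (stackOf l)) := Part.dom_iff_mem.1 h
    rw [StateTransition.mem_eval] at hb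
    clear h
    obtain ⟨hr, hb⟩ := hb
    generalize hC : TM2.stepAux q s (stackOf l) = C at hr
    induction hr using Relation.ReflTransGen.head_induction_on generalizing q s l with
    | refl =>
      induction hn : sizeOf q using Nat.strong_induction_on generalizing q s l with
      | _ n ih =>
        rw [← haltsFrom_step c rfl]
        rcases run_step c q s l with ⟨q', s', l', h, h' | ⟨lab, h', rfl⟩⟩ | ⟨⟨l', h⟩, _⟩
        · rw [h]; exact ih _ (hn ▸ h'.2) _ _ _ (h'.1 ▸ hC) rfl
        · rw [← hC, h'] at hb; cases hb
        · exact ⟨0, by rw [h]; rfl⟩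
    | head hab hbc ih0 =>
      induction hn : sizeOf q using Nat.strong_induction_on generalizing q s l with
      | _ n ih =>
        rw [← haltsFrom_step c rfl]
        rcases run_step c q s l with ⟨q', s', l', h, h' | ⟨lab, h', rfl⟩⟩ | ⟨⟨l', h⟩, _⟩
        · rw [h]; exact ih _ (hn ▸ h'.2) _ _ _ (h'.1 ▸ hC) rfl
        · rw [h]
          rw [← hC, h'] at hab
          exact ih0 _ _ _ (Option.some_inj.1 hab)
        · exact ⟨0, by rw [h]; rfl⟩


/-- The number of input letters that have not been unloaded yet. -/
def inputCount (l : List (Option Letter)) : ℕ := l.countP fun a => decide (a = some none)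

theorem inputCount_spread (l : List (Option Letter)) :
    inputCount (Machine.spread l) = inputCount l := by
  induction l with
  | nil => rfl
  | cons a l ih =>
    have : Machine.spread (a :: l) = a :: none :: Machine.spread l := rfl
    rw [this]
    unfold inputCount at *
    rw [List.countP_cons, List.countP_cons, List.countP_cons, ih]
    simp

/-- State `unload` deletes one input letter and leaves the stacks alone. -/
theorem unload_hit (l : List (Option Letter)) :
    (stackMachine c).firstHit (some .unload) l = (if inputCount l = 0 then none else some none) ∧
    inputCount ((stackMachine c).eraseHit (some .unload) l) = inputCount l - 1 ∧
    stackOf ((stackMachine c).eraseHit (some .unload) l) = stackOf l := by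
  induction l with
  | nil => exact ⟨rfl, rfl, rfl⟩
  | cons a l ih =>
    obtain ⟨h1, h2, h3⟩ := ih
    rcases a with _ | _ | a
    · have hh : (stackMachine c).hit (some .unload) none = false := rfl
      have hc : ∀ l, inputCount (none :: l) = inputCount l := fun l => by simp [inputCount]
      simp only [Machine.firstHit, Machine.eraseHit, hh, hc]
      refine ⟨h1, h2, ?_⟩
      funext k; simp [stackOf_cons, h3]
    · have hh : (stackMachine c).hit (some .unload) (some none) = true := rfl
      have hc : ∀ l, inputCount (some none :: l) = inputCount l + 1 := fun l => by simp [inputCount]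
      have hc' : ∀ l, inputCount (none :: l) = inputCount l := fun l => by simp [inputCount]
      simp only [Machine.firstHit, Machine.eraseHit, hh, hc, if_true, hc']
      refine ⟨by simp, by simp, ?_⟩
      funext k; simp [stackOf_cons]
    · have hh : (stackMachine c).hit (some .unload) (some (some a)) = false := rfl
      have hc : ∀ l, inputCount (some (some a) :: l) = inputCount l := fun l => by
        simp [inputCount]
      simp only [Machine.firstHit, Machine.eraseHit, hh, hc]
      refine ⟨h1, h2, ?_⟩
      funext k; simp [stackOf_cons, h3]

theorem haltsFrom_load (j : ℕ) (l : List (Option Letter)) :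
    ∃ l', inputCount l' = inputCount l + j ∧ stackOf l' = stackOf l ∧
      (HaltsFrom c (none, j, l) ↔ HaltsFrom c (some .pushCons, 0, l')) := by
  induction j generalizing l with
  | zero =>
    refine ⟨none :: Machine.spread l, ?_, ?_, ?_⟩
    · rw [← inputCount_spread l]; simp [inputCount]
    · funext k; rw [stackOf_cons, stackOf_spread]; rfl
    · rw [← haltsFrom_step c (by rfl), Machine.step, Machine.firstHit_none, Machine.eraseHit_none]
      rfl
  | succ j ih =>
    obtain ⟨l', h1, h2, h3⟩ := ih (some none :: Machine.spread l)
    refine ⟨l', ?_, ?_, ?_⟩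
    · rw [h1, ← inputCount_spread l]; simp [inputCount]; omega
    · rw [h2]; funext k; rw [stackOf_cons, stackOf_spread]; rfl
    · rw [← h3, ← haltsFrom_step c (by rfl), Machine.step, Machine.firstHit_none,
        Machine.eraseHit_none]
      rfl

theorem haltsFrom_unload (n : ℕ) (l : List (Option Letter)) (hl : inputCount l = n) :
    ∃ l', stackOf l' = Function.update (stackOf l) .main
        (List.replicate n .bit0 ++ stackOf l .main) ∧
      (HaltsFrom c (some .unload, 0, l) ↔
        HaltsFrom c (some (.run (stackProg (trNormal c .halt)) none), 0, l')) := by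
  induction n generalizing l with
  | zero =>
    obtain ⟨h1, h2, h3⟩ := unload_hit c l
    refine ⟨none :: Machine.spread ((stackMachine c).eraseHit (some .unload) l), ?_, ?_⟩
    · funext k; rw [stackOf_cons, stackOf_spread, h3]; simp
    · rw [← haltsFrom_step c (by rfl), Machine.step, h1, if_pos hl]
      rfl
  | succ n ih =>
    obtain ⟨h1, h2, h3⟩ := unload_hit c l
    set l₁ := none :: Machine.spread ((stackMachine c).eraseHit (some .unload) l) with hl₁
    have hs₁ : stackOf l₁ = stackOf l := by
      funext k; rw [hl₁, stackOf_cons, stackOf_spread, h3]; simp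
    have hc₁ : inputCount l₁ = n := by
      have : inputCount l₁ = inputCount (Machine.spread
        ((stackMachine c).eraseHit (some .unload) l)) := by simp [hl₁, inputCount]
      rw [this, inputCount_spread, h2, hl]; rfl
    obtain ⟨g1, g2⟩ := firstHit_nopop c (C := .move) (fun a => by cases a <;> rfl) l₁
    obtain ⟨l', k1, k2⟩ := ih (some (some (.main, .bit0)) :: Machine.spread l₁)
      (by rw [← hc₁, ← inputCount_spread l₁]; simp [inputCount])
    refine ⟨l', ?_, ?_⟩
    · rw [k1]
      funext k
      by_cases hk : k = .main
      · subst hk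
        simp [stackOf_cons, stackOf_spread, hs₁, List.replicate_succ']
      · simp [stackOf_cons, stackOf_spread, hs₁, hk, Ne.symm hk]
    · rw [← k2, ← haltsFrom_step c (by rfl), Machine.step, h1, if_neg (by omega)]
      rw [← haltsFrom_step c (by rfl)]
      change HaltsFrom c ((stackMachine c).step (some .move, 0, l₁)) ↔ _
      rw [Machine.step]
      simp only [g1, g2]
      rfl

theorem trNat_two_pow (n : ℕ) : trNat (2 ^ n) = List.replicate n Γ'.bit0 ++ [Γ'.bit1] := by
  have h : ∃ p : PosNum, ((2 ^ n : ℕ) : Num) = Num.pos p ∧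
      trPosNum p = List.replicate n Γ'.bit0 ++ [Γ'.bit1] := by
    induction n with
    | zero => exact ⟨PosNum.one, rfl, rfl⟩
    | succ n ih =>
      obtain ⟨p, h1, h2⟩ := ih
      refine ⟨p.bit0, ?_, ?_⟩
      · rw [pow_succ, mul_comm, two_mul, Nat.cast_add, h1]
        exact (Num.bit0_of_bit0 (Num.pos p))
      · rw [trPosNum, h2, List.replicate_succ]; rfl
  obtain ⟨p, h1, h2⟩ := h
  rw [trNat, h1, trNum, h2]

theorem stackMachine_halts (m : ℕ) : (stackMachine c).Halts m ↔ (c.eval [2 ^ m]).Dom := by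
  obtain ⟨l₀, h1, h2, h3⟩ := haltsFrom_load c m []
  refine Iff.trans (b := HaltsFrom c (none, m, [])) Iff.rfl (h3.trans ?_)
  rw [← haltsFrom_step c (by rfl), Machine.step]
  obtain ⟨g1, g2⟩ := firstHit_nopop c (C := .pushCons) (fun a => by cases a <;> rfl) l₀
  simp only [g1, g2]
  set l₁ := (stackMachine c).pushed (some .pushCons) (0 == 0) none :: Machine.spread l₀ with hl₁
  rw [← haltsFrom_step c (by rfl)]
  change HaltsFrom c ((stackMachine c).step (some .pushOne, 0, l₁)) ↔ _
  obtain ⟨g1, g2⟩ := firstHit_nopop c (C := .pushOne) (fun a => by cases a <;> rfl) l₁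
  rw [Machine.step]
  simp only [g1, g2]
  set l₂ := (stackMachine c).pushed (some .pushOne) (0 == 0) none :: Machine.spread l₁ with hl₂
  have hc₁ : inputCount l₁ = m := by
    rw [hl₁, inputCount, List.countP_cons, ← inputCount, inputCount_spread, h1]
    simp [stackMachine, Machine.pushed, inputCount]
  have hc₂ : inputCount l₂ = m := by
    rw [hl₂, inputCount, List.countP_cons, ← inputCount, inputCount_spread, hc₁]
    simp [stackMachine, Machine.pushed]
  have hs₂ : stackOf l₂ = K'.elim [.bit1, .cons] [] [] [] := by
    funext k
    rw [hl₂, stackOf_cons, stackOf_spread, hl₁, stackOf_cons, stackOf_spread, h2]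
    cases k <;> simp [stackMachine, Machine.pushed, stackOf]
  obtain ⟨l', k1, k2⟩ := haltsFrom_unload c m l₂ hc₂
  change HaltsFrom c (some .unload, 0, l₂) ↔ _
  rw [k2, haltsFrom_run, k1, hs₂]
  have hi : (init c [2 ^ m] : TM2.Cfg (fun _ : K' => Γ') Λ' (Option Γ')) =
      ⟨some (trNormal c .halt), none, Function.update (K'.elim [.bit1, .cons] [] [] []) .main
        (List.replicate m .bit0 ++ [.bit1, .cons])⟩ := by
    rw [K'.elim_update_main]
    simp [init, trNat_two_pow]
    rfl
  have := tr_eval c [2 ^ m]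
  have h' : (StateTransition.eval (TM2.step stackProg) (init c [2 ^ m])).Dom ↔
      (c.eval [2 ^ m]).Dom := by
    unfold stackProg
    erw [this]
    rfl
  have hstep := StateTransition.reaches_eval (f := TM2.step stackProg)
    (a := ⟨some (trNormal c .halt), none, Function.update (K'.elim [.bit1, .cons] [] [] []) .main
        (List.replicate m .bit0 ++ [.bit1, .cons])⟩) (.single rfl)
  rw [← h', hi, hstep]
  rfl

/-- Only finitely many control states can be reached. -/
theorem finite_stackStates : ∃ P : Set Ctl, P.Finite ∧ (stackMachine c).start ∈ P ∧
    ∀ q ∈ P, ∀ g, (stackMachine c).next q g ∈ P := by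
  let S := codeSupp c .halt
  have hS : @TM2.Supports _ _ _ _ ⟨trNormal c .halt⟩ stackProg S := tr_supports c .halt
  let T : Set StackStmt := {q | ∃ lab ∈ S, q ∈ TM2.stmts₁ (stackProg lab)}
  have hT : T.Finite := by
    have : T = ⋃ lab ∈ S, ↑(TM2.stmts₁ (stackProg lab)) := by ext; simp [T]
    rw [this]
    exact S.finite_toSet.biUnion fun _ _ => Finset.finite_toSet _
  have hT' : ∀ q ∈ T, TM2.SupportsStmt S q := by
    rintro q ⟨lab, h, hq⟩
    exact TM2.stmts₁_supportsStmt_mono hq (hS.2 _ h)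
  have hgo : ∀ lab ∈ S, stackProg lab ∈ T := fun lab h => ⟨lab, h, TM2.stmts₁_self⟩
  have hsub : ∀ q ∈ T, ∀ q', q' ∈ TM2.stmts₁ q → q' ∈ T := by
    rintro q ⟨lab, h, hq⟩ q' hq'
    exact ⟨lab, h, TM2.stmts₁_trans hq hq'⟩
  refine ⟨{.pushCons, .pushOne, .unload, .move, .done} ∪ Set.image2 Ctl.run T Set.univ,
    ?_, by simp [stackMachine], ?_⟩
  · exact Set.Finite.union (by simp) (hT.image2 _ Set.finite_univ)
  · rintro q (hq | ⟨q, hq, s, -, rfl⟩) g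
    · rcases hq with rfl | rfl | rfl | rfl | rfl
      · simp [stackMachine]
      · simp [stackMachine]
      · simp only [stackMachine]
        split
        · simp
        · exact Or.inr ⟨_, hgo _ hS.1, none, trivial, rfl⟩
      · simp [stackMachine]
      · simp [stackMachine]
    · cases q with
      | push k f q =>
        exact Or.inr ⟨q, hsub _ hq _ (by simp [TM2.stmts₁, TM2.stmts₁_self]), _, trivial, rfl⟩
      | peek k f q =>
        exact Or.inr ⟨q, hsub _ hq _ (by simp [TM2.stmts₁, TM2.stmts₁_self]), _, trivial, rfl⟩
      | pop k f q =>
        exact Or.inr ⟨q, hsub _ hq _ (by simp [TM2.stmts₁, TM2.stmts₁_self]), _, trivial, rfl⟩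
      | load f q =>
        exact Or.inr ⟨q, hsub _ hq _ (by simp [TM2.stmts₁, TM2.stmts₁_self]), _, trivial, rfl⟩
      | branch f q₁ q₂ =>
        refine Or.inr ⟨cond (f s) q₁ q₂, hsub _ hq _ ?_, _, trivial, rfl⟩
        cases f s <;> simp [TM2.stmts₁, TM2.stmts₁_self]
      | goto lab => exact Or.inr ⟨_, hgo _ (hT' _ hq s), s, trivial, rfl⟩
      | halt => exact Or.inl (by simp [stackMachine])

/-- Every partial recursive function has a machine with finitely many states and letters that
halts exactly on its domain. -/
theorem exists_machine {F : ℕ →. ℕ} (hF : Partrec F) :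
    ∃ (Q Γ : Type) (_ : Finite Q) (_ : Finite Γ) (M : Machine Q Γ),
      ∀ m, M.Halts m ↔ (F m).Dom := by
  -- the stack machine gets `2 ^ m` instead of `m`, so the logarithm is taken first
  let p : ℕ → ℕ →. Bool := fun x m => Part.some (decide (x ≤ 2 ^ m))
  have hG : Partrec fun x : ℕ => (Nat.rfind (p x)).bind F := by
    refine Partrec.bind (Partrec.rfind (p := p) ?_) (hF.comp Computable.snd)
    refine Computable.partrec (Primrec.to_comp ?_)
    refine PrimrecPred.decide (Primrec.nat_le.comp Primrec.fst ?_)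
    exact (Primrec₂.unpaired'.1 Nat.Primrec.pow).comp (Primrec.const 2) Primrec.snd
  obtain ⟨c, hc⟩ := ToPartrec.Code.exists_code (Nat.Partrec'.part_iff₁.2 hG)
  obtain ⟨P, hP, h0, h⟩ := finite_stackStates c
  have hK : Finite K' :=
    Finite.of_surjective (fun i : Fin 4 => ![K'.main, .rev, .aux, .stack] i) fun k => by
      cases k
      exacts [⟨0, rfl⟩, ⟨1, rfl⟩, ⟨2, rfl⟩, ⟨3, rfl⟩]
  refine ⟨P, Letter, hP.to_subtype, inferInstance, (stackMachine c).restrict P h0 h, fun m => ?_⟩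
  rw [Machine.restrict_halts, stackMachine_halts]
  have hr : Nat.rfind (p (2 ^ m)) = Part.some m := by
    rw [Part.eq_some_iff, Nat.mem_rfind]
    refine ⟨by simp [p], fun {n} hn => ?_⟩
    have := Nat.pow_lt_pow_right (a := 2) (by omega) hn
    simpa [p] using this
  have h2 : c.eval [2 ^ m] = pure <$> (Nat.rfind (p (2 ^ m))).bind F := hc ⟨[2 ^ m], rfl⟩
  rw [h2, hr]
  exact iff_of_eq (congrArg Part.Dom (Part.bind_some m F))

end TM2

/-! ### Locally checkable tables of runs -/

/-- The finite part of the label of a node in a table. A table is a binary tree whose rows are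
paths; row `t` shows the configuration at time `t`. -/
structure Sym (Q Γ : Type) where
  /-- twice the row plus a constant, modulo 3, which orients the edges between rows -/
  lev : Fin 3
  /-- the position in the row modulo 3, which orients the edges within the row -/
  pos : Fin 3
  /-- the node is the root -/
  root : Bool
  /-- the node is at the right end of its row -/
  last : Bool
  /-- the node is in the last row -/
  leaf : Bool
  /-- at the left border, the control state and a guess of the letter to be found; elsewhere, the
  content of a cell of the list -/
  cell : (Option Q × Option Γ) ⊕ Option Γ
  /-- control state and guess as received from the left neighbour, as long as the letter has not
  been found -/
  carry : Option (Q × Option Γ)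

/-- A label in a table: a program, which is the same throughout a table, the counter, which is
used at the left border only, and the symbol. -/
abbrev NodeLabel (Q Γ : Type) := ℕ × ℕ × Sym Q Γ

namespace Sym
variable {Q Γ : Type}

/-- Next to `a`, the symbol `b` belongs to the right neighbour in the row. -/
def IsRow (a b : Sym Q Γ) : Prop := b.lev = a.lev ∧ b.pos.val = (a.pos.val + 1) % 3

/-- Next to `a`, the symbol `b` belongs to the left child. -/
def IsLeft (a b : Sym Q Γ) : Prop :=
  b.root = false ∧ a.lev.val = (b.lev.val + 1) % 3 ∧ b.pos.val = (2 * a.pos.val) % 3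

/-- Next to `a`, the symbol `b` belongs to the right child. -/
def IsRight (a b : Sym Q Γ) : Prop :=
  b.root = false ∧ a.lev.val = (b.lev.val + 1) % 3 ∧ b.pos.val = (2 * a.pos.val + 1) % 3

theorem IsLeft.not_isRight {a b : Sym Q Γ} (h : IsLeft a b) : ¬ IsRight a b := by
  rintro ⟨-, -, h'⟩
  obtain ⟨-, -, h⟩ := h
  omega

theorem IsLeft.isRow {a b c : Sym Q Γ} (h : IsLeft a b) (h' : IsRight a c) : IsRow b c := by
  obtain ⟨-, h1, h2⟩ := h
  obtain ⟨-, h1', h2'⟩ := h'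
  have := b.lev.isLt
  have := c.lev.isLt
  exact ⟨Fin.ext (by omega), by omega⟩

theorem IsRight.isRow {a b c d : Sym Q Γ} (h : IsRight a b) (hac : IsRow a c) (h' : IsLeft c d) :
    IsRow b d := by
  obtain ⟨-, h1, h2⟩ := h
  obtain ⟨-, h1', h2'⟩ := h'
  obtain ⟨h3, h4⟩ := hac
  have h3' := congrArg Fin.val h3
  have := b.lev.isLt
  have := d.lev.isLt
  exact ⟨Fin.ext (by omega), by omega⟩

variable (M : Machine Q Γ)

/-- The search that is passed on to the next node of the row. -/
def out (a : Sym Q Γ) : Option (Q × Option Γ) :=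
  match a.cell with
  | .inl (c, g) => c.map fun q => (q, g)
  | .inr x => if M.hit (a.carry.map Prod.fst) x then none else a.carry

/-- The cell content `y` of the left child continues that of the symbol `a`: the next control state,
or the content of the same cell after the deletion. Here `z` says that the counter is zero. -/
def leftCell (z : Bool) (a : Sym Q Γ) (y : (Option Q × Option Γ) ⊕ Option Γ) : Prop :=
  match a.cell with
  | .inl (c, g) => ∃ g', y = .inl (M.nextCtl c z g, g')
  | .inr x => y = .inr (if M.hit (a.carry.map Prod.fst) x then none else x)

/-- The content of the cell of the right child: the prepended letter, or a blank. -/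
def rightLetter (z : Bool) (a : Sym Q Γ) : Option Γ :=
  match a.cell with
  | .inl (c, g) => M.pushed c z g
  | .inr _ => none

/-- Local conditions on one symbol. The guess has to be the letter that is found first, and has to
be blank if none is found; a table ends only when the machine has halted; the root is a row of
length one in the initial configuration. -/
structure OkOne (a : Sym Q Γ) : Prop where
  found : ∀ x, a.cell = .inr x → M.hit (a.carry.map Prod.fst) x = true → a.carry.bind Prod.snd = x
  last : a.last = true → (a.out M).bind Prod.snd = none
  go_on : ∀ c g, a.cell = .inl (c, g) → M.stopped c = false → a.leaf = false
  root : a.root = true → a.last = true ∧ ∃ g, a.cell = .inl (none, g)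

/-- Local conditions on the symbols of adjacent nodes, where `z` says that the counter of the first
node is zero. -/
structure OkPair (z : Bool) (a b : Sym Q Γ) : Prop where
  row : IsRow a b → b.leaf = a.leaf ∧ b.carry = a.out M
  left : IsLeft a b → a.leaf = false ∧ a.leftCell M z b.cell
  right : IsRight a b → a.leaf = false ∧ b.last = a.last ∧ b.cell = .inr (a.rightLetter M z)

end Sym

section
variable {Q Γ : Type}

/-- The labels have the same program and related symbols. -/
def LabelRel (p : Sym Q Γ → Sym Q Γ → Prop) (x y : Option (NodeLabel Q Γ)) : Prop :=
  ∃ e j a j' b, x = some (e, j, a) ∧ y = some (e, j', b) ∧ p a b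

/-- The label belongs to a table and satisfies `p`. -/
def LabelIs (p : ℕ → ℕ → Sym Q Γ → Prop) (x : Option (NodeLabel Q Γ)) : Prop :=
  ∃ e j a, x = some (e, j, a) ∧ p e j a

/-- Next to `x`, the label `y` belongs to a child. -/
def IsChildLabel (x y : Option (NodeLabel Q Γ)) : Prop :=
  LabelRel Sym.IsLeft x y ∨ LabelRel Sym.IsRight x y

/-- Local conditions on the labels of adjacent nodes; nodes outside all tables do not matter. -/
def OkPairLabel (M : Machine Q Γ) (x y : Option (NodeLabel Q Γ)) : Prop :=
  y = none ∨ ∃ e j a j' b, x = some (e, j, a) ∧ y = some (e, j', b) ∧ a.OkPair M (j == 0) b ∧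
    (Sym.IsLeft a b → j' = j - 1)

variable {V : Type} (M : Machine Q Γ) (adj : V → V → Prop) (lab : V → Option (NodeLabel Q Γ))

/-- The local conditions on a node `v` of a table. Parent and children are recognized by their
labels; there may be several right neighbours. A root without parent is either the root of a table
whose input is its own program, or adjacent to such a root. -/
structure Valid (v : V) : Prop where
  one : LabelIs (fun _ _ a => a.OkOne M) (lab v)
  pair : ∀ u, adj v u → OkPairLabel M (lab v) (lab u)
  parent : LabelIs (fun _ _ a => a.root = false) (lab v) → ∃ u, adj v u ∧ IsChildLabel (lab u) (lab v)
  parent_unique : ∀ u, adj v u → ∀ w, adj v w →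
    IsChildLabel (lab u) (lab v) → IsChildLabel (lab w) (lab v) → u = w
  left : LabelIs (fun _ _ a => a.leaf = false) (lab v) →
    ∃ u, adj v u ∧ LabelRel Sym.IsLeft (lab v) (lab u)
  right : LabelIs (fun _ _ a => a.leaf = false) (lab v) →
    ∃ u, adj v u ∧ LabelRel Sym.IsRight (lab v) (lab u)
  siblings : ∀ u, adj v u → ∀ w, adj v w →
    LabelRel Sym.IsLeft (lab v) (lab u) → LabelRel Sym.IsRight (lab v) (lab w) → adj u w
  cousins : ∀ u, adj v u → ∀ w, adj v w → LabelRel Sym.IsRight (lab v) (lab u) →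
    LabelRel Sym.IsRow (lab v) (lab w) → ∀ x, adj w x → LabelRel Sym.IsLeft (lab w) (lab x) → adj u x
  root : LabelIs (fun _ _ a => a.root = true) (lab v) →
    LabelIs (fun e j _ => j = e) (lab v) ∨
      ∃ u, adj v u ∧ LabelRel (fun _ _ => True) (lab v) (lab u) ∧
        LabelIs (fun e j a => j = e ∧ a.root = true) (lab u)

end

/-! ### Valid tables show complete runs -/

section Sound
variable {Q Γ : Type} {V : Type} {M : Machine Q Γ} {adj : V → V → Prop}
  {lab : V → Option (NodeLabel Q Γ)}

/-- `u` and `w` are adjacent nodes of the same row. -/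
def RowStep (adj : V → V → Prop) (lab : V → Option (NodeLabel Q Γ)) (u w : V) : Prop :=
  adj u w ∧ (LabelRel Sym.IsRow (lab u) (lab w) ∨ LabelRel Sym.IsRow (lab w) (lab u))

/-- The nodes in the row of `v`. -/
def rowOf (adj : V → V → Prop) (lab : V → Option (NodeLabel Q Γ)) (v : V) : Set V :=
  {u | Relation.ReflTransGen (RowStep adj lab) v u}

theorem LabelRel.trans_row {p q r : Sym Q Γ → Sym Q Γ → Prop} {x y z : Option (NodeLabel Q Γ)}
    (h : ∀ a b c, p a b → q a c → r b c) (hxy : LabelRel p x y) (hxz : LabelRel q x z) :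
    LabelRel r y z := by
  obtain ⟨e, j, a, j', b, rfl, rfl, hp⟩ := hxy
  obtain ⟨e₁, j₁, a₁, j₁', b₁, h1, rfl, hq⟩ := hxz
  simp only [Option.some.injEq, Prod.mk.injEq] at h1
  obtain ⟨rfl, rfl, rfl⟩ := h1
  exact ⟨_, _, _, _, _, rfl, rfl, h _ _ _ hp hq⟩

variable (hsymm : ∀ u v, adj u v → adj v u) (hok : ∀ v, lab v ≠ none → Valid M adj lab v)
include hsymm hok

omit hsymm hok in
theorem LabelRel.ne_none {p : Sym Q Γ → Sym Q Γ → Prop} {x y : Option (NodeLabel Q Γ)}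
    (h : LabelRel p x y) : x ≠ none ∧ y ≠ none := by
  obtain ⟨e, j, a, j', b, rfl, rfl, hp⟩ := h
  simp

omit hsymm hok in
theorem IsChildLabel.ne_none {x y : Option (NodeLabel Q Γ)}
    (h : IsChildLabel x y) : x ≠ none ∧ y ≠ none := by
  rcases h with ⟨e, j, a, j', b, rfl, rfl, hp⟩ | ⟨e, j, a, j', b, rfl, rfl, hp⟩ <;> simp

omit hsymm in
theorem leaf_of_child {u v : V} (huv : adj u v) (h : IsChildLabel (lab u) (lab v)) :
    LabelIs (fun _ _ a => a.leaf = false) (lab u) := by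
  rcases (hok u h.ne_none.1).pair v huv with h1 | ⟨e, j, a, j', b, h1, h2, h3, h4⟩
  · exact absurd h1 h.ne_none.2
  · rw [h1, h2] at h
    refine ⟨e, j, a, h1, ?_⟩
    rcases h with ⟨_, _, _, _, _, h5, h6, h7⟩ | ⟨_, _, _, _, _, h5, h6, h7⟩ <;>
      simp only [Option.some.injEq, Prod.mk.injEq] at h5 h6 <;>
      obtain ⟨rfl, rfl, rfl⟩ := h5 <;> obtain ⟨-, rfl, rfl⟩ := h6
    exacts [(h3.left h7).1, (h3.right h7).1]

omit hsymm in
theorem leaf_of_row {u v : V} (huv : adj u v) (h : LabelRel Sym.IsRow (lab u) (lab v)) :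
    LabelIs (fun _ _ a => a.leaf = false) (lab u) ↔ LabelIs (fun _ _ a => a.leaf = false) (lab v) := by
  have hn : lab u ≠ none ∧ lab v ≠ none := by
    obtain ⟨_, _, _, _, _, h1, h2, _⟩ := h; simp [h1, h2]
  rcases (hok u hn.1).pair v huv with h1 | ⟨e, j, a, j', b, h1, h2, h3, h4⟩
  · exact absurd h1 hn.2
  · rw [h1, h2] at h
    obtain ⟨_, _, _, _, _, h5, h6, h7⟩ := h
    simp only [Option.some.injEq, Prod.mk.injEq] at h5 h6
    obtain ⟨rfl, rfl, rfl⟩ := h5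
    obtain ⟨-, rfl, rfl⟩ := h6
    have := (h3.row h7).1
    simp only [LabelIs, h1, h2, Option.some.injEq, Prod.mk.injEq]
    constructor
    · rintro ⟨_, _, _, ⟨rfl, rfl, rfl⟩, h⟩; exact ⟨_, _, _, ⟨rfl, rfl, rfl⟩, this.trans h⟩
    · rintro ⟨_, _, _, ⟨rfl, rfl, rfl⟩, h⟩; exact ⟨_, _, _, ⟨rfl, rfl, rfl⟩, this.symm.trans h⟩

omit hok in
theorem RowStep.symm {u w : V} (h : RowStep adj lab u w) : RowStep adj lab w u :=
  ⟨hsymm _ _ h.1, h.2.symm⟩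

omit hok in
theorem rowOf_symm {u w : V} (h : Relation.ReflTransGen (RowStep adj lab) u w) :
    Relation.ReflTransGen (RowStep adj lab) w u :=
  h.rec .refl fun _ h ih => .head (RowStep.symm hsymm h) ih

/-- The children of a node are neighbours in their row. -/
theorem kids_same {u x y : V} (hx : adj u x) (hy : adj u y)
    (hx' : IsChildLabel (lab u) (lab x)) (hy' : IsChildLabel (lab u) (lab y)) :
    Relation.ReflTransGen (RowStep adj lab) x y := by
  have hu := hok u hx'.ne_none.1
  have key : ∀ x y, adj u x → adj u y → LabelRel Sym.IsLeft (lab u) (lab x) →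
      LabelRel Sym.IsRight (lab u) (lab y) → RowStep adj lab x y := fun x y hx hy h1 h2 =>
    ⟨hu.siblings x hx y hy h1 h2, Or.inl (LabelRel.trans_row
      (p := Sym.IsLeft) (q := Sym.IsRight) (fun _ _ _ h h' => h.isRow h') h1 h2)⟩
  have hl := leaf_of_child hok hx hx'
  obtain ⟨l, hl1, hl2⟩ := hu.left hl
  obtain ⟨r, hr1, hr2⟩ := hu.right hl
  have hlr := key l r hl1 hr1 hl2 hr2
  have : ∀ z, adj u z → IsChildLabel (lab u) (lab z) →
      Relation.ReflTransGen (RowStep adj lab) z l := by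
    rintro z hz (h | h)
    · exact .head (key z r hz hr1 h hr2) (.single (hlr.symm hsymm))
    · exact .single ((key l z hl1 hz hl2 h).symm hsymm)
  exact (this x hx hx').trans (rowOf_symm hsymm (this y hy hy'))

/-- The children of the nodes of one row belong to one row. -/
theorem kids_row {u w x y : V} (huw : Relation.ReflTransGen (RowStep adj lab) u w)
    (hx : adj u x) (hy : adj w y)
    (hx' : IsChildLabel (lab u) (lab x)) (hy' : IsChildLabel (lab w) (lab y)) :
    Relation.ReflTransGen (RowStep adj lab) x y := by
  have key : ∀ u w, adj u w → LabelRel Sym.IsRow (lab u) (lab w) → ∀ x y, adj u x → adj w y →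
      IsChildLabel (lab u) (lab x) → IsChildLabel (lab w) (lab y) →
      Relation.ReflTransGen (RowStep adj lab) x y := by
    intro u w huw h x y hx hy hx' hy'
    obtain ⟨r, hr1, hr2⟩ := (hok u hx'.ne_none.1).right (leaf_of_child hok hx hx')
    obtain ⟨l, hl1, hl2⟩ := (hok w hy'.ne_none.1).left (leaf_of_child hok hy hy')
    have hrl : RowStep adj lab r l := by
      refine ⟨(hok u hx'.ne_none.1).cousins r hr1 w huw hr2 h l hl1 hl2, Or.inl ?_⟩
      exact LabelRel.trans_row (p := fun a b => ∃ c, Sym.IsRow c a ∧ Sym.IsRight c b)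
        (q := Sym.IsLeft) (fun a b c ⟨d, h1, h2⟩ h3 => h2.isRow h1 h3)
        (by
          obtain ⟨e, j, a, j', b, h1, h2, h3⟩ := h
          rw [h1] at hr2
          obtain ⟨e₁, j₁, a₁, j₁', b₁, h1', h2', h3'⟩ := hr2
          simp only [Option.some.injEq, Prod.mk.injEq] at h1'
          obtain ⟨rfl, rfl, rfl⟩ := h1'
          exact ⟨_, _, _, _, _, h2, h2', _, h3, h3'⟩) hl2
    exact (kids_same hsymm hok hx hr1 hx' (Or.inr hr2)).trans
      (.head hrl (kids_same hsymm hok hl1 hy (Or.inl hl2) hy'))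
  induction huw using Relation.ReflTransGen.head_induction_on generalizing x with
  | refl => exact kids_same hsymm hok hx hy hx' hy'
  | @head u u' h _ ih =>
    obtain ⟨h1, h2 | h2⟩ := h
    · obtain ⟨z, hz1, hz2⟩ := (hok u' (by obtain ⟨_, _, _, _, _, _, h2, _⟩ := h2; simp [h2])).left
        ((leaf_of_row hok h1 h2).1 (leaf_of_child hok hx hx'))
      exact (key _ _ h1 h2 x z hx hz1 hx' (Or.inl hz2)).trans (ih hz1 (Or.inl hz2))
    · obtain ⟨z, hz1, hz2⟩ := (hok u' (by obtain ⟨_, _, _, _, _, h2, _, _⟩ := h2; simp [h2])).left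
        ((leaf_of_row hok (hsymm _ _ h1) h2).2 (leaf_of_child hok hx hx'))
      exact (rowOf_symm hsymm (key _ _ (hsymm _ _ h1) h2 z x hz1 hx (Or.inl hz2) hx')).trans
        (ih hz1 (Or.inl hz2))

theorem leaf_of_rowOf {u w : V} (huw : Relation.ReflTransGen (RowStep adj lab) u w)
    (h : LabelIs (fun _ _ a => a.leaf = false) (lab u)) :
    LabelIs (fun _ _ a => a.leaf = false) (lab w) := by
  induction huw with
  | refl => exact h
  | tail _ h' ih =>
    obtain ⟨h1, h2 | h2⟩ := h'
    · exact (leaf_of_row hok h1 h2).1 ih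
    · exact (leaf_of_row hok (hsymm _ _ h1) h2).2 ih

/-- Rows get longer from parents to children: left children of distinct nodes are distinct because
parents are unique, and there is a right child in addition. -/
theorem rowOf_lt [Finite V] {u v : V} (huv : adj u v) (h : IsChildLabel (lab u) (lab v)) :
    (rowOf adj lab u).ncard < (rowOf adj lab v).ncard := by
  have hleaf := leaf_of_child hok huv h
  have hex : ∀ w, ∃ x, w ∈ rowOf adj lab u → adj w x ∧ LabelRel Sym.IsLeft (lab w) (lab x) := by
    intro w
    by_cases hw : w ∈ rowOf adj lab u
    · have hl := leaf_of_rowOf hsymm hok hw hleaf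
      obtain ⟨x, hx⟩ := (hok w (by obtain ⟨_, _, _, h, _⟩ := hl; simp [h])).left hl
      exact ⟨x, fun _ => hx⟩
    · exact ⟨w, fun h => absurd h hw⟩
  choose f hf using hex
  obtain ⟨r, hr1, hr2⟩ := (hok u h.ne_none.1).right hleaf
  have hinj : Set.InjOn f (rowOf adj lab u) := by
    intro w hw w' hw' heq
    have h1 := hf w hw
    have h2 := hf w' hw'
    rw [← heq] at h2
    exact (hok (f w) (IsChildLabel.ne_none (Or.inl h1.2)).2).parent_unique w (hsymm _ _ h1.1) w'
      (hsymm _ _ h2.1) (Or.inl h1.2) (Or.inl h2.2)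
  rw [← hinj.ncard_image]
  refine Set.ncard_lt_ncard ⟨?_, ?_⟩ (Set.toFinite _)
  · rintro _ ⟨w, hw, rfl⟩
    exact kids_row hsymm hok hw huv (hf w hw).1 h (Or.inl (hf w hw).2)
  · intro hsub
    obtain ⟨w, hw, hwr⟩ := hsub (kids_same hsymm hok huv hr1 h (Or.inr hr2))
    have h1 := hf w hw
    rw [hwr] at h1
    have : w = u := (hok r (IsChildLabel.ne_none (Or.inr hr2)).2).parent_unique w (hsymm _ _ h1.1) u
      (hsymm _ _ hr1) (Or.inl h1.2) (Or.inr hr2)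
    subst this
    obtain ⟨e, j, a, j', b, h2, h3, h4⟩ := h1.2
    rw [h2, h3] at hr2
    obtain ⟨_, _, _, _, _, h5, h6, h7⟩ := hr2
    simp only [Option.some.injEq, Prod.mk.injEq] at h5 h6
    obtain ⟨rfl, rfl, rfl⟩ := h5
    obtain ⟨-, rfl, rfl⟩ := h6
    exact h4.not_isRight h7

/-- Every valid table has a root whose input is the program: going from child to parent, rows get
shorter, so a root is reached. -/
theorem exists_root [Finite V] (e : ℕ) {v : V} (hv : LabelIs (fun e' _ _ => e' = e) (lab v)) :
    ∃ r b, lab r = some (e, e, b) ∧ b.root = true := by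
  induction hn : (rowOf adj lab v).ncard using Nat.strong_induction_on generalizing v with
  | _ n ih =>
    obtain ⟨_, j, a, hv, rfl⟩ := hv
    have hV := hok v (by simp [hv])
    cases ha : a.root with
    | false =>
      obtain ⟨u, hu1, hu2⟩ := hV.parent ⟨_, _, _, hv, ha⟩
      refine ih _ (hn ▸ rowOf_lt hsymm hok (hsymm _ _ hu1) hu2) (v := u) ?_ rfl
      rw [hv] at hu2
      rcases hu2 with ⟨_, _, _, _, _, h5, h6, h7⟩ | ⟨_, _, _, _, _, h5, h6, h7⟩ <;>
        simp only [Option.some.injEq, Prod.mk.injEq] at h6 <;>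
        exact ⟨_, _, _, h5, h6.1.symm⟩
    | true =>
      rcases hV.root ⟨_, _, _, hv, ha⟩ with ⟨_, _, _, h1, h2⟩ | ⟨u, hu1, hu2, _, _, b, h1, rfl, h2⟩
      · rw [hv] at h1
        simp only [Option.some.injEq, Prod.mk.injEq] at h1
        obtain ⟨rfl, rfl, rfl⟩ := h1
        subst h2
        exact ⟨v, _, hv, ha⟩
      · rw [hv, h1] at hu2
        obtain ⟨_, _, _, _, _, h5, h6, h7⟩ := hu2
        simp only [Option.some.injEq, Prod.mk.injEq] at h5 h6
        obtain ⟨rfl, rfl, rfl⟩ := h5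
        obtain ⟨rfl, -, -⟩ := h6
        exact ⟨u, b, h1, h2⟩

end Sound

/-! ### Deletion and insertion along a row -/

section Rows
variable {Q Γ : Type} (M : Machine Q Γ)

namespace Machine

theorem spread_length (l : List (Option Γ)) : (spread l).length = 2 * l.length := by
  induction l with
  | nil => rfl
  | cons a l ih =>
    have : spread (a :: l) = a :: none :: spread l := rfl
    rw [this]; simp [ih]; omega

theorem spread_getD_even (l : List (Option Γ)) (i : ℕ) :
    (spread l).getD (2 * i) none = l.getD i none := by
  induction l generalizing i with
  | nil => simp [spread]
  | cons a l ih =>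
    have h : spread (a :: l) = a :: none :: spread l := rfl
    rw [h]
    cases i with
    | zero => rfl
    | succ i => rw [show 2 * (i + 1) = 2 * i + 1 + 1 by omega]; simpa using ih i

theorem spread_getD_odd (l : List (Option Γ)) (i : ℕ) :
    (spread l).getD (2 * i + 1) none = none := by
  induction l generalizing i with
  | nil => simp [spread]
  | cons a l ih =>
    have h : spread (a :: l) = a :: none :: spread l := rfl
    rw [h]
    cases i with
    | zero => rfl
    | succ i => rw [show 2 * (i + 1) + 1 = 2 * i + 1 + 1 + 1 by omega]; simpa using ih i

theorem eraseHit_length (c : Option Q) (l : List (Option Γ)) :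
    (M.eraseHit c l).length = l.length := by
  induction l with
  | nil => rfl
  | cons a l ih => simp only [eraseHit]; split <;> simp [ih]

theorem conf_length (m t : ℕ) : (M.conf m t).2.2.length + 1 = 2 ^ t := by
  induction t with
  | zero => rfl
  | succ t ih =>
    rw [conf_succ, step]
    simp only [List.length_cons, spread_length, eraseHit_length]
    omega

end Machine

/-- A search `k` that is passed along the list `l` from the guess `g` at the left border and
satisfies the local conditions confirms the guess and deletes the letter. -/
theorem scan (c : Option Q) (g : Option Γ) (l : List (Option Γ)) (k : ℕ → Option (Q × Option Γ))
    (h0 : k 0 = c.map fun q => (q, g))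
    (hk : ∀ i (h : i < l.length), k (i + 1) = if M.hit ((k i).map Prod.fst) l[i] then none else k i)
    (hfound : ∀ i (h : i < l.length), M.hit ((k i).map Prod.fst) l[i] = true →
      (k i).bind Prod.snd = l[i])
    (hlast : (k l.length).bind Prod.snd = none) :
    (∀ q, c = some q → g = M.firstHit c l) ∧
      ∀ i (h : i < l.length), (if M.hit ((k i).map Prod.fst) l[i] then none else l[i]) =
        (M.eraseHit c l).getD i none := by
  induction l generalizing k with
  | nil =>
    refine ⟨?_, by simp⟩
    rintro q rfl
    simpa [h0, Machine.firstHit] using hlast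
  | cons a l ih =>
    have hc : (k 0).map Prod.fst = c := by rw [h0]; cases c <;> rfl
    by_cases ha : M.hit c a = true
    · have hnone : ∀ i, i ≤ l.length → k (i + 1) = none := by
        intro i hi
        induction i with
        | zero => have := hk 0 (by simp); rw [this, hc]; simp [ha]
        | succ i ih' => rw [hk (i + 1) (by simp; omega), ih' (by omega)]; simp [Machine.hit]
      have hf := hfound 0 (by simp) (by rw [hc]; simpa using ha)
      refine ⟨?_, ?_⟩
      · rintro q rfl
        rw [Machine.firstHit, if_pos ha]
        simpa [h0] using hf
      · intro i h
        rw [Machine.eraseHit, if_pos ha]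
        cases i with
        | zero => simp [hc, ha]
        | succ i =>
          rw [hnone i (by simpa using Nat.le_of_lt h)]
          simp only [List.length_cons, Nat.add_lt_add_iff_right] at h
          simp [Machine.hit, h]
    · have h1 : k 1 = k 0 := by have := hk 0 (by simp); rw [this, hc]; simp [ha]
      obtain ⟨ih1, ih2⟩ := ih (fun i => k (i + 1)) (by simpa [h1] using h0)
        (fun i h => hk (i + 1) (by simpa using h)) (fun i h => hfound (i + 1) (by simpa using h))
        hlast
      rw [Machine.firstHit, if_neg ha, Machine.eraseHit, if_neg ha]
      refine ⟨ih1, ?_⟩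
      intro i h
      cases i with
      | zero => simp [hc, ha]
      | succ i => simpa using ih2 i (by simpa using h)

end Rows

/-! ### The run below a root -/

section Sound
variable {Q Γ : Type} {V : Type} {M : Machine Q Γ} {adj : V → V → Prop}
  {lab : V → Option (NodeLabel Q Γ)}

/-- The nodes `φ 0, …, φ (2 ^ t - 1)` form row `t` of the run of `M` on input `e`. -/
structure IsRunRow (M : Machine Q Γ) (adj : V → V → Prop) (lab : V → Option (NodeLabel Q Γ))
    (e t : ℕ) (φ : ℕ → V) (idx : ℕ → ℕ) (s : ℕ → Sym Q Γ) : Prop where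
  lab : ∀ i < 2 ^ t, lab (φ i) = some (e, idx i, s i)
  border : ∃ g, (s 0).cell = .inl ((M.conf e t).1, g)
  counter : idx 0 = (M.conf e t).2.1
  inner : ∀ i, i + 1 < 2 ^ t → (s (i + 1)).cell = .inr ((M.conf e t).2.2.getD i none)
  row : ∀ i, i + 1 < 2 ^ t → adj (φ i) (φ (i + 1)) ∧ Sym.IsRow (s i) (s (i + 1))
  last : (s (2 ^ t - 1)).last = true

theorem LabelRel.elim {p : Sym Q Γ → Sym Q Γ → Prop} {e j : ℕ} {a : Sym Q Γ}
    {y : Option (NodeLabel Q Γ)} (h : LabelRel p (some (e, j, a)) y) :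
    ∃ j' b, y = some (e, j', b) ∧ p a b := by
  obtain ⟨_, _, _, j', b, h1, h2, h3⟩ := h
  simp only [Option.some.injEq, Prod.mk.injEq] at h1
  obtain ⟨rfl, rfl, rfl⟩ := h1
  exact ⟨j', b, h2, h3⟩

theorem OkPairLabel.elim {e j e' j' : ℕ} {a b : Sym Q Γ}
    (h : OkPairLabel M (some (e, j, a)) (some (e', j', b))) :
    a.OkPair M (j == 0) b ∧ (Sym.IsLeft a b → j' = j - 1) := by
  rcases h with h | ⟨_, _, _, _, _, h1, h2, h3⟩
  · cases h
  · simp only [Option.some.injEq, Prod.mk.injEq] at h1 h2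
    obtain ⟨rfl, rfl, rfl⟩ := h1
    obtain ⟨rfl, rfl, rfl⟩ := h2
    exact h3

theorem LabelIs.elim {p : ℕ → ℕ → Sym Q Γ → Prop} {e j : ℕ} {a : Sym Q Γ}
    (h : LabelIs p (some (e, j, a))) : p e j a := by
  obtain ⟨_, _, _, h1, h3⟩ := h
  simp only [Option.some.injEq, Prod.mk.injEq] at h1
  obtain ⟨rfl, rfl, rfl⟩ := h1
  exact h3

variable (hok : ∀ v, lab v ≠ none → Valid M adj lab v)
include hok

/-- The children of a row that shows a configuration show the next configuration. -/
theorem IsRunRow.next {e t : ℕ} {φ : ℕ → V} {idx : ℕ → ℕ} {s : ℕ → Sym Q Γ}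
    (h : IsRunRow M adj lab e t φ idx s) (hrun : M.stopped (M.conf e t).1 = false) :
    ∃ φ' idx' s', IsRunRow M adj lab e (t + 1) φ' idx' s' ∧
      adj (φ 0) (φ' 0) ∧ IsChildLabel (lab (φ 0)) (lab (φ' 0)) := by
  have hpos : 0 < 2 ^ t := by positivity
  have hV : ∀ i < 2 ^ t, Valid M adj lab (φ i) := fun i hi => hok _ (by simp [h.lab i hi])
  have hone : ∀ i < 2 ^ t, (s i).OkOne M := fun i hi => by
    have := (hV i hi).one; rw [h.lab i hi] at this; exact this.elim
  have hrow : ∀ i, i + 1 < 2 ^ t →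
      (s (i + 1)).leaf = (s i).leaf ∧ (s (i + 1)).carry = (s i).out M := fun i hi => by
    have := (hV i (by omega)).pair _ (h.row i hi).1
    rw [h.lab _ (by omega), h.lab _ hi] at this
    exact this.elim.1.row (h.row i hi).2
  obtain ⟨g, hg⟩ := h.border
  have hleaf : ∀ i < 2 ^ t, (s i).leaf = false := by
    intro i hi
    induction i with
    | zero => exact (hone 0 hi).go_on _ _ hg hrun
    | succ i ih => rw [(hrow i hi).1]; exact ih (by omega)
  have hex : ∀ i, ∃ l r, i < 2 ^ t → (adj (φ i) l ∧ LabelRel Sym.IsLeft (lab (φ i)) (lab l)) ∧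
      (adj (φ i) r ∧ LabelRel Sym.IsRight (lab (φ i)) (lab r)) := by
    intro i
    by_cases hi : i < 2 ^ t
    · obtain ⟨l, hl⟩ := (hV i hi).left ⟨_, _, _, h.lab i hi, hleaf i hi⟩
      obtain ⟨r, hr⟩ := (hV i hi).right ⟨_, _, _, h.lab i hi, hleaf i hi⟩
      exact ⟨l, r, fun _ => ⟨hl, hr⟩⟩
    · exact ⟨φ 0, φ 0, fun h => absurd h hi⟩
  choose L R hLR using hex
  have hexL : ∀ i, ∃ j b, i < 2 ^ t → lab (L i) = some (e, j, b) ∧ Sym.IsLeft (s i) b ∧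
      (s i).leftCell M (idx i == 0) b.cell ∧ j = idx i - 1 := by
    intro i
    by_cases hi : i < 2 ^ t
    · obtain ⟨⟨h1, h2⟩, -⟩ := hLR i hi
      have h3 := (hV i hi).pair _ h1
      rw [h.lab i hi] at h2 h3
      obtain ⟨j, b, hb, hb'⟩ := h2.elim
      rw [hb] at h3
      exact ⟨j, b, fun _ => ⟨hb, hb', (h3.elim.1.left hb').2, h3.elim.2 hb'⟩⟩
    · exact ⟨0, s 0, fun h => absurd h hi⟩
  choose jL sL hL using hexL
  have hexR : ∀ i, ∃ j b, i < 2 ^ t → lab (R i) = some (e, j, b) ∧ Sym.IsRight (s i) b ∧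
      b.last = (s i).last ∧ b.cell = .inr ((s i).rightLetter M (idx i == 0)) := by
    intro i
    by_cases hi : i < 2 ^ t
    · obtain ⟨-, h1, h2⟩ := hLR i hi
      have h3 := (hV i hi).pair _ h1
      rw [h.lab i hi] at h2 h3
      obtain ⟨j, b, hb, hb'⟩ := h2.elim
      rw [hb] at h3
      exact ⟨j, b, fun _ => ⟨hb, hb', (h3.elim.1.right hb').2⟩⟩
    · exact ⟨0, s 0, fun h => absurd h hi⟩
  choose jR sR hR using hexR
  -- the search along the row
  set l := (M.conf e t).2.2 with hl
  have hlen : l.length + 1 = 2 ^ t := M.conf_length e t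
  have hget : ∀ i (h : i < l.length), l.getD i none = l[i] := fun i h => by simp [h]
  have hcell : ∀ i (hi : i < l.length), (s (i + 1)).cell = .inr l[i] := fun i hi => by
    rw [h.inner i (by omega), hget]
  have hcarry : ∀ i (hi : i < l.length), (s (i + 1)).carry = (s i).out M := fun i hi =>
    (hrow i (by omega)).2
  obtain ⟨hguess, herase⟩ := scan M (M.conf e t).1 g l (fun i => (s i).out M)
    (by simp [Sym.out, hg])
    (fun i hi => by
      rw [Sym.out, hcell i hi, hcarry i hi])
    (fun i hi => by
      have := (hone (i + 1) (by omega)).found _ (hcell i hi)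
      rw [hcarry i hi] at this
      exact this)
    (by
      have h1 := h.last
      rw [show 2 ^ t - 1 = l.length by omega] at h1
      exact (hone _ (by omega)).last h1)
  refine ⟨fun i => if i % 2 = 0 then L (i / 2) else R (i / 2),
    fun i => if i % 2 = 0 then jL (i / 2) else jR (i / 2),
    fun i => if i % 2 = 0 then sL (i / 2) else sR (i / 2), ?_, ?_⟩
  · have hconf := M.conf_succ e t
    rw [Machine.step] at hconf
    have hz : idx 0 = (M.conf e t).2.1 := h.counter
    constructor
    · intro i hi
      rw [pow_succ] at hi
      split
      · exact (hL _ (by omega)).1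
      · exact (hR _ (by omega)).1
    · have h1 := (hL 0 hpos).2.2.1
      rw [Sym.leftCell, hg] at h1
      obtain ⟨g', h1⟩ := h1
      refine ⟨g', ?_⟩
      simp only [Nat.zero_mod, Nat.zero_div, if_true, h1, hconf, ← hz]
      congr 2
      cases hc : (M.conf e t).1 with
      | none => rfl
      | some q => rw [← hc, ← hguess q hc]
    · simp only [Nat.zero_mod, Nat.zero_div, if_true, hconf, ← hz]
      exact (hL 0 hpos).2.2.2
    · intro i hi
      rw [pow_succ] at hi
      rw [hconf]
      rcases Nat.even_or_odd' i with ⟨i, rfl | rfl⟩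
      · rw [if_neg (by omega), show (2 * i + 1) / 2 = i by omega, (hR i (by omega)).2.2.2]
        congr 1
        cases i with
        | zero =>
          rw [Sym.rightLetter, hg, ← hz]
          simp only [Nat.mul_zero, List.getD_cons_zero]
          cases hc : (M.conf e t).1 with
          | none => rfl
          | some q => rw [← hc, ← hguess q hc]
        | succ i =>
          rw [Sym.rightLetter, h.inner i (by omega), show 2 * (i + 1) = 2 * i + 1 + 1 by omega,
            List.getD_cons_succ, Machine.spread_getD_odd]
      · rw [if_pos (by omega), show (2 * i + 1 + 1) / 2 = i + 1 by omega]
        have h1 := (hL (i + 1) (by omega)).2.2.1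
        rw [Sym.leftCell, hcell i (by omega), hcarry i (by omega)] at h1
        rw [h1, List.getD_cons_succ, Machine.spread_getD_even]
        exact congrArg _ (herase i (by omega))
    · intro i hi
      rw [pow_succ] at hi
      rcases Nat.even_or_odd' i with ⟨i, rfl | rfl⟩
      · simp only [show (2 * i) % 2 = 0 by omega, show (2 * i + 1) % 2 = 1 by omega, if_true,
          show (2 * i) / 2 = i by omega, show (2 * i + 1) / 2 = i by omega, one_ne_zero, if_false]
        have hi' : i < 2 ^ t := by omega
        exact ⟨(hV i hi').siblings _ (hLR i hi').1.1 _ (hLR i hi').2.1 (hLR i hi').1.2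
          (hLR i hi').2.2, (hL i hi').2.1.isRow (hR i hi').2.1⟩
      · simp only [show (2 * i + 1 + 1) % 2 = 0 by omega, show (2 * i + 1) % 2 = 1 by omega, if_true,
          show (2 * i + 1 + 1) / 2 = i + 1 by omega, show (2 * i + 1) / 2 = i by omega,
          one_ne_zero, if_false]
        have hi' : i + 1 < 2 ^ t := by omega
        have hi'' : i < 2 ^ t := by omega
        refine ⟨(hV i hi'').cousins _ (hLR i hi'').2.1 _ (h.row i hi').1 (hLR i hi'').2.2 ?_ _
          (hLR _ hi').1.1 (hLR _ hi').1.2, (hR i hi'').2.1.isRow (h.row i hi').2 (hL _ hi').2.1⟩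
        exact ⟨_, _, _, _, _, h.lab i hi'', h.lab _ hi', (h.row i hi').2⟩
    · rw [pow_succ, if_neg (by omega), show (2 ^ t * 2 - 1) / 2 = 2 ^ t - 1 by omega,
        (hR _ (by omega)).2.2.1]
      exact h.last
  · exact ⟨(hLR 0 hpos).1.1, Or.inl (hLR 0 hpos).1.2⟩

variable (hsymm : ∀ u v, adj u v → adj v u)
include hsymm

/-- If all nodes are valid, then the machine halts on the program `e` that occurs in a label,
and the number of nodes with this label exceeds the number of steps. Otherwise the rows below the
root would get longer for ever. -/
theorem halts_of_valid [Finite V] (e : ℕ) {v : V} (hv : LabelIs (fun e' _ _ => e' = e) (lab v)) :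
    ∃ T, M.stopped (M.conf e T).1 = true ∧
      T < {u | LabelIs (fun e' _ _ => e' = e) (lab u)}.ncard := by
  classical
  obtain ⟨r, b, hr, hb⟩ := exists_root hsymm hok e hv
  have hrow : ∀ t, (∀ t' < t, M.stopped (M.conf e t').1 = false) →
      ∃ φ idx s, IsRunRow M adj lab e t φ idx s ∧ t < (rowOf adj lab (φ 0)).ncard := by
    intro t
    induction t with
    | zero =>
      intro _
      have h1 := (hok r (by simp [hr])).one
      rw [hr] at h1
      obtain ⟨h2, h3⟩ := h1.elim.root hb
      refine ⟨fun _ => r, fun _ => e, fun _ => b, ⟨fun _ _ => hr, h3, rfl, ?_, ?_, h2⟩, ?_⟩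
      · intro i hi; simp at hi
      · intro i hi; simp at hi
      · exact (Set.ncard_pos (Set.toFinite _)).2 ⟨r, .refl⟩
    | succ t ih =>
      intro h
      obtain ⟨φ, idx, s, h1, h2⟩ := ih fun t' ht' => h t' (by omega)
      obtain ⟨φ', idx', s', h3, h4, h5⟩ := h1.next hok (h t (by omega))
      exact ⟨φ', idx', s', h3, lt_of_le_of_lt h2 (rowOf_lt hsymm hok h4 h5)⟩
  have hsub : ∀ t, (∀ t' < t, M.stopped (M.conf e t').1 = false) →
      t < {u | LabelIs (fun e' _ _ => e' = e) (lab u)}.ncard := by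
    intro t ht
    obtain ⟨φ, idx, s, h1, h2⟩ := hrow t ht
    refine h2.trans_le (Set.ncard_le_ncard ?_ (Set.toFinite _))
    intro u hu
    induction hu with
    | refl => exact ⟨_, _, _, h1.lab 0 (by positivity), rfl⟩
    | tail _ h ih =>
      rw [Set.mem_ofPred_eq] at ih
      obtain ⟨_, ⟨_, _, _, _, _, h5, h6, _⟩ | ⟨_, _, _, _, _, h5, h6, _⟩⟩ := h
      · rw [h5] at ih; exact ⟨_, _, _, h6, ih.elim⟩
      · rw [h6] at ih; exact ⟨_, _, _, h5, ih.elim⟩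
  by_cases hh : ∃ T, M.stopped (M.conf e T).1 = true
  · refine ⟨Nat.find hh, Nat.find_spec hh, hsub _ fun t' ht' => ?_⟩
    simpa using Nat.find_min hh ht'
  · push Not at hh
    exact absurd (hsub _ fun t' _ => by simpa using hh t') (lt_irrefl _)

end Sound

/-! ### The local conditions are decidable -/

section Encoding
variable {Q Γ : Type}

instance [Finite Q] [Finite Γ] : Finite (Sym Q Γ) :=
  Finite.of_injective (fun a : Sym Q Γ => (a.lev, a.pos, a.root, a.last, a.leaf, a.cell, a.carry))
    fun a b h => by cases a; cases b; simpa using h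

/-- An arbitrary coding of a finite type. -/
@[reducible]
noncomputable def primcodableOfFinite (α : Type) [Finite α] : Primcodable α :=
  Primcodable.ofEquiv _ (Finite.equivFin α)

noncomputable instance [Finite Q] [Finite Γ] : Primcodable (Sym Q Γ) := primcodableOfFinite _

variable [Finite Q] [Finite Γ]

/-- A label as a bit string: its code in unary. The value `none` stands for a node outside all
tables. -/
noncomputable def encodeLabel (x : Option (NodeLabel Q Γ)) : BitString :=
  List.replicate (Encodable.encode x) true

/-- The label that a bit string stands for, where meaningless strings stand for `none`. -/
noncomputable def decodeLabel (w : BitString) : Option (NodeLabel Q Γ) :=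
  (Encodable.decode (α := Option (NodeLabel Q Γ)) w.length).bind id

theorem decode_encodeLabel (x : Option (NodeLabel Q Γ)) : decodeLabel (encodeLabel x) = x := by
  simp [decodeLabel, encodeLabel]

theorem primrec_decodeLabel : Primrec (decodeLabel (Q := Q) (Γ := Γ)) :=
  Primrec.option_bind (Primrec.decode.comp Primrec.list_length) Primrec.snd

theorem primrec_replicate_true : Primrec fun n : ℕ => List.replicate n true := by
  refine (Primrec.list_map Primrec.list_range (Primrec.const true).to₂).of_eq fun n => ?_
  simp

theorem primrec_encodeLabel : Primrec (encodeLabel (Q := Q) (Γ := Γ)) :=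
  primrec_replicate_true.comp Primrec.encode

end Encoding

section PrimrecLemmas
variable {α β : Type*} [Primcodable α] [Primcodable β]

theorem primrecPred_of_finite [Finite α] (p : α → Prop) : PrimrecPred p :=
  ⟨Classical.decPred _, Primrec.dom_finite _⟩

theorem _root_.PrimrecPred.imp {p q : α → Prop} (hp : PrimrecPred p) (hq : PrimrecPred q) :
    PrimrecPred fun a => p a → q a :=
  (hp.not.or hq).of_eq fun a => by by_cases h : p a <;> simp [h]

theorem _root_.PrimrecPred.ball_lt {N : α → ℕ} (hN : Primrec N) {R : α → ℕ → Prop}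
    (hR : PrimrecPred fun p : α × ℕ => R p.1 p.2) : PrimrecPred fun a => ∀ i < N a, R a i :=
  ((PrimrecRel.forall_mem_list (R := fun (i : ℕ) a => R a i)
    (hR.comp (Primrec.snd.pair Primrec.fst)).primrecRel).comp (Primrec.list_range.comp hN)
      Primrec.id).of_eq fun a => by simp

theorem _root_.PrimrecPred.bex_lt {N : α → ℕ} (hN : Primrec N) {R : α → ℕ → Prop}
    (hR : PrimrecPred fun p : α × ℕ => R p.1 p.2) : PrimrecPred fun a => ∃ i < N a, R a i :=
  ((PrimrecRel.exists_mem_list (R := fun (i : ℕ) a => R a i)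
    (hR.comp (Primrec.snd.pair Primrec.fst)).primrecRel).comp (Primrec.list_range.comp hN)
      Primrec.id).of_eq fun a => by simp

theorem _root_.PrimrecPred.exists_some {p : α → Prop} (hp : PrimrecPred p) :
    PrimrecPred fun x : Option α => ∃ a, x = some a ∧ p a := by
  classical
  have : Primrec fun x : Option α => x.bind fun a => if p a then some () else none :=
    Primrec.option_bind Primrec.id
      (Primrec.ite (hp.comp Primrec.snd) (Primrec.const (some ())) (Primrec.const none))
  refine (Primrec.eq.comp this (Primrec.const (some ()))).of_eq fun x => ?_
  rcases x with _ | a <;> simp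

theorem _root_.PrimrecPred.exists_some₂ {p : α → α → Prop} (hp : PrimrecPred fun a : α × α => p a.1 a.2) :
    PrimrecPred fun x : Option α × Option α => ∃ a b, x.1 = some a ∧ x.2 = some b ∧ p a b := by
  classical
  have : Primrec fun x : Option α × Option α =>
      x.1.bind fun a => x.2.bind fun b => if p a b then some () else none :=
    Primrec.option_bind Primrec.fst (Primrec.option_bind (Primrec.snd.comp Primrec.fst)
      (Primrec.ite (hp.comp ((Primrec.snd.comp Primrec.fst).pair Primrec.snd))
        (Primrec.const (some ())) (Primrec.const none)))
  refine (Primrec.eq.comp this (Primrec.const (some ()))).of_eq fun x => ?_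
  rcases x with ⟨_ | a, _ | b⟩ <;> simp

end PrimrecLemmas

section Check
variable {Q Γ : Type} [Finite Q] [Finite Γ] (M : Machine Q Γ)

theorem primrecPred_labelIs {p : ℕ → ℕ → Sym Q Γ → Prop}
    (hp : PrimrecPred fun x : NodeLabel Q Γ => p x.1 x.2.1 x.2.2) : PrimrecPred (LabelIs p) :=
  hp.exists_some.of_eq fun x => by
    constructor
    · rintro ⟨⟨e, j, a⟩, h⟩; exact ⟨e, j, a, h⟩
    · rintro ⟨e, j, a, h⟩; exact ⟨⟨e, j, a⟩, h⟩

theorem primrecPred_labelRel (p : Sym Q Γ → Sym Q Γ → Prop) :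
    PrimrecPred fun x : Option (NodeLabel Q Γ) × Option (NodeLabel Q Γ) => LabelRel p x.1 x.2 := by
  have h : PrimrecPred fun x : NodeLabel Q Γ × NodeLabel Q Γ => x.1.1 = x.2.1 ∧ p x.1.2.2 x.2.2.2 :=
    (Primrec.eq.comp (Primrec.fst.comp Primrec.fst) (Primrec.fst.comp Primrec.snd)).and
      ((primrecPred_of_finite fun x : Sym Q Γ × Sym Q Γ => p x.1 x.2).comp
        (((Primrec.snd.comp Primrec.snd).comp Primrec.fst).pair
          ((Primrec.snd.comp Primrec.snd).comp Primrec.snd)))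
  refine (PrimrecPred.exists_some₂ (p := fun a b => a.1 = b.1 ∧ p a.2.2 b.2.2) h).of_eq fun x => ?_
  constructor
  · rintro ⟨⟨e, j, a⟩, ⟨e', j', b⟩, h1, h2, h3, h4⟩
    dsimp only at h3 h4
    subst h3
    exact ⟨_, _, _, _, _, h1, h2, h4⟩
  · rintro ⟨e, j, a, j', b, h1, h2, h3⟩
    exact ⟨_, _, h1, h2, rfl, h3⟩

theorem primrecPred_okPairLabel : PrimrecPred
    fun x : Option (NodeLabel Q Γ) × Option (NodeLabel Q Γ) => OkPairLabel M x.1 x.2 := by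
  have e1 : Primrec fun x : NodeLabel Q Γ × NodeLabel Q Γ => (x.1.2.2, x.2.2.2) :=
    ((Primrec.snd.comp Primrec.snd).comp Primrec.fst).pair
          ((Primrec.snd.comp Primrec.snd).comp Primrec.snd)
  have e2 : Primrec fun x : NodeLabel Q Γ × NodeLabel Q Γ => x.1.2.1 :=
    (Primrec.fst.comp Primrec.snd).comp Primrec.fst
  have e3 : Primrec fun x : NodeLabel Q Γ × NodeLabel Q Γ => x.2.2.1 :=
    (Primrec.fst.comp Primrec.snd).comp Primrec.snd
  have e4 : Primrec fun x : NodeLabel Q Γ × NodeLabel Q Γ => (x.1.2.1 == 0) :=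
    Primrec.beq.comp e2 (Primrec.const 0)
  have h : PrimrecPred fun x : NodeLabel Q Γ × NodeLabel Q Γ => x.1.1 = x.2.1 ∧
      x.1.2.2.OkPair M (x.1.2.1 == 0) x.2.2.2 ∧
      (Sym.IsLeft x.1.2.2 x.2.2.2 → x.2.2.1 = x.1.2.1 - 1) :=
    (Primrec.eq.comp (Primrec.fst.comp Primrec.fst) (Primrec.fst.comp Primrec.snd)).and
      (((primrecPred_of_finite fun x : Bool × Sym Q Γ × Sym Q Γ => x.2.1.OkPair M x.1 x.2.2).comp
        (e4.pair e1)).and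
        (((primrecPred_of_finite fun x : Sym Q Γ × Sym Q Γ => Sym.IsLeft x.1 x.2).comp e1).imp
          (Primrec.eq.comp e3 (Primrec.nat_sub.comp e2 (Primrec.const 1)))))
  have h0 : PrimrecPred fun x : Option (NodeLabel Q Γ) × Option (NodeLabel Q Γ) => x.2 = none :=
    Primrec.eq.comp Primrec.snd (Primrec.const none)
  refine (h0.or (PrimrecPred.exists_some₂ (p := fun a b : NodeLabel Q Γ => a.1 = b.1 ∧
      a.2.2.OkPair M (a.2.1 == 0) b.2.2 ∧
      (Sym.IsLeft a.2.2 b.2.2 → b.2.1 = a.2.1 - 1)) h)).of_eq fun x => ?_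
  refine or_congr Iff.rfl ?_
  constructor
  · rintro ⟨⟨e, j, a⟩, ⟨e', j', b⟩, h1, h2, h3, h4⟩
    dsimp only at h3 h4
    subst h3
    exact ⟨_, _, _, _, _, h1, h2, h4⟩
  · rintro ⟨e, j, a, j', b, h1, h2, h3⟩
    exact ⟨_, _, h1, h2, rfl, h3⟩

/-- The label of the `i`-th node in a description. -/
noncomputable def descLabel (D : Description (ℕ × BitString)) (i : ℕ) : Option (NodeLabel Q Γ) :=
  D.1[i]?.bind fun d => decodeLabel d.2

/-- Adjacency in a description. -/
def descAdj (D : Description (ℕ × BitString)) (i j : ℕ) : Prop :=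
  i < D.1.length ∧ j < D.1.length ∧ (D.2.getD i []).getD j false = true

theorem primrec_descLabel :
    Primrec fun p : Description (ℕ × BitString) × ℕ => descLabel (Q := Q) (Γ := Γ) p.1 p.2 :=
  Primrec.option_bind (Primrec.list_getElem?.comp (Primrec.fst.comp Primrec.fst) Primrec.snd)
    (primrec_decodeLabel.comp (Primrec.snd.comp Primrec.snd))

theorem primrecPred_descAdj :
    PrimrecPred fun p : Description (ℕ × BitString) × ℕ × ℕ => descAdj p.1 p.2.1 p.2.2 := by
  have hlen : Primrec fun p : Description (ℕ × BitString) × ℕ × ℕ => p.1.1.length :=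
    Primrec.list_length.comp (Primrec.fst.comp Primrec.fst)
  have hi : Primrec fun p : Description (ℕ × BitString) × ℕ × ℕ => p.2.1 :=
    Primrec.fst.comp Primrec.snd
  have hj : Primrec fun p : Description (ℕ × BitString) × ℕ × ℕ => p.2.2 :=
    Primrec.snd.comp Primrec.snd
  refine (Primrec.nat_lt.comp hi hlen).and ((Primrec.nat_lt.comp hj hlen).and
    (Primrec.eq.comp ?_ (Primrec.const true)))
  exact (Primrec.list_getD false).comp
    ((Primrec.list_getD []).comp (Primrec.snd.comp Primrec.fst) hi) hj

theorem descAdj_iff_ball {D : Description (ℕ × BitString)} {v : ℕ} {P : ℕ → Prop} :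
    (∀ u, descAdj D v u → P u) ↔ ∀ u < D.1.length, descAdj D v u → P u :=
  ⟨fun h u _ => h u, fun h u hu => h u hu.2.1 hu⟩

theorem descAdj_iff_bex {D : Description (ℕ × BitString)} {v : ℕ} {P : ℕ → Prop} :
    (∃ u, descAdj D v u ∧ P u) ↔ ∃ u < D.1.length, descAdj D v u ∧ P u :=
  ⟨fun ⟨u, h, h'⟩ => ⟨u, h.2.1, h, h'⟩, fun ⟨u, _, h⟩ => ⟨u, h⟩⟩

theorem primrecPred_valid :
    PrimrecPred fun D => Valid M (descAdj D) (descLabel D) 0 := by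
  -- bounded quantifiers over neighbours
  have hball : ∀ {β : Type} [Primcodable β] {δ : β → Description (ℕ × BitString)} {v : β → ℕ}
      {P : β → ℕ → Prop}, Primrec δ → Primrec v → PrimrecPred (fun p : β × ℕ => P p.1 p.2) →
      PrimrecPred fun b => ∀ u, descAdj (δ b) (v b) u → P b u := by
    intro β _ δ v P hδ hv hP
    refine (PrimrecPred.ball_lt (N := fun b => (δ b).1.length)
      (Primrec.list_length.comp (Primrec.fst.comp hδ))
      (R := fun b u => descAdj (δ b) (v b) u → P b u) (PrimrecPred.imp ?_ hP)).of_eq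
        fun b => descAdj_iff_ball.symm
    exact primrecPred_descAdj.comp ((hδ.comp Primrec.fst).pair
      ((hv.comp Primrec.fst).pair Primrec.snd))
  have hbex : ∀ {β : Type} [Primcodable β] {δ : β → Description (ℕ × BitString)} {v : β → ℕ}
      {P : β → ℕ → Prop}, Primrec δ → Primrec v → PrimrecPred (fun p : β × ℕ => P p.1 p.2) →
      PrimrecPred fun b => ∃ u, descAdj (δ b) (v b) u ∧ P b u := by
    intro β _ δ v P hδ hv hP
    refine (PrimrecPred.bex_lt (N := fun b => (δ b).1.length)
      (Primrec.list_length.comp (Primrec.fst.comp hδ))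
      (R := fun b u => descAdj (δ b) (v b) u ∧ P b u) (PrimrecPred.and ?_ hP)).of_eq
        fun b => descAdj_iff_bex.symm
    exact primrecPred_descAdj.comp ((hδ.comp Primrec.fst).pair
      ((hv.comp Primrec.fst).pair Primrec.snd))
  have hrel : ∀ {β : Type} [Primcodable β] {δ : β → Description (ℕ × BitString)} {u w : β → ℕ}
      (p : Sym Q Γ → Sym Q Γ → Prop), Primrec δ → Primrec u → Primrec w →
      PrimrecPred fun b => LabelRel p (descLabel (δ b) (u b)) (descLabel (δ b) (w b)) :=
    fun p hδ hu hw => (primrecPred_labelRel p).comp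
      ((primrec_descLabel.comp (hδ.pair hu)).pair (primrec_descLabel.comp (hδ.pair hw)))
  have hchild : ∀ {β : Type} [Primcodable β] {δ : β → Description (ℕ × BitString)} {u w : β → ℕ},
      Primrec δ → Primrec u → Primrec w → PrimrecPred fun b =>
        IsChildLabel (Q := Q) (Γ := Γ) (descLabel (δ b) (u b)) (descLabel (δ b) (w b)) :=
    fun hδ hu hw => (hrel _ hδ hu hw).or (hrel _ hδ hu hw)
  have his : ∀ {β : Type} [Primcodable β] {δ : β → Description (ℕ × BitString)} {u : β → ℕ}
      {p : ℕ → ℕ → Sym Q Γ → Prop}, PrimrecPred (fun x : NodeLabel Q Γ => p x.1 x.2.1 x.2.2) →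
      Primrec δ → Primrec u → PrimrecPred fun b => LabelIs p (descLabel (δ b) (u b)) :=
    fun hp hδ hu => (primrecPred_labelIs hp).comp (primrec_descLabel.comp (hδ.pair hu))
  have hsym : ∀ p : Sym Q Γ → Prop, PrimrecPred fun x : NodeLabel Q Γ => p x.2.2 := fun p =>
    (primrecPred_of_finite p).comp (Primrec.snd.comp Primrec.snd)
  have id1 {β : Type} [Primcodable β] : Primrec fun b : β => b := Primrec.id
  have c0 {β : Type} [Primcodable β] : Primrec fun _ : β => (0 : ℕ) := Primrec.const 0
  have f1 {β γ : Type} [Primcodable β] [Primcodable γ] : Primrec fun b : β × γ => b.1 := Primrec.fst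
  have f2 {β γ : Type} [Primcodable β] [Primcodable γ] : Primrec fun b : β × γ => b.2 := Primrec.snd
  have p1 := his (u := fun _ => 0) (p := fun _ _ a => a.OkOne M) (hsym fun a => a.OkOne M) id1 c0
  have p2 := hball (v := fun _ => 0) id1 c0 (P := fun D u => OkPairLabel M (descLabel D 0) (descLabel D u))
    ((primrecPred_okPairLabel M).comp
      ((primrec_descLabel.comp (f1.pair c0)).pair primrec_descLabel))
  have p3 := (his (u := fun _ => 0) (p := fun _ _ a => a.root = false)
    (hsym fun a => a.root = false) id1 c0).imp
    (hbex (v := fun _ => 0) id1 c0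
      (P := fun D u => IsChildLabel (Q := Q) (Γ := Γ) (descLabel D u) (descLabel D 0)) (hchild f1 f2 c0))
  have p4 := hball (v := fun _ => 0) id1 c0 (P := fun D u => ∀ w, descAdj D 0 w →
      IsChildLabel (Q := Q) (Γ := Γ) (descLabel D u) (descLabel D 0) →
      IsChildLabel (Q := Q) (Γ := Γ) (descLabel D w) (descLabel D 0) → u = w)
    (hball (β := Description (ℕ × BitString) × ℕ) (δ := fun b => b.1) (v := fun _ => 0) f1 c0
      (P := fun b w => IsChildLabel (Q := Q) (Γ := Γ) (descLabel b.1 b.2) (descLabel b.1 0) →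
        IsChildLabel (Q := Q) (Γ := Γ) (descLabel b.1 w) (descLabel b.1 0) → b.2 = w)
      ((hchild (f1.comp f1) (f2.comp f1) c0).imp ((hchild (f1.comp f1) f2 c0).imp
        (Primrec.eq.comp (f2.comp f1) f2))))
  have p5 : ∀ p : Sym Q Γ → Sym Q Γ → Prop, _ := fun p =>
    (his (u := fun _ => 0) (p := fun _ _ a => a.leaf = false)
    (hsym fun a => a.leaf = false) id1 c0).imp
    (hbex (v := fun _ => 0) id1 c0
      (P := fun D u => LabelRel p (descLabel D 0) (descLabel D u)) (hrel p f1 c0 f2))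
  have p7 := hball (v := fun _ => 0) id1 c0 (P := fun D u => ∀ w, descAdj D 0 w →
      LabelRel (Sym.IsLeft (Q := Q) (Γ := Γ)) (descLabel D 0) (descLabel D u) →
      LabelRel (Sym.IsRight (Q := Q) (Γ := Γ)) (descLabel D 0) (descLabel D w) → descAdj D u w)
    (hball (β := Description (ℕ × BitString) × ℕ) (δ := fun b => b.1) (v := fun _ => 0) f1 c0
      (P := fun b w => LabelRel (Sym.IsLeft (Q := Q) (Γ := Γ)) (descLabel b.1 0) (descLabel b.1 b.2) →
        LabelRel (Sym.IsRight (Q := Q) (Γ := Γ)) (descLabel b.1 0) (descLabel b.1 w) →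
          descAdj b.1 b.2 w)
      ((hrel _ (f1.comp f1) c0 (f2.comp f1)).imp ((hrel _ (f1.comp f1) c0 f2).imp
        (primrecPred_descAdj.comp ((f1.comp f1).pair ((f2.comp f1).pair f2))))))
  have p8 := hball (v := fun _ => 0) id1 c0 (P := fun D u => ∀ w, descAdj D 0 w →
      LabelRel (Sym.IsRight (Q := Q) (Γ := Γ)) (descLabel D 0) (descLabel D u) →
      LabelRel (Sym.IsRow (Q := Q) (Γ := Γ)) (descLabel D 0) (descLabel D w) →
      ∀ x, descAdj D w x → LabelRel (Sym.IsLeft (Q := Q) (Γ := Γ)) (descLabel D w) (descLabel D x) →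
        descAdj D u x)
    (hball (β := Description (ℕ × BitString) × ℕ) (δ := fun b => b.1) (v := fun _ => 0) f1 c0
      (P := fun b w => LabelRel (Sym.IsRight (Q := Q) (Γ := Γ)) (descLabel b.1 0) (descLabel b.1 b.2) →
        LabelRel (Sym.IsRow (Q := Q) (Γ := Γ)) (descLabel b.1 0) (descLabel b.1 w) →
        ∀ x, descAdj b.1 w x →
          LabelRel (Sym.IsLeft (Q := Q) (Γ := Γ)) (descLabel b.1 w) (descLabel b.1 x) →
          descAdj b.1 b.2 x)
      ((hrel _ (f1.comp f1) c0 (f2.comp f1)).imp ((hrel _ (f1.comp f1) c0 f2).imp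
        (hball (β := (Description (ℕ × BitString) × ℕ) × ℕ) (δ := fun b => b.1.1) (v := fun b => b.2)
          (f1.comp f1) f2
          (P := fun b x => LabelRel (Sym.IsLeft (Q := Q) (Γ := Γ)) (descLabel b.1.1 b.2)
            (descLabel b.1.1 x) → descAdj b.1.1 b.1.2 x)
          ((hrel _ (f1.comp (f1.comp f1)) (f2.comp f1) f2).imp
            (primrecPred_descAdj.comp
              ((f1.comp (f1.comp f1)).pair ((f2.comp (f1.comp f1)).pair f2))))))))
  have e1 : PrimrecPred fun x : NodeLabel Q Γ => x.2.1 = x.1 :=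
    Primrec.eq.comp (f1.comp f2) f1
  have p9 := (his (u := fun _ => 0) (p := fun _ _ a => a.root = true)
    (hsym fun a => a.root = true) id1 c0).imp
    ((his (u := fun _ => 0) (p := fun e j _ => j = e) e1 id1 c0).or
    (hbex (v := fun _ => 0) id1 c0
      (P := fun D u => LabelRel (Q := Q) (Γ := Γ) (fun _ _ => True) (descLabel D 0) (descLabel D u) ∧
        LabelIs (Q := Q) (Γ := Γ) (fun e j a => j = e ∧ a.root = true) (descLabel D u))
      ((hrel _ f1 c0 f2).and (his (p := fun e j a => j = e ∧ a.root = true)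
        (e1.and (hsym fun a => a.root = true)) f1 f2))))
  refine (p1.and (p2.and (p3.and (p4.and ((p5 Sym.IsLeft).and ((p5 Sym.IsRight).and
    (p7.and (p8.and p9)))))))).of_eq fun D => ?_
  constructor
  · rintro ⟨h1, h2, h3, h4, h5, h6, h7, h8, h9⟩
    exact ⟨h1, h2, h3, h4, h5, h6, h7, h8, h9⟩
  · rintro ⟨h1, h2, h3, h4, h5, h6, h7, h8, h9⟩
    exact ⟨h1, h2, h3, h4, h5, h6, h7, h8, h9⟩

end Check

/-! ### The language is in `LD` -/

section Transport
variable {Q Γ : Type} {M : Machine Q Γ}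

/-- Validity of a node depends only on its radius-2 neighbourhood. -/
theorem Valid.transport {V W : Type} {adj : V → V → Prop} {lab : V → Option (NodeLabel Q Γ)}
    {adj' : W → W → Prop} {lab' : W → Option (NodeLabel Q Γ)} {v : V} {w : W} (R : V → W → Prop)
    (hlab : ∀ {x j}, R x j → lab x = lab' j)
    (hadj : ∀ {x j y k}, R x j → R y k → (adj x y ↔ adj' j k))
    (huniq : ∀ {x j y k}, R x j → R y k → (x = y ↔ j = k)) (h0 : R v w)
    (forth : ∀ y, adj v y → ∃ k, R y k) (back : ∀ k, adj' w k → ∃ y, R y k)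
    (back₂ : ∀ k, adj' w k → ∀ m, adj' k m → ∃ y, R y m)
    (h : Valid M adj lab v) : Valid M adj' lab' w where
  one := hlab h0 ▸ h.one
  pair k hk := by
    obtain ⟨y, hy⟩ := back k hk
    have := h.pair y ((hadj h0 hy).2 hk)
    rwa [hlab h0, hlab hy] at this
  parent hr := by
    obtain ⟨y, hy, hc⟩ := h.parent (hlab h0 ▸ hr)
    obtain ⟨k, hk⟩ := forth y hy
    refine ⟨k, (hadj h0 hk).1 hy, ?_⟩
    rwa [← hlab h0, ← hlab hk]
  parent_unique k hk k' hk' h1 h2 := by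
    obtain ⟨y, hy⟩ := back k hk
    obtain ⟨y', hy'⟩ := back k' hk'
    rw [← hlab h0, ← hlab hy] at h1
    rw [← hlab h0, ← hlab hy'] at h2
    exact (huniq hy hy').1 (h.parent_unique y ((hadj h0 hy).2 hk) y' ((hadj h0 hy').2 hk') h1 h2)
  left hr := by
    obtain ⟨y, hy, hc⟩ := h.left (hlab h0 ▸ hr)
    obtain ⟨k, hk⟩ := forth y hy
    refine ⟨k, (hadj h0 hk).1 hy, ?_⟩
    rwa [← hlab h0, ← hlab hk]
  right hr := by
    obtain ⟨y, hy, hc⟩ := h.right (hlab h0 ▸ hr)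
    obtain ⟨k, hk⟩ := forth y hy
    refine ⟨k, (hadj h0 hk).1 hy, ?_⟩
    rwa [← hlab h0, ← hlab hk]
  siblings k hk k' hk' h1 h2 := by
    obtain ⟨y, hy⟩ := back k hk
    obtain ⟨y', hy'⟩ := back k' hk'
    rw [← hlab h0, ← hlab hy] at h1
    rw [← hlab h0, ← hlab hy'] at h2
    exact (hadj hy hy').1 (h.siblings y ((hadj h0 hy).2 hk) y' ((hadj h0 hy').2 hk') h1 h2)
  cousins k hk k' hk' h1 h2 m hm h3 := by
    obtain ⟨y, hy⟩ := back k hk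
    obtain ⟨y', hy'⟩ := back k' hk'
    obtain ⟨z, hz⟩ := back₂ k' hk' m hm
    rw [← hlab h0, ← hlab hy] at h1
    rw [← hlab h0, ← hlab hy'] at h2
    rw [← hlab hy', ← hlab hz] at h3
    exact (hadj hy hz).1 (h.cousins y ((hadj h0 hy).2 hk) y' ((hadj h0 hy').2 hk') h1 h2 z
      ((hadj hy' hz).2 hm) h3)
  root hr := by
    rcases h.root (hlab h0 ▸ hr) with h1 | ⟨y, hy, h1, h2⟩
    · exact .inl (hlab h0 ▸ h1)
    · obtain ⟨k, hk⟩ := forth y hy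
      refine .inr ⟨k, (hadj h0 hk).1 hy, ?_, ?_⟩
      · rwa [← hlab h0, ← hlab hk]
      · rwa [← hlab hk]

variable [Finite Q] [Finite Γ]

/-- The label of a node, read as a label of a binary table (`none` for a node outside). -/
noncomputable def LabelledGraph.tableLabel (G : LabelledGraph) (v : G.Node) :
    Option (NodeLabel Q Γ) := decodeLabel (G.label v)

theorem ListsBall.getElem?_zero {G : LabelledGraph} {r : ℕ} {v : G.Node} {l : List G.Node}
    (h : ListsBall G r v l) : l[0]? = some v := by
  rw [← List.head?_eq_getElem?]; exact h.head

theorem descAdj_describe {G : LabelledGraph} {d : G.Node → ℕ × BitString} {l : List G.Node}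
    {i j : ℕ} : descAdj (describe G d l) i j ↔
      ∃ u w, l[i]? = some u ∧ l[j]? = some w ∧ G.graph.Adj u w := by
  simp only [descAdj, describe, List.length_map]
  constructor
  · rintro ⟨hi, hj, h⟩
    refine ⟨l[i], l[j], by simp [hi], by simp [hj], ?_⟩
    simpa [List.getD_eq_getElem?_getD, hi, hj] using h
  · rintro ⟨u, w, hu, hw, h⟩
    obtain ⟨hi, rfl⟩ := List.getElem?_eq_some_iff.1 hu
    obtain ⟨hj, rfl⟩ := List.getElem?_eq_some_iff.1 hw
    exact ⟨hi, hj, by simpa [List.getD_eq_getElem?_getD, hi, hj] using h⟩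

theorem descLabel_describe {G : LabelledGraph} {ident : G.Node → ℕ} {l : List G.Node}
    {i : ℕ} {u : G.Node} (h : l[i]? = some u) :
    descLabel (Q := Q) (Γ := Γ) (describe G (plainData G ident) l) i = G.tableLabel u := by
  simp [descLabel, describe, h, plainData, LabelledGraph.tableLabel]

theorem valid_describe {G : LabelledGraph} {ident : G.Node → ℕ} {v : G.Node} {l : List G.Node}
    (hl : ListsBall G 2 v l) :
    Valid M (descAdj (describe G (plainData G ident) l))
      (descLabel (describe G (plainData G ident) l)) 0 ↔ Valid M G.graph.Adj G.tableLabel v := by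
  have hadj : ∀ {x : G.Node} {j : ℕ} {y : G.Node} {k : ℕ}, l[j]? = some x → l[k]? = some y →
      (G.graph.Adj x y ↔ descAdj (describe G (plainData G ident) l) j k) := by
    intro x j y k hx hy
    rw [descAdj_describe]
    constructor
    · intro h; exact ⟨x, y, hx, hy, h⟩
    · rintro ⟨u, w, hu, hw, h⟩
      rw [hx, Option.some_inj] at hu
      rw [hy, Option.some_inj] at hw
      rwa [hu, hw]
  have huniq : ∀ {x : G.Node} {j : ℕ} {y : G.Node} {k : ℕ}, l[j]? = some x → l[k]? = some y →
      (x = y ↔ j = k) := by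
    intro x j y k hx hy
    obtain ⟨hj, rfl⟩ := List.getElem?_eq_some_iff.1 hx
    obtain ⟨hk, rfl⟩ := List.getElem?_eq_some_iff.1 hy
    exact hl.nodup.getElem_inj_iff
  have hmem : ∀ x, G.graph.dist v x ≤ 2 → ∃ j : ℕ, l[j]? = some x := fun x hx =>
    List.mem_iff_getElem?.1 ((hl.mem_iff x).2 hx)
  have h1 : ∀ y, G.graph.Adj v y → ∃ k : ℕ, l[k]? = some y := fun y hy =>
    hmem y ((SimpleGraph.dist_eq_one_iff_adj.2 hy).le.trans one_le_two)
  constructor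
  · refine Valid.transport (fun j x => l[j]? = some x)
      (fun h => descLabel_describe h) (fun hx hy => (hadj hx hy).symm)
      (fun hx hy => (huniq hx hy).symm) hl.getElem?_zero ?_ h1 ?_
    · intro j hj
      obtain ⟨u, w, -, hw, -⟩ := descAdj_describe.1 hj
      exact ⟨w, hw⟩
    · intro y hy z hz
      refine hmem z ?_
      exact (SimpleGraph.dist_le (.cons hy (.cons hz .nil)))
  · refine Valid.transport (fun x j => l[j]? = some x)
      (fun h => (descLabel_describe h).symm) hadj huniq hl.getElem?_zero h1 ?_ ?_
    · intro j hj
      obtain ⟨u, w, -, hw, -⟩ := descAdj_describe.1 hj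
      exact ⟨w, hw⟩
    · intro j _ k hj
      obtain ⟨u, w, -, hw, -⟩ := descAdj_describe.1 hj
      exact ⟨w, hw⟩

end Transport

section Simulation
variable {Q Γ : Type} [Primcodable Q] [Primcodable Γ] [Finite Q] [Finite Γ] (M : Machine Q Γ)

theorem Machine.primrec_firstHit :
    Primrec fun p : Option Q × List (Option Γ) => M.firstHit p.1 p.2 := by
  have hh : PrimrecPred fun x : Option Q × Option Γ => M.hit x.1 x.2 = true :=
    primrecPred_of_finite _
  refine (Primrec.list_foldr (f := fun p : Option Q × List (Option Γ) => p.2)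
    (g := fun _ => (none : Option Γ))
    (h := fun p x => if M.hit p.1 x.1 then x.1 else x.2) Primrec.snd (Primrec.const none)
    (Primrec.ite (hh.comp ((Primrec.fst.comp Primrec.fst).pair (Primrec.fst.comp Primrec.snd)))
      (Primrec.fst.comp Primrec.snd) (Primrec.snd.comp Primrec.snd))).of_eq ?_
  rintro ⟨c, l⟩
  induction l with
  | nil => rfl
  | cons a l ih => simp only [List.foldr_cons, Machine.firstHit] at ih ⊢; rw [ih]

theorem Machine.primrec_eraseHit :
    Primrec fun p : Option Q × List (Option Γ) => M.eraseHit p.1 p.2 := by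
  have hh : PrimrecPred fun x : Option Q × Option Γ => M.hit x.1 x.2 = true :=
    primrecPred_of_finite _
  refine (Primrec.list_rec (f := fun p : Option Q × List (Option Γ) => p.2)
    (g := fun _ => ([] : List (Option Γ)))
    (h := fun p x => if M.hit p.1 x.1 then none :: x.2.1 else x.1 :: x.2.2) Primrec.snd
      (Primrec.const [])
    (Primrec.ite (hh.comp ((Primrec.fst.comp Primrec.fst).pair (Primrec.fst.comp Primrec.snd)))
      (Primrec.list_cons.comp (Primrec.const none)
        (Primrec.fst.comp (Primrec.snd.comp Primrec.snd)))
      (Primrec.list_cons.comp (Primrec.fst.comp Primrec.snd)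
        (Primrec.snd.comp (Primrec.snd.comp Primrec.snd))))).of_eq ?_
  rintro ⟨c, l⟩
  induction l with
  | nil => rfl
  | cons a l ih => simp only [Machine.eraseHit] at ih ⊢; rw [ih]

theorem Machine.primrec_step : Primrec M.step := by
  have h1 : Primrec fun x : Option Q × Bool × Option Γ => M.nextCtl x.1 x.2.1 x.2.2 :=
    Primrec.dom_finite _
  have h2 : Primrec fun x : Option Q × Bool × Option Γ => M.pushed x.1 x.2.1 x.2.2 :=
    Primrec.dom_finite _
  have hc : Primrec fun C : Conf Q Γ => C.1 := Primrec.fst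
  have hj : Primrec fun C : Conf Q Γ => C.2.1 := Primrec.fst.comp Primrec.snd
  have hl : Primrec fun C : Conf Q Γ => C.2.2 := Primrec.snd.comp Primrec.snd
  have hz : Primrec fun C : Conf Q Γ => (C.2.1 == 0) := Primrec.beq.comp hj (Primrec.const 0)
  have hg := M.primrec_firstHit.comp (hc.pair hl)
  have he := M.primrec_eraseHit.comp (hc.pair hl)
  have hs : Primrec (Machine.spread (Γ := Γ)) :=
    Primrec.list_flatMap Primrec.id (Primrec.list_cons.comp Primrec.snd
      (Primrec.const [(none : Option Γ)]))
  exact (h1.comp (hc.pair (hz.pair hg))).pair ((Primrec.nat_sub.comp hj (Primrec.const 1)).pair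
    (Primrec.list_cons.comp (h2.comp (hc.pair (hz.pair hg))) (hs.comp he)))

theorem Machine.primrec_conf : Primrec fun p : ℕ × ℕ => M.conf p.1 p.2 :=
  Primrec.nat_iterate Primrec.snd
    ((Primrec.const none).pair (Primrec.fst.pair (Primrec.const [])))
    (M.primrec_step.comp Primrec.snd)

theorem Machine.primrecPred_stopped :
    PrimrecPred fun p : ℕ × ℕ => M.stopped (M.conf p.1 p.2).1 = true :=
  (primrecPred_of_finite fun c : Option Q => M.stopped c = true).comp
    (Primrec.fst.comp M.primrec_conf)

theorem Machine.primrecPred_haltsBy :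
    PrimrecPred fun p : ℕ × ℕ => ∃ t < p.2 + 1, M.stopped (M.conf p.1 t).1 = true :=
  PrimrecPred.bex_lt (Primrec.succ.comp Primrec.snd)
    (M.primrecPred_stopped.comp ((Primrec.fst.comp Primrec.fst).pair Primrec.snd))

end Simulation

section Language
variable {Q Γ : Type} [Finite Q] [Finite Γ] (M : Machine Q Γ) (F : ℕ →. ℕ)

/-- The language of the labelled graphs in which every node inside the tables is valid and no
program in the labels outputs `0`. -/
def tableLanguage : DistLanguage :=
  {G | (∀ v, G.tableLabel (Q := Q) (Γ := Γ) v ≠ none → Valid M G.graph.Adj G.tableLabel v) ∧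
    ∀ v e, LabelIs (Q := Q) (Γ := Γ) (fun e' _ _ => e' = e) (G.tableLabel v) → 0 ∉ F e}

/-- If `M` halts exactly on the domain of `F`, then identifiers decide the language. A node whose
identifier bounds the halting time of `M` on the program in its label evaluates `F` on it. In a
valid graph, more nodes carry this program than the halting time, so one of them has such an
identifier. -/
theorem tableLanguage_mem_LD (hF : Partrec F) (hM : ∀ m, M.Halts m ↔ (F m).Dom) :
    tableLanguage M F ∈ LD := by
  classical
  let _ := primcodableOfFinite Q
  let _ := primcodableOfFinite Γ
  -- the program in the label of the root of the description, and the identifier of this node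
  let arg : Description (ℕ × BitString) → ℕ := fun D =>
    ((descLabel (Q := Q) (Γ := Γ) D 0).map Prod.fst).getD 0
  have harg : Primrec arg := Primrec.option_getD.comp (Primrec.option_map
    (primrec_descLabel.comp (Primrec.id.pair (Primrec.const 0))) (Primrec.fst.comp Primrec.snd))
    (Primrec.const 0)
  let idn : Description (ℕ × BitString) → ℕ := fun D => (D.1[0]?.map Prod.fst).getD 0
  have hid : Primrec idn := Primrec.option_getD.comp (Primrec.option_map
    (Primrec.list_getElem?.comp Primrec.fst (Primrec.const 0)) (Primrec.fst.comp Primrec.snd))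
    (Primrec.const 0)
  let chk : Description (ℕ × BitString) → Prop := fun D =>
    descLabel (Q := Q) (Γ := Γ) D 0 = none ∨ Valid M (descAdj D) (descLabel D) 0
  have hnone : PrimrecPred fun D => descLabel (Q := Q) (Γ := Γ) D 0 = none :=
    Primrec.eq.comp (primrec_descLabel.comp (Primrec.id.pair (Primrec.const 0)))
      (Primrec.const none)
  have hchk : PrimrecPred chk := hnone.or (primrecPred_valid M)
  let tst : Description (ℕ × BitString) → Prop := fun D =>
    descLabel (Q := Q) (Γ := Γ) D 0 ≠ none ∧ Valid M (descAdj D) (descLabel D) 0 ∧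
      ∃ t < idn D + 1, M.stopped (M.conf (arg D) t).1 = true
  have htst : PrimrecPred tst := hnone.not.and ((primrecPred_valid M).and
    (M.primrecPred_haltsBy.comp (harg.pair hid)))
  let A : LocalAlgorithm (ℕ × BitString) :=
    { radius := 2
      run := fun D => bif decide (tst D) then (F (arg D)).map (fun y => !(y == 0))
        else Part.some (decide (chk D))
      computable := Partrec.cond htst.decide.to_comp
        ((hF.comp harg.to_comp).map
          ((Primrec.not.comp (Primrec.beq.comp Primrec.snd (Primrec.const 0))).to₂).to_comp)
        hchk.decide.to_comp.partrec }
  refine ⟨A, fun G ident hinj => ?_⟩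
  let haltsAt : G.Node → Prop := fun v => ∃ e, LabelIs (Q := Q) (Γ := Γ) (fun e' _ _ => e' = e)
    (G.tableLabel v) ∧ (∃ t < ident v + 1, M.stopped (M.conf e t).1 = true) ∧ 0 ∈ F e
  let ok : G.Node → Prop := fun v => G.tableLabel (Q := Q) (Γ := Γ) v = none ∨
    Valid M G.graph.Adj G.tableLabel v
  refine ⟨fun v => decide (ok v ∧ ¬ haltsAt v), fun v l hl => ?_, ?_⟩
  · have hl0 := hl.getElem?_zero
    have hval := valid_describe (M := M) (ident := ident) hl
    have hlab : descLabel (Q := Q) (Γ := Γ) (describe G (plainData G ident) l) 0 = G.tableLabel v :=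
      descLabel_describe hl0
    have hidn : idn (describe G (plainData G ident) l) = ident v := by
      simp [idn, describe, hl0, plainData]
    have hargn : arg (describe G (plainData G ident) l) =
      ((G.tableLabel (Q := Q) (Γ := Γ) v).map Prod.fst).getD 0 := by simp only [arg, hlab]
    have hc : chk (describe G (plainData G ident) l) ↔ ok v := by
      simp only [chk, ok, hlab, hval]
    change _ ∈ (bif decide (tst _) then _ else _)
    by_cases ht : tst (describe G (plainData G ident) l)
    · simp only [ht, decide_true, cond_true]
      obtain ⟨h1, h2, h3⟩ := ht
      rw [hlab] at h1
      obtain ⟨⟨e, j, a⟩, hx⟩ := Option.ne_none_iff_exists'.1 h1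
      have he : arg (describe G (plainData G ident) l) = e := by rw [hargn, hx]; rfl
      rw [he, hidn] at h3
      obtain ⟨t, ht, hst⟩ := h3
      have hdom : (F e).Dom := (hM e).1 ⟨t, hst⟩
      rw [he, Part.mem_map_iff]
      refine ⟨(F e).get hdom, Part.get_mem _, ?_⟩
      have hok : ok v := .inr (hval.1 h2)
      have : haltsAt v ↔ (F e).get hdom = 0 := by
        rw [Part.get_eq_iff_mem]
        constructor
        · rintro ⟨e', ⟨e'', j', a', h4, h5⟩, -, h6⟩
          rw [hx] at h4
          simp only [Option.some.injEq, Prod.mk.injEq] at h4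
          rwa [h4.1, h5]
        · exact fun h => ⟨e, ⟨e, j, a, hx, rfl⟩, ⟨t, ht, hst⟩, h⟩
      by_cases h0 : (F e).get hdom = 0 <;> simp [this, hok, h0]
    · simp only [ht, decide_false, cond_false, Part.mem_some_iff, decide_eq_decide, hc]
      refine and_iff_left_of_imp fun hok => ?_
      rintro ⟨e, ⟨e', j, a, hx, rfl⟩, h3, -⟩
      refine ht ⟨by rw [hlab, hx]; simp, hval.2 ?_, ?_⟩
      · rcases hok with h | h
        · rw [hx] at h; cases h
        · exact h
      · rw [hidn, hargn, hx]; exact h3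
  · simp only [decide_eq_true_eq]
    constructor
    · rintro ⟨h1, h2⟩ v
      refine ⟨?_, fun ⟨e, h3, _, h4⟩ => h2 v e h3 h4⟩
      by_cases h : G.tableLabel (Q := Q) (Γ := Γ) v = none
      · exact .inl h
      · exact .inr (h1 v h)
    · intro h
      have hv (v : G.Node) (hx : G.tableLabel (Q := Q) (Γ := Γ) v ≠ none) :
          Valid M G.graph.Adj G.tableLabel v := (h v).1.resolve_left hx
      refine ⟨hv, fun v e he h0 => ?_⟩
      obtain ⟨T, hT, hcard⟩ := halts_of_valid hv (fun _ _ h => h.symm) e he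
      obtain ⟨u, hu, hid⟩ : ∃ u, LabelIs (Q := Q) (Γ := Γ) (fun e' _ _ => e' = e)
          (G.tableLabel u) ∧ T ≤ ident u := by
        by_contra! hlt
        refine absurd hcard (not_lt.2 ?_)
        refine (Set.ncard_le_ncard_of_injOn ident (t := Set.Iio T) (fun u hu => hlt u hu)
          hinj.injOn (Set.finite_Iio T)).trans_eq ?_
        rw [Set.ncard_eq_toFinset_card', Set.toFinset_Iio, Nat.card_Iio]
      exact (h u).2 ⟨e, hu, ⟨T, by omega, hT⟩, h0⟩

end Language

/-! ### Networks as induced subgraphs, and the outputs of oblivious algorithms -/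

section Reach
variable {V : Type}

/-- `reach adj r u v`: the node `v` can be reached from `u` in at most `r` steps. -/
def reach (adj : V → V → Prop) : ℕ → V → V → Prop
  | 0, u, v => u = v
  | r + 1, u, v => u = v ∨ ∃ w, adj u w ∧ reach adj r w v

theorem reach_self (adj : V → V → Prop) (r : ℕ) (u : V) : reach adj r u u := by
  cases r
  · rfl
  · exact .inl rfl

theorem dist_le_iff_reach {G : SimpleGraph V} (hG : G.Connected) {r : ℕ} {u v : V} :
    G.dist u v ≤ r ↔ reach G.Adj r u v := by
  constructor
  · intro h
    obtain ⟨p, hp⟩ := hG.exists_walk_length_eq_dist u v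
    rw [← hp] at h
    clear hp
    induction p generalizing r with
    | nil => exact reach_self _ _ _
    | cons ha p ih =>
      cases r with
      | zero => simp at h
      | succ r => exact .inr ⟨_, ha, ih (by simpa using h)⟩
  · intro h
    suffices ∃ p : G.Walk u v, p.length ≤ r by
      obtain ⟨p, hp⟩ := this
      exact (SimpleGraph.dist_le p).trans hp
    induction r generalizing u with
    | zero => cases h; exact ⟨.nil, le_rfl⟩
    | succ r ih =>
      rcases h with rfl | ⟨w, hw, h⟩
      · exact ⟨.nil, Nat.zero_le _⟩
      · obtain ⟨p, hp⟩ := ih h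
        exact ⟨.cons hw p, by simpa using hp⟩

/-- A quantity that grows by at most one along each edge grows by at most `r` in `r` steps. -/
theorem reach.le_add {adj : V → V → Prop} {h : V → ℕ} (hadj : ∀ u w, adj u w → h w ≤ h u + 1)
    {r : ℕ} {u v : V} (huv : reach adj r u v) : h v ≤ h u + r := by
  induction r generalizing u with
  | zero => cases huv; exact le_rfl
  | succ r ih =>
    rcases huv with rfl | ⟨w, hw, h'⟩
    · omega
    · have := ih h'
      have := hadj u w hw
      omega

/-- A map which is locally bijective on neighbours maps balls onto balls. -/
theorem reach_map {W : Type} {adj : V → V → Prop} {adj' : W → W → Prop} (φ : V → W) {X : Set V}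
    (hzig : ∀ u ∈ X, ∀ w, adj u w → adj' (φ u) (φ w))
    (hzag : ∀ u ∈ X, ∀ y, adj' (φ u) y → ∃ w, adj u w ∧ φ w = y)
    {r : ℕ} {u : V} (hX : ∀ w, reach adj r u w → w ∈ X) (y : W) :
    reach adj' r (φ u) y ↔ ∃ w, reach adj r u w ∧ φ w = y := by
  induction r generalizing u with
  | zero => simp [reach]
  | succ r ih =>
    have hu := hX u (reach_self _ _ _)
    constructor
    · rintro (rfl | ⟨y', hy', h⟩)
      · exact ⟨u, reach_self _ _ _, rfl⟩
      · obtain ⟨w, hw, rfl⟩ := hzag u hu y' hy'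
        obtain ⟨z, hz, rfl⟩ := (ih fun z hz => hX z (.inr ⟨w, hw, hz⟩)).1 h
        exact ⟨z, .inr ⟨w, hw, hz⟩, rfl⟩
    · rintro ⟨z, rfl | ⟨w, hw, hz⟩, rfl⟩
      · exact .inl rfl
      · exact .inr ⟨φ w, hzig u hu w hw, (ih fun z hz => hX z (.inr ⟨w, hw, hz⟩)).2 ⟨z, hz, rfl⟩⟩

end Reach

section Network
variable {V : Type} (U : SimpleGraph V) (S : Finset V)

/-- Adjacency inside the subgraph induced by `S`. -/
def adjIn (u w : V) : Prop := U.Adj u w ∧ w ∈ S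

/-- `pts` lists the ball of radius `r` around `v` in the subgraph induced by `S`. -/
structure BallList (r : ℕ) (v : V) (pts : List V) : Prop where
  head : pts.head? = some v
  nodup : pts.Nodup
  mem_iff : ∀ u, u ∈ pts ↔ reach (adjIn U S) r v u

variable {U S}

theorem reach_mem {r : ℕ} {u v : V} (hu : u ∈ S) (h : reach (adjIn U S) r u v) : v ∈ S := by
  induction r generalizing u with
  | zero => cases h; exact hu
  | succ r ih =>
    rcases h with rfl | ⟨w, hw, h⟩
    · exact hu
    · exact ih hw.2 h

theorem exists_ballList (r : ℕ) {v : V} (hv : v ∈ S) : ∃ pts, BallList U S r v pts := by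
  classical
  refine ⟨v :: (S.filter fun u => u ≠ v ∧ reach (adjIn U S) r v u).toList, rfl, ?_, fun u => ?_⟩
  · simp [Finset.nodup_toList]
  · simp only [List.mem_cons, Finset.mem_toList, Finset.mem_filter]
    constructor
    · rintro (rfl | h)
      · exact reach_self _ _ _
      · exact h.2.2
    · intro h
      by_cases hu : u = v
      · exact .inl hu
      · exact .inr ⟨reach_mem hv h, hu, h⟩

variable (U S)

/-- The labelled graph induced by the finite set `S` of nodes. -/
noncomputable abbrev network (hS : (U.induce (S : Set V)).Connected) (lab : V → BitString) :
    LabelledGraph where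
  order := S.card
  graph := (U.induce (S : Set V)).comap S.equivFin.symm
  connected := (SimpleGraph.Iso.comap S.equivFin.symm (U.induce (S : Set V))).connected_iff.2 hS
  label i := lab (S.equivFin.symm i)

/-- The node of `S` with a given number. -/
noncomputable def point (i : Fin S.card) : V := S.equivFin.symm i

variable {S}

theorem point_injective : Function.Injective (point S) :=
  Subtype.val_injective.comp S.equivFin.symm.injective

theorem point_mem (i : Fin S.card) : point S i ∈ S := (S.equivFin.symm i).2

theorem exists_point {v : V} (hv : v ∈ S) : ∃ i, point S i = v :=
  ⟨S.equivFin ⟨v, hv⟩, by simp [point]⟩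

theorem exists_points {pts : List V} (h : ∀ v ∈ pts, v ∈ S) :
    ∃ l : List (Fin S.card), l.map (point S) = pts := by
  induction pts with
  | nil => exact ⟨[], rfl⟩
  | cons v pts ih =>
    obtain ⟨l, rfl⟩ := ih fun u hu => h u (List.mem_cons_of_mem _ hu)
    obtain ⟨i, rfl⟩ := exists_point (h v List.mem_cons_self)
    exact ⟨i :: l, rfl⟩

open Classical in
/-- The description of the subgraph of `U` induced by the nodes in `pts`, with input labels `lab`
and oracle labels `orc`, where the position of a node in `pts` is its identifier. -/
noncomputable def viewDesc (lab orc : V → BitString) (pts : List V) :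
    Description (ℕ × BitString × BitString) :=
  (pts.mapIdx fun i u => (i, lab u, orc u), pts.map fun u => pts.map fun w => decide (U.Adj u w))

/-- `orc` hands out the labels of `f` to the nodes in `S` in a one-to-one manner. -/
def ScalarOracle.Hands (f : ScalarOracle) (S : Finset V) (orc : V → BitString) : Prop :=
  ∃ σ : Fin S.card ≃ Fin S.card, ∀ i, orc (point S i) = f.val S.card (σ i)

variable {U}

theorem ListsBall_network {hS : (U.induce (S : Set V)).Connected} {lab : V → BitString} {r : ℕ}
    {i : Fin S.card} {l : List (Fin S.card)}
    (h : BallList U S r (point S i) (l.map (point S))) :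
    ListsBall (network U S hS lab) r i l := by
  refine ⟨?_, h.nodup.of_map, fun j => ?_⟩
  · have := h.head
    rw [List.head?_map] at this
    obtain ⟨j, hj, hji⟩ := Option.map_eq_some_iff.1 this
    rwa [← point_injective hji]
  · rw [dist_le_iff_reach (network U S hS lab).connected, ← List.mem_map_of_injective
      point_injective, h.mem_iff, reach_map (adj := (network U S hS lab).graph.Adj)
      (point S) (X := Set.univ) ?_ ?_ (fun _ _ => trivial)]
    · constructor
      · rintro ⟨w, hw, h⟩
        rwa [← point_injective h]
      · exact fun h => ⟨j, h, rfl⟩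
    · exact fun u _ w hw => ⟨hw, point_mem w⟩
    · rintro u - y ⟨hy, hyS⟩
      obtain ⟨w, rfl⟩ := exists_point hyS
      exact ⟨w, hy, rfl⟩

/-- In a network labelled with an oracle, the output of an identifier-oblivious algorithm at a
node is determined by the description of the ball of the node with canonical identifiers. -/
theorem LocalAlgorithm.exists_out {A : LocalAlgorithm (ℕ × BitString × BitString)}
    {f : ScalarOracle} {L : DistLanguage} (hobl : A.IsOblivious f)
    (hcor : ∀ (G : LabelledGraph) (σ : G.Node ≃ Fin G.order) (ident : G.Node → ℕ),
      Function.Injective ident → A.CorrectOn L G (oracleData f G σ ident))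
    (hS : (U.induce (S : Set V)).Connected) (lab orc : V → BitString) (horc : f.Hands S orc) :
    ∃ out : V → Bool, (network U S hS lab ∈ L ↔ ∀ v ∈ S, out v = true) ∧
      ∀ v ∈ S, ∀ pts, BallList U S A.radius v pts → out v ∈ A.run (viewDesc U lab orc pts) := by
  classical
  obtain ⟨σ, hσ⟩ := horc
  obtain ⟨out, hout, hL⟩ := hcor (network U S hS lab) σ Fin.val Fin.val_injective
  have hext : ∀ i, Function.extend (point S) out (fun _ => true) (point S i) = out i :=
    fun i => point_injective.extend_apply _ _ _
  refine ⟨Function.extend (point S) out fun _ => true, ?_, fun v hv pts hpts => ?_⟩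
  · rw [hL]
    constructor
    · intro h v hv
      obtain ⟨i, rfl⟩ := exists_point hv
      rw [hext, h]
    · intro h i
      rw [← hext, h _ (point_mem i)]
  · obtain ⟨l, rfl⟩ := exists_points fun u hu => reach_mem hv ((hpts.mem_iff u).1 hu)
    obtain ⟨i, rfl⟩ := exists_point hv
    rw [hext]
    have hball : ListsBall (network U S hS lab) A.radius i l := ListsBall_network hpts
    -- identifiers which number the nodes of the ball in the order of the list
    let ident : Fin S.card → ℕ := fun i => l.idxOf i + if i ∈ l then 0 else i.val
    have hid : Function.Injective ident := by
      intro i j hij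
      have h1 : ∀ i, i ∈ l → l.idxOf i < l.length := fun i hi => List.idxOf_lt_length_iff.2 hi
      have h2 : ∀ i, i ∉ l → l.idxOf i = l.length := fun i hi => List.idxOf_eq_length_iff.2 hi
      simp only [ident] at hij
      by_cases hi : i ∈ l <;> by_cases hj : j ∈ l <;> simp only [hi, hj, if_true, if_false] at hij
      · exact (List.idxOf_inj hi).1 (by omega)
      · have := h1 i hi; have := h2 j hj; omega
      · have := h1 j hj; have := h2 i hi; omega
      · have := h2 j hj; have := h2 i hi; exact Fin.ext (by omega)
    have := (hobl (network U S hS lab) σ Fin.val ident Fin.val_injective hid _ _).1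
      (hout i) l hball
    convert this using 1
    refine congrArg A.run (Prod.ext ?_ ?_)
    · refine List.ext_getElem (by simp [describe, viewDesc]) fun i h1 h2 => ?_
      have hi : i < l.length := by simpa [viewDesc] using h1
      have hidx : l.idxOf l[i] = i := hball.nodup.idxOf_getElem i hi
      simp [describe, viewDesc, oracleData, ident, hidx, hσ]
      rfl
    · simp only [describe, viewDesc, List.map_map]
      rfl

end Network

/-! ### The canonical table of a run -/

namespace Machine
variable {Q Γ : Type} (M : Machine Q Γ)

theorem firstHit_eq {c : Option Q} {l : List (Option Γ)} {n : ℕ}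
    (h : M.hit c (l.getD n none) = true) (hn : ∀ j < n, M.hit c (l.getD j none) = false) :
    M.firstHit c l = l.getD n none := by
  induction l generalizing n with
  | nil => cases c <;> simp [hit] at h
  | cons a l ih =>
    cases n with
    | zero =>
      simp only [List.getD_cons_zero] at h ⊢
      simp [firstHit, h]
    | succ n =>
      have h0 := hn 0 n.succ_pos
      simp only [List.getD_cons_zero] at h0
      simp only [firstHit, h0, List.getD_cons_succ, Bool.false_eq_true, if_false] at h ⊢
      exact ih h fun j hj => by simpa using hn (j + 1) (by omega)

theorem firstHit_eq_none {c : Option Q} {l : List (Option Γ)}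
    (h : ∀ j, M.hit c (l.getD j none) = false) : M.firstHit c l = none := by
  induction l with
  | nil => rfl
  | cons a l ih =>
    have h0 := h 0
    simp only [List.getD_cons_zero] at h0
    simp only [firstHit, h0, Bool.false_eq_true, if_false]
    exact ih fun j => by simpa using h (j + 1)

open Classical in
theorem eraseHit_getD (c : Option Q) (l : List (Option Γ)) (n : ℕ) :
    (M.eraseHit c l).getD n none =
      if M.hit c (l.getD n none) = true ∧ ∀ j < n, M.hit c (l.getD j none) = false then none
      else l.getD n none := by
  induction l generalizing n with
  | nil => simp [eraseHit]
  | cons a l ih =>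
    by_cases ha : M.hit c a = true
    · cases n with
      | zero => simp [eraseHit, ha]
      | succ n =>
        rw [if_neg]
        · simp [eraseHit, ha]
        · rintro ⟨-, h⟩
          have := h 0 n.succ_pos
          simp [ha] at this
    · simp only [eraseHit, ha, Bool.false_eq_true, if_false]
      cases n with
      | zero => simp [ha]
      | succ n =>
        simp only [List.getD_cons_succ, ih]
        refine if_congr (and_congr_right fun _ => ⟨fun h j hj => ?_, fun h j hj => ?_⟩) rfl rfl
        · cases j with
          | zero => simpa using ha
          | succ j => simpa using h j (by omega)
        · simpa using h (j + 1) (by omega)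

open Classical in
/-- The search that arrives at the `n`-th letter of `l`: it goes on as long as no letter has been
popped. -/
noncomputable def search (c : Option Q) (l : List (Option Γ)) (n : ℕ) : Option (Q × Option Γ) :=
  if ∀ j < n, M.hit c (l.getD j none) = false then c.map fun q => (q, M.firstHit c l) else none

variable {M} {c : Option Q} {l : List (Option Γ)} {n : ℕ}

theorem hit_search (a : Option Γ) : M.hit ((M.search c l n).map Prod.fst) a = true ↔
    M.hit c a = true ∧ ∀ j < n, M.hit c (l.getD j none) = false := by
  unfold search
  split_ifs with h
  · cases c with
    | none => simp [hit]
    | some q => simp only [Option.map_some]; tauto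
  · exact iff_of_false (by simp [hit]) fun h' => h h'.2

theorem search_found (h : M.hit ((M.search c l n).map Prod.fst) (l.getD n none) = true) :
    (M.search c l n).bind Prod.snd = l.getD n none := by
  obtain ⟨h1, h2⟩ := (hit_search _).1 h
  cases c with
  | none => simp [hit] at h1
  | some q => rw [search, if_pos h2]; simpa using M.firstHit_eq h1 h2

theorem search_succ : M.search c l (n + 1) =
    if M.hit ((M.search c l n).map Prod.fst) (l.getD n none) = true then none
    else M.search c l n := by
  classical
  simp only [hit_search]
  unfold search
  have key : (∀ j < n + 1, M.hit c (l.getD j none) = false) ↔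
      (∀ j < n, M.hit c (l.getD j none) = false) ∧ M.hit c (l.getD n none) = false := by
    simp only [Nat.lt_succ_iff_lt_or_eq, or_imp, forall_and, forall_eq]
  rw [if_congr key rfl rfl]
  by_cases h : ∀ j < n, M.hit c (l.getD j none) = false
  · by_cases h' : M.hit c (l.getD n none) = true
    · rw [if_neg fun x => Bool.false_ne_true (x.2.symm.trans h'), if_pos ⟨h', h⟩]
    · rw [if_pos ⟨h, by simpa using h'⟩, if_neg fun x => h' x.1, if_pos h]
  · rw [if_neg fun x => h x.1, if_neg fun x => h x.2, if_neg h]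

theorem search_length (h : l.length ≤ n) : (M.search c l n).bind Prod.snd = none := by
  unfold search
  split_ifs with h'
  · cases c with
    | none => rfl
    | some q =>
      simp only [Option.map_some, Option.bind_some]
      refine M.firstHit_eq_none fun j => ?_
      rcases lt_or_ge j n with hj | hj
      · exact h' j hj
      · rw [List.getD_eq_default _ _ (h.trans hj)]; rfl
  · rfl

theorem eraseHit_getD_search : (M.eraseHit c l).getD n none =
    if M.hit ((M.search c l n).map Prod.fst) (l.getD n none) = true then none
    else l.getD n none := by
  classical
  rw [eraseHit_getD]
  exact if_congr (hit_search _).symm rfl rfl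

end Machine

section Table
variable {Q Γ : Type} (M : Machine Q Γ)

/-- The counter of the node in position `i` of row `t` of the table of the run on input `m`. -/
def tableIdx (m t i : ℕ) : ℕ := if i = 0 then (M.conf m t).2.1 else 0

/-- The symbol of the node in position `i` of row `t` of the table of depth `D` of the run on
input `m`. Row `t` holds the configuration of the machine at time `t`: the left border holds the
control state, and position `i + 1` holds the `i`-th letter. -/
noncomputable def tableSym (m D t i : ℕ) : Sym Q Γ where
  lev := ⟨(m + 2 * t) % 3, Nat.mod_lt _ (by norm_num)⟩
  pos := ⟨i % 3, Nat.mod_lt _ (by norm_num)⟩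
  root := decide (t = 0)
  last := decide (i + 1 = 2 ^ t)
  leaf := decide (t = D)
  cell := if i = 0 then .inl ((M.conf m t).1, M.firstHit (M.conf m t).1 (M.conf m t).2.2)
    else .inr ((M.conf m t).2.2.getD (i - 1) none)
  carry := if i = 0 then none else M.search (M.conf m t).1 (M.conf m t).2.2 (i - 1)

variable {M} {m D t i : ℕ}

theorem tableSym_out : (tableSym M m D t i).out M =
    M.search (M.conf m t).1 (M.conf m t).2.2 i := by
  rcases i with _ | i
  · simp [Sym.out, tableSym, Machine.search]
  · simp only [Sym.out, tableSym, Nat.add_eq_zero_iff, one_ne_zero, and_false, if_false,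
      Nat.add_sub_cancel, Machine.search_succ]

theorem tableSym_okOne (hi : i < 2 ^ t) (hD : M.stopped (M.conf m D).1 = true) :
    (tableSym M m D t i).OkOne M where
  found x hx hit := by
    rcases i with _ | i
    · simp [tableSym] at hx
    · simp only [tableSym, Nat.add_eq_zero_iff, one_ne_zero, and_false, if_false,
        Nat.add_sub_cancel, Sum.inr.injEq] at hx hit ⊢
      subst hx
      exact Machine.search_found hit
  last h := by
    rw [tableSym_out]
    refine Machine.search_length ?_
    have := M.conf_length m t
    simp only [tableSym, decide_eq_true_eq] at h
    omega
  go_on c g h hc := by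
    rcases i with _ | i
    · simp only [tableSym, if_true, Sum.inl.injEq, Prod.mk.injEq] at h
      simp only [tableSym, decide_eq_false_iff_not]
      rintro rfl
      rw [h.1, hc] at hD
      cases hD
    · simp [tableSym] at h
  root h := by
    simp only [tableSym, decide_eq_true_eq] at h
    subst h
    obtain rfl : i = 0 := by simpa using hi
    refine ⟨by simp [tableSym], M.firstHit none [], by simp [tableSym, Machine.conf]⟩

theorem tableSym_isLeft : (tableSym M m D t i).IsLeft (tableSym M m D (t + 1) (2 * i)) := by
  refine ⟨by simp [tableSym], ?_, ?_⟩
  · change (m + 2 * t) % 3 = ((m + 2 * (t + 1)) % 3 + 1) % 3; omega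
  · change (2 * i) % 3 = (2 * (i % 3)) % 3; omega

theorem tableSym_isRight : (tableSym M m D t i).IsRight (tableSym M m D (t + 1) (2 * i + 1)) := by
  refine ⟨by simp [tableSym], ?_, ?_⟩
  · change (m + 2 * t) % 3 = ((m + 2 * (t + 1)) % 3 + 1) % 3; omega
  · change (2 * i + 1) % 3 = (2 * (i % 3) + 1) % 3; omega

theorem tableSym_row : (tableSym M m D t (i + 1)).leaf = (tableSym M m D t i).leaf ∧
    (tableSym M m D t (i + 1)).carry = (tableSym M m D t i).out M := by
  rw [tableSym_out]
  simp [tableSym]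

theorem tableSym_leftCell : (tableSym M m D t i).leftCell M (tableIdx M m t i == 0)
    (tableSym M m D (t + 1) (2 * i)).cell := by
  rcases i with _ | i
  · simp only [Sym.leftCell, tableSym, tableIdx, if_true, mul_zero]
    exact ⟨_, by rw [Machine.conf_succ]; rfl⟩
  · have h2 : 2 * (i + 1) - 1 = 2 * i + 1 := by omega
    simp only [Sym.leftCell, tableSym, Nat.add_eq_zero_iff, one_ne_zero, and_false, if_false,
      Nat.add_sub_cancel, Nat.mul_eq_zero, OfNat.ofNat_ne_zero, false_or, h2, Machine.conf_succ,
      Machine.step, List.getD_cons_succ, Machine.spread_getD_even, Machine.eraseHit_getD_search]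

theorem tableSym_rightCell : (tableSym M m D (t + 1) (2 * i + 1)).cell =
    .inr ((tableSym M m D t i).rightLetter M (tableIdx M m t i == 0)) := by
  rcases i with _ | i
  · simp [Sym.rightLetter, tableSym, tableIdx, Machine.conf_succ, Machine.step]
  · have h2 : 2 * (i + 1) = 2 * i + 1 + 1 := by omega
    simp only [Sym.rightLetter, tableSym, Nat.add_eq_zero_iff, one_ne_zero, and_false, if_false,
      Nat.add_sub_cancel, h2, Machine.conf_succ,
      Machine.step, List.getD_cons_succ, Machine.spread_getD_odd]

theorem tableSym_last :
    (tableSym M m D (t + 1) (2 * i + 1)).last = (tableSym M m D t i).last := by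
  simp only [tableSym, decide_eq_decide, pow_succ]
  omega

theorem tableIdx_left : tableIdx M m (t + 1) (2 * i) = tableIdx M m t i - 1 := by
  rcases i with _ | i
  · simp [tableIdx, Machine.conf_succ, Machine.step]
  · simp [tableIdx]

end Table

/-! ### Networks of tables -/

/-- The nodes of the networks: `cell k t i` is position `i` in row `t` of the `k`-th table, and
`pad j` is a node outside all tables. -/
inductive Pt
  | cell (k t i : ℕ)
  | pad (j : ℕ)

/-- The edges of the grid: a cell is joined to the next cell of its row and to its two children
in the next row, the root of table `0` is joined to the roots of the other tables and to the
first of the pads, which form a path. -/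
def Edge : Pt → Pt → Prop
  | .cell k t i, .cell k' t' i' => (k' = k ∧ t' = t ∧ i' = i + 1) ∨
      (k' = k ∧ t' = t + 1 ∧ i = i' / 2) ∨ (k = 0 ∧ t = 0 ∧ i = 0 ∧ k' ≠ 0 ∧ t' = 0 ∧ i' = 0)
  | .cell k t i, .pad j => k = 0 ∧ t = 0 ∧ i = 0 ∧ j = 0
  | .pad j, .pad j' => j' = j + 1
  | .pad _, .cell _ _ _ => False

/-- The infinite graph of which all networks are induced subgraphs. -/
def grid : SimpleGraph Pt where
  Adj u v := Edge u v ∨ Edge v u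
  symm := ⟨fun _ _ h => Or.symm h⟩
  loopless := ⟨fun u h => by
    rcases u with ⟨k, t, i⟩ | j <;> simp only [Edge] at h <;> omega⟩

theorem grid_adj_cell {k t i k' t' i' : ℕ} : grid.Adj (.cell k t i) (.cell k' t' i') ↔
    (k' = k ∧ ((t' = t ∧ (i' = i + 1 ∨ i = i' + 1)) ∨ (t' = t + 1 ∧ i = i' / 2) ∨
      (t = t' + 1 ∧ i' = i / 2))) ∨
    (t = 0 ∧ i = 0 ∧ t' = 0 ∧ i' = 0 ∧ k' ≠ k ∧ (k = 0 ∨ k' = 0)) := by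
  simp only [grid, Edge]
  omega

theorem grid_adj_pad {k t i j : ℕ} :
    grid.Adj (.cell k t i) (.pad j) ↔ k = 0 ∧ t = 0 ∧ i = 0 ∧ j = 0 := by
  simp only [grid, Edge, or_false]

theorem grid_adj_pad_pad {j j' : ℕ} :
    grid.Adj (.pad j) (.pad j') ↔ j' = j + 1 ∨ j = j' + 1 := by
  simp only [grid, Edge]

section NetSet
variable (K : ℕ) (T : ℕ → ℕ) (P : ℕ)

/-- The nodes of the network with the tables `0, …, K`, of depths `T 0, …, T K`, and `P` pads. -/
def InNet : Pt → Prop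
  | .cell k t i => k ≤ K ∧ t ≤ T k ∧ i < 2 ^ t
  | .pad j => j < P

theorem finite_inNet : {v | InNet K T P v}.Finite := by
  have h1 := ((Finset.range (K + 1)).finite_toSet.biUnion (t := fun k =>
    ⋃ t ∈ (Finset.range (T k + 1) : Set ℕ), (Pt.cell k t) '' (Finset.range (2 ^ t) : Set ℕ))
    fun k _ => (Finset.finite_toSet _).biUnion fun t _ => (Finset.finite_toSet _).image _)
  have h2 := (Finset.range P).finite_toSet.image Pt.pad
  refine (h1.union h2).subset fun v hv => ?_
  rcases v with ⟨k, t, i⟩ | j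
  · left
    simp only [Set.mem_iUnion]
    exact ⟨k, by simpa [Nat.lt_succ_iff] using hv.1, t, by simpa [Nat.lt_succ_iff] using hv.2.1,
      i, by simpa using hv.2.2, rfl⟩
  · exact .inr ⟨j, by simpa [InNet] using hv, rfl⟩

/-- The finite set of the nodes of the network. -/
noncomputable def netSet : Finset Pt := (finite_inNet K T P).toFinset

variable {K T P}

theorem mem_netSet {v : Pt} : v ∈ netSet K T P ↔ InNet K T P v := by
  simp [netSet]

theorem cell_mem_netSet {k t i : ℕ} :
    .cell k t i ∈ netSet K T P ↔ k ≤ K ∧ t ≤ T k ∧ i < 2 ^ t := mem_netSet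

theorem pad_mem_netSet {j : ℕ} : .pad j ∈ netSet K T P ↔ j < P := mem_netSet

theorem netSet_connected : (grid.induce (netSet K T P : Set Pt)).Connected := by
  have h0 : Pt.cell 0 0 0 ∈ (netSet K T P : Set Pt) := cell_mem_netSet.2 (by simp)
  rw [SimpleGraph.connected_iff_exists_forall_reachable]
  have hstep : ∀ u v (hu : u ∈ (netSet K T P : Set Pt)) (hv : v ∈ (netSet K T P : Set Pt)),
      grid.Adj u v → (grid.induce (netSet K T P : Set Pt)).Reachable ⟨_, h0⟩ ⟨u, hu⟩ →
      (grid.induce (netSet K T P : Set Pt)).Reachable ⟨_, h0⟩ ⟨v, hv⟩ :=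
    fun u v hu hv h hr => hr.trans (SimpleGraph.Adj.reachable h)
  refine ⟨⟨_, h0⟩, ?_⟩
  rintro ⟨⟨k, t, i⟩ | j, hv⟩
  · induction t generalizing i with
    | zero =>
      have hv' := cell_mem_netSet.1 hv
      obtain rfl : i = 0 := by simpa using hv'.2.2
      rcases Nat.eq_zero_or_pos k with rfl | hk
      · exact SimpleGraph.Reachable.refl _
      · exact hstep _ _ h0 hv (by rw [grid_adj_cell]; omega) (SimpleGraph.Reachable.refl _)
    | succ t ih =>
      have hv' := cell_mem_netSet.1 hv
      have hm : Pt.cell k t (i / 2) ∈ (netSet K T P : Set Pt) :=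
        cell_mem_netSet.2 (by rw [pow_succ] at hv'; omega)
      exact hstep _ _ hm hv (by rw [grid_adj_cell]; omega) (ih _ hm)
  · induction j with
    | zero => exact hstep _ _ h0 hv (by rw [grid_adj_pad]; omega) (SimpleGraph.Reachable.refl _)
    | succ j ih =>
      have hm : Pt.pad j ∈ (netSet K T P : Set Pt) :=
        pad_mem_netSet.2 (by have := pad_mem_netSet.1 hv; omega)
      exact hstep _ _ hm hv (by rw [grid_adj_pad_pad]; omega) (ih hm)

end NetSet

/-! ### Networks of halting runs are valid -/

section NetLabel
variable {Q Γ : Type} (M : Machine Q Γ) (e : ℕ) (g T : ℕ → ℕ)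

/-- The labels of a network: program `e` everywhere, and in the `k`-th table the run of the
machine on input `g k`. -/
noncomputable def netLabel : Pt → Option (NodeLabel Q Γ)
  | .cell k t i => some (e, tableIdx M (g k) t i, tableSym M (g k) (T k) t i)
  | .pad _ => none

variable {M e g T}

theorem netLabel_rel {p : Sym Q Γ → Sym Q Γ → Prop} {k t i : ℕ} {w : Pt} :
    LabelRel p (netLabel M e g T (.cell k t i)) (netLabel M e g T w) ↔
      ∃ k' t' i', w = .cell k' t' i' ∧
        p (tableSym M (g k) (T k) t i) (tableSym M (g k') (T k') t' i') := by
  constructor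
  · rintro ⟨e', j, a, j', b, h1, h2, h3⟩
    rcases w with ⟨k', t', i'⟩ | j
    · simp only [netLabel, Option.some.injEq, Prod.mk.injEq] at h1 h2
      exact ⟨k', t', i', rfl, by rw [h1.2.2, h2.2.2]; exact h3⟩
    · cases h2
  · rintro ⟨k', t', i', rfl, h⟩
    exact ⟨_, _, _, _, _, rfl, rfl, h⟩

theorem netLabel_is {p : ℕ → ℕ → Sym Q Γ → Prop} {k t i : ℕ} :
    LabelIs p (netLabel M e g T (.cell k t i)) ↔
      p e (tableIdx M (g k) t i) (tableSym M (g k) (T k) t i) := by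
  constructor
  · rintro ⟨e', j, a, h1, h⟩
    simp only [netLabel, Option.some.injEq, Prod.mk.injEq] at h1
    obtain ⟨rfl, rfl, rfl⟩ := h1
    exact h
  · exact fun h => ⟨_, _, _, rfl, h⟩

theorem row_of_isRow {k t i k' t' i' : ℕ} (hadj : grid.Adj (.cell k t i) (.cell k' t' i'))
    (h : (tableSym M (g k) (T k) t i).IsRow (tableSym M (g k') (T k') t' i')) :
    k' = k ∧ t' = t ∧ i' = i + 1 := by
  obtain ⟨h1, h2⟩ := h
  have h1 : (g k' + 2 * t') % 3 = (g k + 2 * t) % 3 := congrArg Fin.val h1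
  change i' % 3 = (i % 3 + 1) % 3 at h2
  rcases grid_adj_cell.1 hadj with ⟨rfl, h⟩ | h <;> omega

theorem child_of_isLeft {k t i k' t' i' : ℕ} (hadj : grid.Adj (.cell k t i) (.cell k' t' i'))
    (h : (tableSym M (g k) (T k) t i).IsLeft (tableSym M (g k') (T k') t' i')) :
    k' = k ∧ t' = t + 1 ∧ i' = 2 * i := by
  obtain ⟨h0, h1, h2⟩ := h
  change (g k + 2 * t) % 3 = ((g k' + 2 * t') % 3 + 1) % 3 at h1
  change i' % 3 = (2 * (i % 3)) % 3 at h2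
  simp only [tableSym, decide_eq_false_iff_not] at h0
  rcases grid_adj_cell.1 hadj with ⟨rfl, h⟩ | h <;> omega

theorem child_of_isRight {k t i k' t' i' : ℕ} (hadj : grid.Adj (.cell k t i) (.cell k' t' i'))
    (h : (tableSym M (g k) (T k) t i).IsRight (tableSym M (g k') (T k') t' i')) :
    k' = k ∧ t' = t + 1 ∧ i' = 2 * i + 1 := by
  obtain ⟨h0, h1, h2⟩ := h
  change (g k + 2 * t) % 3 = ((g k' + 2 * t') % 3 + 1) % 3 at h1
  change i' % 3 = (2 * (i % 3) + 1) % 3 at h2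
  simp only [tableSym, decide_eq_false_iff_not] at h0
  rcases grid_adj_cell.1 hadj with ⟨rfl, h⟩ | h <;> omega

theorem parent_of_isChild {k t i : ℕ} {u : Pt} (hadj : grid.Adj (.cell k t i) u)
    (h : IsChildLabel (netLabel M e g T u) (netLabel M e g T (.cell k t i))) :
    u = .cell k (t - 1) (i / 2) := by
  rcases u with ⟨k', t', i'⟩ | j
  · rcases h with h | h
    · obtain ⟨_, _, _, h1, h2⟩ := netLabel_rel.1 h
      cases h1
      obtain ⟨rfl, rfl, rfl⟩ := child_of_isLeft hadj.symm h2
      congr 1; omega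
    · obtain ⟨_, _, _, h1, h2⟩ := netLabel_rel.1 h
      cases h1
      obtain ⟨rfl, rfl, rfl⟩ := child_of_isRight hadj.symm h2
      congr 1; omega
  · rcases h with ⟨_, _, _, _, _, h, _⟩ | ⟨_, _, _, _, _, h, _⟩ <;> cases h

/-- Networks of complete tables of halting runs are valid, provided that the input of table `0`
is the program in the labels. -/
theorem valid_netLabel {K P : ℕ} (hg : g 0 = e)
    (hT : ∀ k ≤ K, M.stopped (M.conf (g k) (T k)).1 = true) {v : Pt} (hv : v ∈ netSet K T P)
    (hlab : netLabel M e g T v ≠ none) :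
    Valid M (adjIn grid (netSet K T P)) (netLabel M e g T) v := by
  rcases v with ⟨k, t, i⟩ | j
  swap
  · exact absurd rfl hlab
  obtain ⟨hk, ht, hi⟩ := cell_mem_netSet.1 hv
  have hleaf : ∀ {t' i'}, Pt.cell k t' i' ∈ netSet K T P → t' = t + 1 →
      (tableSym M (g k) (T k) t i).leaf = false := by
    intro t' i' h ht'
    have := (cell_mem_netSet.1 h).2.1
    simp only [tableSym, decide_eq_false_iff_not]
    omega
  have hchild : LabelIs (fun _ _ a => a.leaf = false) (netLabel M e g T (.cell k t i)) →
      t < T k := by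
    intro h
    have h := netLabel_is.1 h
    simp only [tableSym, decide_eq_false_iff_not] at h
    omega
  refine ⟨?_, ?_, ?_, ?_, ?_, ?_, ?_, ?_, ?_⟩
  · exact netLabel_is.2 (tableSym_okOne hi (hT k hk))
  · rintro (⟨k', t', i'⟩ | j) ⟨hadj, hu⟩
    · refine .inr ⟨_, _, _, _, _, rfl, rfl, ⟨fun h => ?_, fun h => ?_, fun h => ?_⟩, fun h => ?_⟩
      · obtain ⟨rfl, rfl, rfl⟩ := row_of_isRow hadj h
        exact tableSym_row
      · obtain ⟨rfl, rfl, rfl⟩ := child_of_isLeft hadj h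
        exact ⟨hleaf hu rfl, tableSym_leftCell⟩
      · obtain ⟨rfl, rfl, rfl⟩ := child_of_isRight hadj h
        exact ⟨hleaf hu rfl, tableSym_last, tableSym_rightCell⟩
      · obtain ⟨rfl, rfl, rfl⟩ := child_of_isLeft hadj h
        exact tableIdx_left
    · exact .inl rfl
  · intro h
    have h := netLabel_is.1 h
    simp only [tableSym, decide_eq_false_iff_not] at h
    obtain ⟨t, rfl⟩ := Nat.exists_eq_succ_of_ne_zero h
    rw [Nat.succ_eq_add_one, pow_succ] at hi
    refine ⟨.cell k t (i / 2), ⟨grid_adj_cell.2 (by omega), cell_mem_netSet.2 (by omega)⟩, ?_⟩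
    rcases Nat.even_or_odd' i with ⟨j, rfl | rfl⟩
    · rw [show 2 * j / 2 = j by omega]
      exact .inl (netLabel_rel.2 ⟨_, _, _, rfl, tableSym_isLeft⟩)
    · rw [show (2 * j + 1) / 2 = j by omega]
      exact .inr (netLabel_rel.2 ⟨_, _, _, rfl, tableSym_isRight⟩)
  · intro u hu w hw h1 h2
    rw [parent_of_isChild hu.1 h1, parent_of_isChild hw.1 h2]
  · intro h
    have := hchild h
    exact ⟨.cell k (t + 1) (2 * i), ⟨grid_adj_cell.2 (by omega),
      cell_mem_netSet.2 (by rw [pow_succ]; omega)⟩, netLabel_rel.2 ⟨_, _, _, rfl, tableSym_isLeft⟩⟩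
  · intro h
    have := hchild h
    exact ⟨.cell k (t + 1) (2 * i + 1), ⟨grid_adj_cell.2 (by omega),
      cell_mem_netSet.2 (by rw [pow_succ]; omega)⟩, netLabel_rel.2 ⟨_, _, _, rfl, tableSym_isRight⟩⟩
  · intro u hu w hw h1 h2
    obtain ⟨_, _, _, rfl, a1⟩ := netLabel_rel.1 h1
    obtain ⟨_, _, _, rfl, a2⟩ := netLabel_rel.1 h2
    obtain ⟨rfl, rfl, rfl⟩ := child_of_isLeft hu.1 a1
    obtain ⟨rfl, rfl, rfl⟩ := child_of_isRight hw.1 a2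
    exact ⟨grid_adj_cell.2 (by omega), hw.2⟩
  · intro u hu w hw h1 h2 x hx h3
    obtain ⟨_, _, _, rfl, a1⟩ := netLabel_rel.1 h1
    obtain ⟨_, _, _, rfl, a2⟩ := netLabel_rel.1 h2
    obtain ⟨_, _, _, rfl, a3⟩ := netLabel_rel.1 h3
    obtain ⟨rfl, rfl, rfl⟩ := child_of_isRight hu.1 a1
    obtain ⟨rfl, rfl, rfl⟩ := row_of_isRow hw.1 a2
    obtain ⟨rfl, rfl, rfl⟩ := child_of_isLeft hx.1 a3
    exact ⟨grid_adj_cell.2 (by omega), hx.2⟩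
  · intro h
    have h := netLabel_is.1 h
    simp only [tableSym, decide_eq_true_eq] at h
    subst h
    obtain rfl : i = 0 := by simpa using hi
    rcases Nat.eq_zero_or_pos k with rfl | hk'
    · exact .inl (netLabel_is.2 (by simp [tableIdx, Machine.conf, hg]))
    · refine .inr ⟨.cell 0 0 0, ⟨grid_adj_cell.2 (by omega), cell_mem_netSet.2 (by simp)⟩,
        netLabel_rel.2 ⟨_, _, _, rfl, trivial⟩, netLabel_is.2 ?_⟩
      simp [tableIdx, Machine.conf, hg, tableSym]

end NetLabel

section Membership
variable {Q Γ : Type} [Finite Q] [Finite Γ] {M : Machine Q Γ} {F : ℕ →. ℕ}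

theorem tableLabel_network {U : SimpleGraph Pt} {S : Finset Pt}
    {hS : (U.induce (S : Set Pt)).Connected} {lab : Pt → Option (NodeLabel Q Γ)}
    (i : Fin S.card) :
    (network U S hS fun v => encodeLabel (lab v)).tableLabel i = lab (point S i) :=
  decode_encodeLabel _

theorem network_mem_tableLanguage {e K P : ℕ} {g T : ℕ → ℕ} (hg : g 0 = e)
    (hT : ∀ k ≤ K, M.stopped (M.conf (g k) (T k)).1 = true) :
    network grid (netSet K T P) netSet_connected (fun v => encodeLabel (netLabel M e g T v)) ∈
      tableLanguage M F ↔ 0 ∉ F e := by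
  constructor
  · intro h
    have h0 : Pt.cell 0 0 0 ∈ netSet K T P := cell_mem_netSet.2 (by simp)
    obtain ⟨i, hi⟩ := exists_point h0
    refine h.2 i e ?_
    rw [tableLabel_network i, hi]
    exact netLabel_is.2 rfl
  · intro h
    refine ⟨fun i hi => ?_, fun i e' he => ?_⟩
    · rw [tableLabel_network i] at hi
      refine Valid.transport (fun v (i : Fin (netSet K T P).card) => point _ i = v) ?_ ?_ ?_ rfl
        ?_ (fun k _ => ⟨_, rfl⟩) (fun _ _ m _ => ⟨_, rfl⟩)
        (valid_netLabel hg hT (point_mem i) hi)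
      · rintro _ j rfl
        exact (tableLabel_network j).symm
      · rintro _ j _ k rfl rfl
        exact ⟨fun h => h.1, fun h => ⟨h, point_mem k⟩⟩
      · rintro _ j _ k rfl rfl
        exact point_injective.eq_iff
      · exact fun y hy => exists_point hy.2
    · rw [tableLabel_network i] at he
      obtain ⟨e'', j, a, h1, rfl⟩ := he
      rcases hp : point (netSet K T P) i with ⟨k, t, i'⟩ | j'
      · rw [hp] at h1
        simp only [netLabel, Option.some.injEq, Prod.mk.injEq] at h1
        rwa [← h1.1]
      · rw [hp] at h1
        cases h1

theorem network_none_mem_tableLanguage {S : Finset Pt}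
    {hS : (grid.induce (S : Set Pt)).Connected} :
    network grid S hS (fun _ => encodeLabel (none : Option (NodeLabel Q Γ))) ∈
      tableLanguage M F := by
  have h : ∀ i : Fin S.card, (network grid S hS fun _ =>
      encodeLabel (none : Option (NodeLabel Q Γ))).tableLabel i =
        (none : Option (NodeLabel Q Γ)) := fun i => decode_encodeLabel _
  refine ⟨fun i hi => absurd (h i) hi, fun i e he => ?_⟩
  rw [h i] at he
  obtain ⟨_, _, _, h, -⟩ := he
  cases h

end Membership

/-! ### Views and local isomorphisms -/

section View
variable {α : Type}

open Classical in
/-- The labels of the nodes in `pts` and the adjacency matrix of the grid. -/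
noncomputable def viewType (lab : Pt → α) (pts : List Pt) : List α × List (List Bool) :=
  (pts.map lab, pts.map fun u => pts.map fun w => decide (grid.Adj u w))

/-- `τ` describes the ball of radius `r` around `v` in the subgraph induced by `S`. -/
def HasView (S : Finset Pt) (lab : Pt → α) (r : ℕ) (v : Pt) (τ : List α × List (List Bool)) :
    Prop :=
  ∃ pts, BallList grid S r v pts ∧ τ = viewType lab pts

theorem exists_hasView {S : Finset Pt} (lab : Pt → α) (r : ℕ) {v : Pt} (hv : v ∈ S) :
    ∃ τ, HasView S lab r v τ := by
  obtain ⟨pts, h⟩ := exists_ballList (U := grid) r hv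
  exact ⟨_, pts, h, rfl⟩

/-- A map that preserves labels and is locally an isomorphism preserves views. -/
theorem HasView.map {S S' : Finset Pt} {lab lab' : Pt → α} {r : ℕ} {v : Pt}
    {τ : List α × List (List Bool)} (h : HasView S lab r v τ) (φ : Pt → Pt) (X : Set Pt)
    (hX : ∀ w, reach (adjIn grid S) r v w → w ∈ X) (hlab : ∀ u ∈ X, lab' (φ u) = lab u)
    (hinj : Set.InjOn φ X) (hadj : ∀ u ∈ X, ∀ w ∈ X, grid.Adj (φ u) (φ w) ↔ grid.Adj u w)
    (hzig : ∀ u ∈ X, ∀ w, adjIn grid S u w → adjIn grid S' (φ u) (φ w))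
    (hzag : ∀ u ∈ X, ∀ y, adjIn grid S' (φ u) y → ∃ w, adjIn grid S u w ∧ φ w = y) :
    HasView S' lab' r (φ v) τ := by
  obtain ⟨pts, hpts, rfl⟩ := h
  have hmem : ∀ u ∈ pts, u ∈ X := fun u hu => hX u ((hpts.mem_iff u).1 hu)
  refine ⟨pts.map φ, ⟨?_, ?_, fun u => ?_⟩, ?_⟩
  · rw [List.head?_map, hpts.head]; rfl
  · exact hpts.nodup.map_on fun u hu w hw h => hinj (hmem u hu) (hmem w hw) h
  · rw [reach_map φ hzig hzag hX, List.mem_map]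
    simp only [hpts.mem_iff]
  · refine Prod.ext ?_ ?_
    · simp only [viewType, List.map_map]
      exact List.map_congr_left fun u hu => (hlab u (hmem u hu)).symm
    · simp only [viewType, List.map_map]
      refine List.map_congr_left fun u hu => List.map_congr_left fun w hw => ?_
      exact decide_eq_decide.2 (hadj u (hmem u hu) w (hmem w hw)).symm

end View

section Geometry

/-- Within fewer steps than its distance from the root, a cell only reaches cells of its own
table, and the positions change at most exponentially in the number of steps. -/
theorem reach_cell {S : Finset Pt} {n k t i : ℕ} {w : Pt} (hn : n ≤ t)
    (h : reach (adjIn grid S) n (.cell k t i) w) :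
    ∃ t' i', w = .cell k t' i' ∧ t' ≤ t + n ∧ t ≤ t' + n ∧ i' + 1 ≤ 2 ^ n * (i + 1) ∧
      i + 1 ≤ 2 ^ n * (i' + 1) := by
  induction n generalizing t i with
  | zero => cases h; exact ⟨t, i, rfl, by simp⟩
  | succ n ih =>
    rcases h with rfl | ⟨⟨k₁, t₁, i₁⟩ | j, hadj, h⟩
    · have : i + 1 ≤ 2 ^ (n + 1) * (i + 1) := Nat.le_mul_of_pos_left _ (by positivity)
      exact ⟨t, i, rfl, by omega, by omega, this, this⟩
    · have hadj := grid_adj_cell.1 hadj.1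
      obtain rfl : k₁ = k := by omega
      obtain ⟨t', i', rfl, h1, h2, h3, h4⟩ := ih (t := t₁) (by omega) h
      refine ⟨t', i', rfl, by omega, by omega, ?_, ?_⟩
      · calc i' + 1 ≤ 2 ^ n * (i₁ + 1) := h3
          _ ≤ 2 ^ n * (2 * (i + 1)) := Nat.mul_le_mul_left _ (by omega)
          _ = _ := by ring
      · calc i + 1 ≤ 2 * (i₁ + 1) := by omega
          _ ≤ 2 * (2 ^ n * (i' + 1)) := Nat.mul_le_mul_left _ h4
          _ = _ := by ring
    · have := grid_adj_pad.1 hadj.1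
      omega

theorem reach_pad {S : Finset Pt} {n j : ℕ} {w : Pt} (hn : n ≤ j)
    (h : reach (adjIn grid S) n (.pad j) w) : ∃ j', w = .pad j' := by
  induction n generalizing j with
  | zero => cases h; exact ⟨j, rfl⟩
  | succ n ih =>
    rcases h with rfl | ⟨⟨k₁, t₁, i₁⟩ | j₁, hadj, h⟩
    · exact ⟨j, rfl⟩
    · have := grid_adj_pad.1 hadj.1.symm
      omega
    · have := grid_adj_pad_pad.1 hadj.1
      exact ih (by omega) h

/-- The distance of a node from the part of the network consisting of the tables `k ≥ 1`, the
first rows of table `0` and the first pads. -/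
def farness (r : ℕ) : Pt → ℕ
  | .cell k t _ => if k = 0 then t - (3 * r + 1) else 0
  | .pad j => j - r

theorem farness_adj {r : ℕ} {u w : Pt} (h : grid.Adj u w) : farness r w ≤ farness r u + 1 := by
  rcases u with ⟨k, t, i⟩ | j <;> rcases w with ⟨k', t', i'⟩ | j' <;> simp only [farness]
  · have := grid_adj_cell.1 h
    split_ifs <;> omega
  · have := grid_adj_pad.1 h
    omega
  · have := grid_adj_pad.1 h.symm
    split_ifs <;> omega
  · have := grid_adj_pad_pad.1 h
    omega

theorem farness_reach {S : Finset Pt} {r n : ℕ} {u w : Pt} (h : reach (adjIn grid S) n u w) :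
    farness r w ≤ farness r u + n :=
  h.le_add fun _ _ h => farness_adj h.1

/-- The view of a node near the roots does not depend on the depth of table `0` and on the number
of pads. -/
theorem HasView.near {α : Type} {K P P' r : ℕ} {T T' : ℕ → ℕ} {lab lab' : Pt → α} {v : Pt}
    {τ : List α × List (List Bool)} (h : HasView (netSet K T P) lab r v τ)
    (hmem : v ∈ netSet K T P) (hv : farness r v = 0)
    (hT : ∀ k, k ≠ 0 → T' k = T k) (hT0 : 4 * r + 2 ≤ T 0)
    (hT0' : 4 * r + 2 ≤ T' 0) (hP : 2 * r + 2 ≤ P) (hP' : 2 * r + 2 ≤ P')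
    (hlab : ∀ u ∈ netSet K T P, farness r u ≤ r → lab' u = lab u) :
    HasView (netSet K T' P') lab' r v τ := by
  have key : ∀ w, farness r w ≤ r + 1 → (w ∈ netSet K T P ↔ w ∈ netSet K T' P') := by
    rintro (⟨k, t, i⟩ | j) hw
    · rw [cell_mem_netSet, cell_mem_netSet]
      rcases Nat.eq_zero_or_pos k with rfl | hk
      · simp only [farness, if_true] at hw
        omega
      · rw [hT k hk.ne']
    · rw [pad_mem_netSet, pad_mem_netSet]
      simp only [farness] at hw
      omega
  refine h.map id {u | u ∈ netSet K T P ∧ farness r u ≤ r}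
    (fun w hw => ⟨reach_mem hmem hw, ?_⟩) (fun u hu => hlab u hu.1 hu.2) (Set.injOn_id _)
    (fun _ _ _ _ => Iff.rfl) ?_ ?_
  · have := farness_reach (r := r) hw
    omega
  · rintro u ⟨-, hu⟩ w ⟨hadj, hw⟩
    have := farness_adj (r := r) hadj
    exact ⟨hadj, (key w (by omega)).1 hw⟩
  · rintro u ⟨-, hu⟩ w ⟨hadj, hw⟩
    have := farness_adj (r := r) hadj
    exact ⟨w, ⟨hadj, (key w (by dsimp at this; omega)).2 hw⟩, rfl⟩

/-- The view of a node away from the root only depends on its table. -/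
theorem HasView.table {α : Type} {K K' P P' r k k' t i : ℕ} {T T' : ℕ → ℕ} {lab lab' : Pt → α}
    {τ : List α × List (List Bool)} (h : HasView (netSet K T P) lab r (.cell k t i) τ)
    (hk : k ≤ K) (hk' : k' ≤ K') (hT : T k = T' k') (ht : r < t)
    (hlab : ∀ t i, lab' (.cell k' t i) = lab (.cell k t i)) :
    HasView (netSet K' T' P') lab' r (.cell k' t i) τ := by
  refine h.map (fun | .cell _ t i => .cell k' t i | .pad j => .pad j)
    {u | ∃ t i, u = .cell k (t + 1) i} ?_ ?_ ?_ ?_ ?_ ?_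
  · intro w hw
    obtain ⟨t', i', rfl, -, h, -⟩ := reach_cell ht.le hw
    obtain ⟨t', rfl⟩ := Nat.exists_eq_add_of_lt (show 0 < t' by omega)
    exact ⟨t', i', by rw [zero_add]⟩
  · rintro _ ⟨t, i, rfl⟩
    exact hlab _ _
  · rintro _ ⟨t, i, rfl⟩ _ ⟨t', i', rfl⟩ h
    simp only [Pt.cell.injEq, true_and] at h
    rw [h.1, h.2]
  · rintro _ ⟨t, i, rfl⟩ _ ⟨t', i', rfl⟩
    change grid.Adj (.cell k' _ _) (.cell k' _ _) ↔ _
    rw [grid_adj_cell, grid_adj_cell]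
    omega
  · rintro _ ⟨t, i, rfl⟩ (⟨k₁, t₁, i₁⟩ | j) ⟨hadj, hw⟩
    · have hadj := grid_adj_cell.1 hadj
      obtain rfl : k₁ = k := by omega
      have hw := cell_mem_netSet.1 hw
      exact ⟨grid_adj_cell.2 (by omega), cell_mem_netSet.2 ⟨hk', by omega, hw.2.2⟩⟩
    · have := grid_adj_pad.1 hadj
      omega
  · rintro _ ⟨t, i, rfl⟩ (⟨k₁, t₁, i₁⟩ | j) ⟨hadj, hw⟩
    · have hadj := grid_adj_cell.1 hadj
      obtain rfl : k₁ = k' := by omega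
      have hw := cell_mem_netSet.1 hw
      exact ⟨.cell k t₁ i₁, ⟨grid_adj_cell.2 (by omega), cell_mem_netSet.2
        ⟨hk, by omega, hw.2.2⟩⟩, rfl⟩
    · have := grid_adj_pad.1 hadj
      omega

/-- The view of a node near the left border may be shifted along the border as long as the labels
agree. -/
theorem HasView.shift {α : Type} {K K' P P' r i δ : ℕ} {T T' : ℕ → ℕ} {lab lab' : Pt → α}
    {τ : List α × List (List Bool)} (h : HasView (netSet K T P) lab r (.cell 0 (3 * r + 1) i) τ)
    (hi : i < 2 ^ r) (hT : 4 * r + 2 ≤ T 0) (hT' : 4 * r + 2 + δ ≤ T' 0)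
    (hlab : ∀ t i, 2 * r + 1 ≤ t → t ≤ 4 * r + 1 → i + 1 < 2 ^ t →
      lab' (.cell 0 (t + δ) i) = lab (.cell 0 t i)) :
    HasView (netSet K' T' P') lab' r (.cell 0 (3 * r + 1 + δ) i) τ := by
  have hpow : ∀ {t i : ℕ}, 2 * r + 1 ≤ t → i + 1 ≤ 2 ^ (2 * r) → i + 1 < 2 ^ t := fun ht hi =>
    hi.trans_lt (Nat.pow_lt_pow_right one_lt_two (by omega))
  refine h.map (fun | .cell k t i => .cell k (t + δ) i | .pad j => .pad j)
    {u | ∃ t i, u = .cell 0 t i ∧ 2 * r + 1 ≤ t ∧ t ≤ 4 * r + 1 ∧ i + 1 ≤ 2 ^ (2 * r)}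
    ?_ ?_ ?_ ?_ ?_ ?_
  · intro w hw
    obtain ⟨t', i', rfl, h1, h2, h3, -⟩ := reach_cell (by omega) hw
    refine ⟨t', i', rfl, by omega, by omega, h3.trans ?_⟩
    rw [two_mul, pow_add]
    exact Nat.mul_le_mul_left _ hi
  · rintro _ ⟨t, i, rfl, h1, h2, h3⟩
    exact hlab t i h1 h2 (hpow h1 h3)
  · rintro _ ⟨t, i, rfl, -⟩ _ ⟨t', i', rfl, -⟩ h
    simp only [Pt.cell.injEq, true_and, Nat.add_right_cancel_iff] at h
    rw [h.1, h.2]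
  · rintro _ ⟨t, i, rfl, h1, -⟩ _ ⟨t', i', rfl, -⟩
    change grid.Adj (.cell 0 (t + δ) _) (.cell 0 (t' + δ) _) ↔ _
    rw [grid_adj_cell, grid_adj_cell]
    omega
  · rintro _ ⟨t, i, rfl, h1, h2, h3⟩ (⟨k₁, t₁, i₁⟩ | j) ⟨hadj, hw⟩
    · have hadj := grid_adj_cell.1 hadj
      obtain rfl : k₁ = 0 := by omega
      have hw := cell_mem_netSet.1 hw
      refine ⟨grid_adj_cell.2 (by omega), cell_mem_netSet.2 ⟨Nat.zero_le _, by omega, ?_⟩⟩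
      exact hw.2.2.trans_le (Nat.pow_le_pow_right two_pos (by omega))
    · have := grid_adj_pad.1 hadj
      omega
  · rintro _ ⟨t, i, rfl, h1, h2, h3⟩ (⟨k₁, t₁, i₁⟩ | j) ⟨hadj, hw⟩
    · have hadj := grid_adj_cell.1 hadj
      obtain rfl : k₁ = 0 := by omega
      obtain ⟨t₁, rfl⟩ : ∃ t', t₁ = t' + δ := ⟨t₁ - δ, by omega⟩
      have hw := cell_mem_netSet.1 hw
      refine ⟨.cell 0 t₁ i₁, ⟨grid_adj_cell.2 (by omega), cell_mem_netSet.2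
        ⟨Nat.zero_le _, by omega, ?_⟩⟩, rfl⟩
      have h4 := hpow h1 h3
      have h5 : 2 ^ (t + 1) = 2 * 2 ^ t := by ring
      obtain ⟨t, rfl⟩ : ∃ t', t = t' + 1 := ⟨t - 1, by omega⟩
      have h6 : 2 ^ (t + 1) = 2 * 2 ^ t := by ring
      have : t₁ = t + 1 ∨ t₁ = t + 1 + 1 ∨ t₁ = t := by omega
      rcases this with rfl | rfl | rfl <;> omega
    · have := grid_adj_pad.1 hadj
      omega

theorem card_netSet_succ {K P : ℕ} {T : ℕ → ℕ} :
    (netSet K T (P + 1)).card = (netSet K T P).card + 1 := by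
  classical
  have : netSet K T (P + 1) = insert (.pad P) (netSet K T P) := by
    ext (⟨k, t, i⟩ | j)
    · simp [cell_mem_netSet]
    · simp [pad_mem_netSet, Nat.le_iff_lt_or_eq, or_comm]
  rw [this, Finset.card_insert_of_notMem (by simp [pad_mem_netSet])]

theorem card_netSet_add {K P j : ℕ} {T : ℕ → ℕ} :
    (netSet K T (P + j)).card = (netSet K T P).card + j := by
  induction j with
  | zero => rfl
  | succ j ih => rw [← add_assoc, card_netSet_succ, ih, add_assoc]

theorem netSet_mono {K P P' : ℕ} {T : ℕ → ℕ} (h : P ≤ P') : netSet K T P ⊆ netSet K T P' := by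
  rintro (⟨k, t, i⟩ | j) hv
  · exact cell_mem_netSet.2 (cell_mem_netSet.1 hv)
  · exact pad_mem_netSet.2 ((pad_mem_netSet.1 hv).trans_le h)

/-- In a single table, balls of a given radius have bounded size. -/
theorem exists_ball_bound (D r : ℕ) {u : Pt} (hu : u ∈ netSet 0 (fun _ => D) 0) :
    ∃ B : Finset Pt, B.card ≤ 6 ^ r ∧
      ∀ w, reach (adjIn grid (netSet 0 (fun _ => D) 0)) r u w → w ∈ B := by
  classical
  induction r generalizing u with
  | zero =>
    refine ⟨{u}, by simp, fun w hw => ?_⟩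
    cases hw
    simp
  | succ r ih =>
    rcases u with ⟨k, t, i⟩ | j
    swap
    · simp [pad_mem_netSet] at hu
    let N : Finset Pt := ({.cell k t (i + 1), .cell k t (i - 1), .cell k (t + 1) (2 * i),
      .cell k (t + 1) (2 * i + 1), .cell k (t - 1) (i / 2)} : Finset Pt)
    have hN : N.card ≤ 5 := Finset.card_le_five
    choose! B hB hBw using fun u => ih (u := u)
    refine ⟨insert (.cell k t i) ((N.filter fun w => w ∈ netSet 0 (fun _ => D) 0).biUnion B),
      ?_, ?_⟩
    · refine (Finset.card_insert_le _ _).trans ?_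
      have h1 : ((N.filter fun w => w ∈ netSet 0 (fun _ => D) 0).biUnion B).card ≤ 5 * 6 ^ r :=
        (Finset.card_biUnion_le_card_mul _ _ (6 ^ r)
          fun w hw => hB w (Finset.mem_filter.1 hw).2).trans
          (Nat.mul_le_mul_right _ ((Finset.card_filter_le _ _).trans hN))
      have h2 : 1 ≤ 6 ^ r := Nat.one_le_pow _ _ (by norm_num)
      have h3 : 6 ^ (r + 1) = 6 * 6 ^ r := by ring
      omega
    · rintro w (rfl | ⟨x, ⟨hadj, hx⟩, hw⟩)
      · exact Finset.mem_insert_self _ _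
      · refine Finset.mem_insert_of_mem (Finset.mem_biUnion.2 ⟨x, Finset.mem_filter.2 ⟨?_, hx⟩,
          hBw x hx w hw⟩)
        rcases x with ⟨k', t', i'⟩ | j
        swap
        · simp [pad_mem_netSet] at hx
        have h1 := grid_adj_cell.1 hadj
        have h2 := cell_mem_netSet.1 hx
        have h3 := cell_mem_netSet.1 hu
        simp only [N, Finset.mem_insert, Finset.mem_singleton, Pt.cell.injEq]
        omega

end Geometry

/-! ### Small oracles repeat a label -/

section Oracle

theorem length_le_rank (w : BitString) : w.length ≤ rank w := by
  suffices ∀ n, n + w.length ≤ w.foldl (fun n b => 2 * n + 1 + b.toNat) n by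
    simpa [rank] using this 0
  induction w with
  | nil => simp
  | cons b w ih =>
    intro n
    have := ih (2 * n + 1 + b.toNat)
    simp only [List.length_cons, List.foldl_cons]
    omega

/-- A small oracle repeats some label arbitrarily often. -/
theorem ScalarOracle.IsSmall.exists_repeated {f : ScalarOracle} (hf : f.IsSmall) :
    ∃ s, ∀ k, ∃ n ≥ k, k ≤ (Finset.univ.filter fun i => f.val n i = s).card := by
  simp only [ScalarOracle.IsSmall, ScalarOracle.IsLarge] at hf
  push Not at hf
  obtain ⟨c, -, hc⟩ := hf
  by_contra! hs
  choose N hN using hs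
  have hfin : {w : BitString | rank w < c}.Finite :=
    (List.finite_length_lt Bool c).subset fun w hw => (length_le_rank w).trans_lt hw
  let R := hfin.toFinset
  obtain ⟨n, hn, hrank⟩ := hc (∑ s ∈ R, N s + 1) (by omega)
  have hlow : ∀ i : Fin n, i.val < ∑ s ∈ R, N s + 1 → f.val n i ∈ R := by
    intro i hi
    simp only [R, Set.Finite.mem_toFinset, Set.mem_ofPred_eq]
    exact (f.sorted n (show i ≤ ⟨∑ s ∈ R, N s + 1 - 1, by omega⟩ from
      Fin.le_def.2 (by dsimp; omega))).trans_lt hrank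
  have h1 : ∑ s ∈ R, N s + 1 ≤
      (Finset.univ.filter fun i : Fin n => i.val < ∑ s ∈ R, N s + 1).card := by
    rw [Fin.card_filter_val_lt]
    exact le_min hn le_rfl
  have h2 : (Finset.univ.filter fun i : Fin n => i.val < ∑ s ∈ R, N s + 1) ⊆
      R.biUnion fun s => Finset.univ.filter fun i => f.val n i = s := by
    intro i hi
    simp only [Finset.mem_biUnion, Finset.mem_filter, Finset.mem_univ, true_and] at hi ⊢
    exact ⟨_, hlow i hi, rfl⟩
  have h3 := (Finset.card_le_card h2).trans Finset.card_biUnion_le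
  have h4 : ∑ s ∈ R, (Finset.univ.filter fun i => f.val n i = s).card ≤ ∑ s ∈ R, N s :=
    Finset.sum_le_sum fun s hs => (hN s n ((Finset.single_le_sum (f := N)
      (fun _ _ => Nat.zero_le _) hs).trans (by omega))).le
  omega

/-- A label that occurs often enough may be handed out to all nodes of a given set. -/
theorem ScalarOracle.exists_hands {V : Type} {f : ScalarOracle} {S B : Finset V} (hB : B ⊆ S)
    {s : BitString} (hs : B.card ≤ (Finset.univ.filter fun i => f.val S.card i = s).card) :
    ∃ orc, f.Hands S orc ∧ ∀ v ∈ B, orc v = s := by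
  classical
  obtain ⟨C, hC, hcard⟩ := Finset.exists_subset_card_eq hs
  let B' : Finset (Fin S.card) := Finset.univ.filter fun i => point S i ∈ B
  have hB' : B'.card = C.card := by
    rw [hcard, ← Finset.card_image_of_injective B' point_injective]
    congr 1
    ext v
    simp only [B', Finset.mem_image, Finset.mem_filter, Finset.mem_univ, true_and]
    constructor
    · rintro ⟨i, hi, rfl⟩; exact hi
    · intro hv
      obtain ⟨i, rfl⟩ := exists_point (hB hv)
      exact ⟨i, hv, rfl⟩
  let σ : Equiv.Perm (Fin S.card) := (Finset.equivOfCardEq hB').extendSubtype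
  refine ⟨Function.extend (point S) (fun i => f.val S.card (σ i)) fun _ => [],
    ⟨σ, fun i => point_injective.extend_apply _ _ _⟩, fun v hv => ?_⟩
  obtain ⟨i, rfl⟩ := exists_point (hB hv)
  rw [point_injective.extend_apply]
  have hi : i ∈ B' := by simpa [B'] using hv
  have := (Finset.equivOfCardEq hB').extendSubtype_mem i hi
  simpa using hC this

/-- With suitably many pads, the repeated label `s` may be handed out to all cells and to the first
`p` pads. -/
theorem exists_pads {f : ScalarOracle} {s : BitString}
    (hs : ∀ k, ∃ n ≥ k, k ≤ (Finset.univ.filter fun i => f.val n i = s).card)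
    (K : ℕ) (T : ℕ → ℕ) (p : ℕ) :
    ∃ P ≥ p, ∃ orc, f.Hands (netSet K T P) orc ∧ ∀ v ∈ netSet K T p, orc v = s := by
  obtain ⟨n, hn, hcard⟩ := hs (netSet K T p).card
  have hS : (netSet K T (p + (n - (netSet K T p).card))).card = n := by
    rw [card_netSet_add]; omega
  obtain ⟨orc, h⟩ := ScalarOracle.exists_hands (f := f) (s := s)
    (netSet_mono (K := K) (T := T) (Nat.le_add_right p (n - (netSet K T p).card))) (by rwa [hS])
  exact ⟨_, Nat.le_add_right _ _, orc, h⟩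

end Oracle

/-! ### The rows in which the input is loaded -/

section Loading
variable {Q Γ : Type} (M : Machine Q Γ)

open Classical in
/-- The letter in position `i` of the rows in which the input is loaded. -/
noncomputable def loadLetter (i : ℕ) : Option Γ := if ∃ a, i = 2 ^ a then some M.inp else none

theorem loadLetter_even {i : ℕ} (hi : 0 < i) : loadLetter M (2 * i) = loadLetter M i := by
  have h : (∃ a, 2 * i = 2 ^ a) ↔ ∃ a, i = 2 ^ a := by
    constructor
    · rintro ⟨_ | a, ha⟩
      · omega
      · exact ⟨a, by rw [pow_succ] at ha; omega⟩
    · rintro ⟨a, rfl⟩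
      exact ⟨a + 1, by ring⟩
  by_cases h' : ∃ a, i = 2 ^ a
  · rw [loadLetter, loadLetter, if_pos (h.2 h'), if_pos h']
  · rw [loadLetter, loadLetter, if_neg (h' ∘ h.1), if_neg h']

theorem loadLetter_odd {i : ℕ} (hi : 0 < i) : loadLetter M (2 * i + 1) = none := by
  unfold loadLetter
  rw [if_neg]
  rintro ⟨_ | a, ha⟩
  · simp at ha; omega
  · rw [pow_succ] at ha; omega

/-- While the input is loaded, the letters do not depend on the time. -/
theorem Machine.conf_loading {m t : ℕ} (ht : t ≤ m) : (M.conf m t).1 = none ∧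
    (M.conf m t).2.1 = m - t ∧
      ∀ j, j + 1 < 2 ^ t → (M.conf m t).2.2.getD j none = loadLetter M (j + 1) := by
  induction t with
  | zero => exact ⟨rfl, rfl, fun j hj => by simp at hj⟩
  | succ t ih =>
    obtain ⟨h1, h2, h3⟩ := ih (by omega)
    have h4 : (m - t == 0) = false := by simp; omega
    rw [Machine.conf_succ, Machine.step, h1, h2, h4]
    refine ⟨rfl, by dsimp; omega, fun j hj => ?_⟩
    rw [pow_succ] at hj
    simp only [Machine.pushed, Bool.false_eq_true, if_false, Machine.eraseHit_none]
    rcases j with _ | j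
    · rw [List.getD_cons_zero, loadLetter, if_pos ⟨0, rfl⟩]
    · rw [List.getD_cons_succ]
      rcases Nat.even_or_odd' j with ⟨a, rfl | rfl⟩
      · rw [Machine.spread_getD_even, h3 a (by omega), show 2 * a + 1 + 1 = 2 * (a + 1) by ring,
          loadLetter_even _ a.succ_pos]
      · rw [Machine.spread_getD_odd, show 2 * a + 1 + 1 + 1 = 2 * (a + 1) + 1 by ring,
          loadLetter_odd _ a.succ_pos]

/-- The symbol in position `i` of row `t` of a table in which input `m` is still being loaded. -/
noncomputable def loadSym (m t i : ℕ) : Sym Q Γ where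
  lev := ⟨(m + 2 * t) % 3, Nat.mod_lt _ (by norm_num)⟩
  pos := ⟨i % 3, Nat.mod_lt _ (by norm_num)⟩
  root := decide (t = 0)
  last := decide (i + 1 = 2 ^ t)
  leaf := false
  cell := if i = 0 then .inl (none, none) else .inr (loadLetter M i)
  carry := none

theorem tableSym_loading {m D t i : ℕ} (ht : t ≤ m) (hD : t < D) (hi : i < 2 ^ t) :
    tableSym M m D t i = loadSym M m t i := by
  obtain ⟨h1, h2, h3⟩ := M.conf_loading ht
  unfold tableSym loadSym
  congr 1
  · simp; omega
  · rw [h1, Machine.firstHit_none]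
    split_ifs with h
    · rfl
    · rw [h3 _ (by omega), Nat.sub_add_cancel (by omega)]
  · rw [h1]
    simp [Machine.search]

theorem tableIdx_loading {m t i : ℕ} (ht : t ≤ m) :
    tableIdx M m t i = if i = 0 then m - t else 0 := by
  rw [tableIdx, (M.conf_loading ht).2.1]

/-- Labels without program: the runs on the inputs `g k` in tables of depths `T k`. -/
noncomputable def netType (g T : ℕ → ℕ) : Pt → Option (ℕ × Sym Q Γ)
  | .cell k t i => some (tableIdx M (g k) t i, tableSym M (g k) (T k) t i)
  | .pad _ => none

/-- The labels without program, where the input `m` of table `0` is still being loaded. -/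
noncomputable def loadType (g T : ℕ → ℕ) (m : ℕ) : Pt → Option (ℕ × Sym Q Γ)
  | .cell k t i => if k = 0 then some (if i = 0 then m - t else 0, loadSym M m t i)
      else some (tableIdx M (g k) t i, tableSym M (g k) (T k) t i)
  | .pad _ => none

variable {M}

theorem netLabel_eq (e : ℕ) (g T : ℕ → ℕ) :
    netLabel M e g T = fun v => (netType M g T v).map fun y => (e, y) := by
  funext v
  cases v <;> rfl

theorem loadSym_mod (m t i : ℕ) : loadSym M m t i = loadSym M (m % 3) t i := by
  unfold loadSym
  congr 2
  omega

theorem loadSym_shift (m t i δ : ℕ) (ht : 0 < t) (hi : i + 1 < 2 ^ t) :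
    loadSym M (m + δ) (t + δ) i = loadSym M m t i := by
  have h : 2 ^ t ≤ 2 ^ (t + δ) := Nat.pow_le_pow_right two_pos (Nat.le_add_right _ _)
  unfold loadSym
  congr 1
  · congr 1; omega
  · rw [decide_eq_decide]; omega
  · rw [decide_eq_decide]; omega

theorem loadType_shift {g g' T T' : ℕ → ℕ} {m t i δ : ℕ} (ht : 0 < t) (hi : i + 1 < 2 ^ t) :
    loadType M g T (m + δ) (.cell 0 (t + δ) i) = loadType M g' T' m (.cell 0 t i) := by
  simp only [loadType, if_true, loadSym_shift m t i δ ht hi, Nat.add_sub_add_right]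

theorem netType_loading {g T : ℕ → ℕ} {t i : ℕ} (ht : t ≤ g 0) (hD : t < T 0) (hi : i < 2 ^ t)
    (g' T' : ℕ → ℕ) : netType M g T (.cell 0 t i) = loadType M g' T' (g 0) (.cell 0 t i) := by
  simp only [netType, loadType, if_true, tableSym_loading M ht hD hi, tableIdx_loading M ht]

end Loading

/-! ### Outputs as functions of views -/

section Outputs
variable {Q Γ : Type} [Finite Q] [Finite Γ]

/-- The description of a view in which every cell has program `e` and every node has oracle
label `s`. -/
noncomputable def fillView (e : ℕ) (s : BitString)
    (τ : List (Option (ℕ × Sym Q Γ)) × List (List Bool)) :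
    Description (ℕ × BitString × BitString) :=
  (τ.1.mapIdx fun i x => (i, encodeLabel (x.map fun y => (e, y)), s), τ.2)

theorem viewDesc_eq_fillView {lab : Pt → Option (ℕ × Sym Q Γ)} {orc : Pt → BitString} {e : ℕ}
    {s : BitString} {pts : List Pt} (h : ∀ u ∈ pts, orc u = s) :
    viewDesc grid (fun v => encodeLabel ((lab v).map fun y => (e, y))) orc pts =
      fillView e s (viewType lab pts) := by
  refine Prod.ext ?_ rfl
  refine List.ext_getElem (by simp [viewDesc, fillView, viewType]) fun i h1 h2 => ?_
  have hi : i < pts.length := by simpa [viewDesc] using h1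
  simp [viewDesc, fillView, viewType, h _ (List.getElem_mem hi)]

/-- The labelled graph with the tables `0, …, K`, `P` pads, and the labels `lab` with program `e`. -/
noncomputable abbrev labNet (e K P : ℕ) (T : ℕ → ℕ) (lab : Pt → Option (ℕ × Sym Q Γ)) :
    LabelledGraph :=
  network grid (netSet K T P) netSet_connected
    fun v => encodeLabel ((lab v).map fun y => (e, y))

variable {A : LocalAlgorithm (ℕ × BitString × BitString)} {f : ScalarOracle} {M : Machine Q Γ}
  {F : ℕ →. ℕ}

/-- The outputs of an oblivious algorithm are determined by the views, as far as all nodes in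
sight have oracle label `s`; nodes which see no cell output *yes*. -/
theorem exists_out_view (hobl : A.IsOblivious f)
    (hcor : ∀ (G : LabelledGraph) (σ : G.Node ≃ Fin G.order) (ident : G.Node → ℕ),
      Function.Injective ident → A.CorrectOn (tableLanguage M F) G (oracleData f G σ ident))
    (e K P : ℕ) (T : ℕ → ℕ) (lab : Pt → Option (ℕ × Sym Q Γ)) (hlab : ∀ j, lab (.pad j) = none)
    (orc : Pt → BitString) (horc : f.Hands (netSet K T P) orc) :
    ∃ out : Pt → Bool, (labNet e K P T lab ∈ tableLanguage M F ↔
        ∀ v ∈ netSet K T P, out v = true) ∧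
      (∀ v ∈ netSet K T P, ∀ τ, HasView (netSet K T P) lab A.radius v τ → ∀ s,
        (∀ u, reach (adjIn grid (netSet K T P)) A.radius v u → orc u = s) →
          out v ∈ A.run (fillView e s τ)) ∧
      ∀ j, A.radius ≤ j → Pt.pad j ∈ netSet K T P → out (.pad j) = true := by
  obtain ⟨out, hL, hout⟩ := A.exists_out (L := tableLanguage M F) hobl hcor
    (netSet_connected (K := K) (T := T) (P := P))
    (fun v => encodeLabel ((lab v).map fun y => (e, y))) orc horc
  -- the same graph with all nodes outside the tables, which is in the language
  obtain ⟨out', hL', hout'⟩ := A.exists_out (L := tableLanguage M F) hobl hcor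
    (netSet_connected (K := K) (T := T) (P := P))
    (fun _ => encodeLabel (none : Option (NodeLabel Q Γ))) orc horc
  refine ⟨out, hL, ?_, fun j hj hmem => ?_⟩
  · rintro v hv τ ⟨pts, hpts, rfl⟩ s hs
    have := hout v hv pts hpts
    rwa [viewDesc_eq_fillView fun u hu => hs u ((hpts.mem_iff u).1 hu)] at this
  · obtain ⟨pts, hpts⟩ := exists_ballList (U := grid) A.radius hmem
    have h1 := hout _ hmem pts hpts
    have h2 := hout' _ hmem pts hpts
    rw [hL'.1 network_none_mem_tableLanguage _ hmem] at h2
    refine Part.mem_unique h1 ?_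
    convert h2 using 2
    refine Prod.ext ?_ rfl
    refine List.ext_getElem (by simp [viewDesc]) fun i h3 h4 => ?_
    have hi : i < pts.length := by simpa [viewDesc] using h3
    obtain ⟨j', hj'⟩ := reach_pad hj ((hpts.mem_iff _).1 (List.getElem_mem hi))
    simp [viewDesc, hj', hlab]

end Outputs

/-! ### A program that runs the algorithm on views of itself -/

section Computability
variable {α β : Type} [Primcodable α]

theorem exists_partrec_all (l : List β) (R : β → α →. Bool) (hR : ∀ b, Partrec (R b)) :
    ∃ h : α →. Bool, Partrec h ∧
      ∀ a (v : β → Bool), (∀ b ∈ l, v b ∈ R b a) → l.all v ∈ h a := by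
  induction l with
  | nil => exact ⟨fun _ => Part.some true, Computable.const true, fun a v _ => by simp⟩
  | cons b l ih =>
    obtain ⟨h, hh, hv⟩ := ih
    refine ⟨fun a => (R b a).bind fun x => (h a).map fun y => x && y,
      (hR b).bind ((hh.comp Computable.fst).map ?_), fun a v hb => ?_⟩
    · exact (Primrec.and.comp (Primrec.snd.comp Primrec.fst) Primrec.snd).to_comp.to₂
    · rw [List.all_cons, Part.mem_bind_iff]
      exact ⟨v b, hb b List.mem_cons_self, Part.mem_map_iff _ |>.2
        ⟨_, hv a v fun b' hb' => hb b' (List.mem_cons_of_mem _ hb'), rfl⟩⟩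

theorem exists_partrec_all_lt {R : α × ℕ →. Bool} (hR : Partrec R) {N : α → ℕ}
    (hN : Computable N) : ∃ h : α →. Bool, Partrec h ∧
      ∀ a (v : ℕ → Bool), (∀ j < N a, v j ∈ R (a, j)) → (List.range (N a)).all v ∈ h a := by
  refine ⟨fun a => Nat.rec (Part.some true) (fun j IH => IH.bind fun b =>
    (R (a, j)).map fun x => b && x) (N a), ?_, fun a v => ?_⟩
  · refine Partrec.nat_rec hN (g := fun _ => Part.some true)
      (h := fun a p => (R (a, p.1)).map fun x => p.2 && x) (Computable.const true) ?_
    refine Partrec.map (hR.comp (Computable.fst.pair (Computable.fst.comp Computable.snd))) ?_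
    exact (Primrec.and.comp (Primrec.snd.comp (Primrec.snd.comp Primrec.fst))
      Primrec.snd).to_comp.to₂
  · dsimp only
    generalize N a = n
    induction n with
    | zero => intro _; simp
    | succ n ih =>
      intro h
      refine Part.mem_bind_iff.2 ⟨_, ih fun j hj => h j (by omega), (Part.mem_map_iff _).2 ⟨v n, h n (by omega), ?_⟩⟩
      simp [List.range_succ]

theorem primrec_mapIdx {γ : Type} [Primcodable γ] (l : List β) {F : ℕ → β → α → γ}
    (hF : ∀ i b, Primrec (F i b)) : Primrec fun a => l.mapIdx fun i b => F i b a := by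
  induction l generalizing F with
  | nil => exact Primrec.const []
  | cons b l ih =>
    simp only [List.mapIdx_cons]
    exact Primrec.list_cons.comp (hF 0 b) (ih fun i b => hF (i + 1) b)

end Computability

section Program
variable {Q Γ : Type} [Finite Q] [Finite Γ] {M : Machine Q Γ}

theorem primrec_loadSym (t i : ℕ) : Primrec fun m => loadSym M m t i := by
  have h : Primrec fun m : ℕ => ((List.range 3).map fun a => loadSym M a t i).getD (m % 3)
      (loadSym M 0 t i) :=
    (Primrec.list_getD _).comp (Primrec.const _) (Primrec.nat_mod.comp Primrec.id (Primrec.const 3))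
  refine h.of_eq fun m => ?_
  have := Nat.mod_lt m (show 3 > 0 by norm_num)
  rw [List.getD_eq_getElem _ _ (by simpa using this)]
  simp [← loadSym_mod]

theorem primrec_fillView (s : BitString) (g T : ℕ → ℕ) (pts : List Pt) :
    Primrec fun p : ℕ × ℕ => fillView p.1 s (viewType (loadType M g T p.2) pts) := by
  have hlab : ∀ u, Primrec fun p : ℕ × ℕ => (loadType M g T p.2 u).map fun y => (p.1, y) := by
    rintro (⟨k, t, i⟩ | j)
    · by_cases hk : k = 0
      · simp only [loadType, hk, if_true, Option.map_some]
        refine Primrec.option_some.comp (Primrec.fst.pair (Primrec.pair ?_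
          ((primrec_loadSym t i).comp Primrec.snd)))
        by_cases hi : i = 0
        · simp only [hi, if_true]
          exact Primrec.nat_sub.comp Primrec.snd (Primrec.const t)
        · simp only [hi, if_false]
          exact Primrec.const 0
      · simp only [loadType, hk, if_false, Option.map_some]
        exact Primrec.option_some.comp (Primrec.fst.pair (Primrec.const _))
    · exact Primrec.const none
  have h := (primrec_mapIdx pts (F := fun i u (p : ℕ × ℕ) =>
    (i, encodeLabel ((loadType M g T p.2 u).map fun y => (p.1, y)), s)) fun i u =>
      (Primrec.const i).pair ((primrec_encodeLabel.comp (hlab u)).pair (Primrec.const s))).pair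
    (Primrec.const (viewType (loadType M g T 0) pts).2)
  refine h.of_eq fun p => Prod.ext ?_ rfl
  refine List.ext_getElem (by simp [fillView, viewType]) fun i h1 h2 => ?_
  simp [fillView, viewType]

/-- The adversary: a program that runs the algorithm on the views of the nodes in `Y`, with its
own number as the input in table `0`, and on the views of the nodes in `Y'`, with all smaller
inputs from `J` on. Its output is `0` if and only if all these nodes answer *yes*. -/
theorem exists_adversary (A : LocalAlgorithm (ℕ × BitString × BitString)) (s : BitString)
    (g T : ℕ → ℕ) (pts : Pt → List Pt) (Y Y' : List Pt) (J : ℕ) :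
    ∃ c : Nat.Partrec.Code, ∀ e (v : ℕ → Pt → Bool),
      (∀ y ∈ Y, v e y ∈ A.run (fillView e s (viewType (loadType M g T e) (pts y)))) →
      (∀ m, J ≤ m → m ≤ e → ∀ y ∈ Y',
        v m y ∈ A.run (fillView e s (viewType (loadType M g T m) (pts y)))) →
      ∃ b ∈ c.eval e, b = 0 ↔ (∀ y ∈ Y, v e y = true) ∧
        ∀ m, J ≤ m → m ≤ e → ∀ y ∈ Y', v m y = true := by
  have hR : ∀ y, Partrec fun p : ℕ × ℕ =>
      A.run (fillView p.1 s (viewType (loadType M g T p.2) (pts y))) := fun y =>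
    A.computable.comp (primrec_fillView s g T (pts y)).to_comp
  obtain ⟨h₁, hh₁, hv₁⟩ := exists_partrec_all Y _ hR
  obtain ⟨h₂, hh₂, hv₂⟩ := exists_partrec_all Y' _ hR
  have h₂' : Partrec fun p : ℕ × ℕ => h₂ (p.1, J + p.2) :=
    hh₂.comp (Primrec.fst.pair (Primrec.nat_add.comp (Primrec.const J) Primrec.snd)).to_comp
  obtain ⟨h₃, hh₃, hv₃⟩ := exists_partrec_all_lt h₂' (N := fun e => e + 1 - J)
    (Primrec.nat_sub.comp Primrec.succ (Primrec.const J)).to_comp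
  have hprog : Partrec fun e : ℕ => (h₁ (e, e)).bind fun x => (h₃ e).map fun y =>
      bif x && y then 0 else 1 := by
    refine (hh₁.comp (Computable.id.pair Computable.id)).bind ((hh₃.comp Computable.fst).map ?_)
    exact (Primrec.cond (Primrec.and.comp (Primrec.snd.comp Primrec.fst) Primrec.snd)
      (Primrec.const 0) (Primrec.const 1)).to_comp.to₂
  obtain ⟨c, hc⟩ := Nat.Partrec.Code.exists_code.1 (Partrec.nat_iff.1 hprog)
  refine ⟨c, fun e v hY hY' => ?_⟩
  have e₁ := hv₁ (e, e) (v e) hY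
  have e₃ := hv₃ e (fun j => Y'.all (v (J + j))) fun j hj =>
    hv₂ (e, J + j) (v (J + j)) (hY' _ (by omega) (by omega))
  refine ⟨bif Y.all (v e) && (List.range (e + 1 - J)).all (fun j => Y'.all (v (J + j)))
    then 0 else 1, ?_, ?_⟩
  · rw [hc]
    exact Part.mem_bind_iff.2 ⟨_, e₁, (Part.mem_map_iff _).2 ⟨_, e₃, rfl⟩⟩
  · have key : (Y.all (v e) && (List.range (e + 1 - J)).all fun j => Y'.all (v (J + j))) = true ↔
        (∀ y ∈ Y, v e y = true) ∧ ∀ m, J ≤ m → m ≤ e → ∀ y ∈ Y', v m y = true := by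
      simp only [Bool.and_eq_true, List.all_eq_true, List.mem_range]
      refine and_congr_right fun _ => ⟨fun h m hm hme => ?_, fun h j hj => h _ (by omega) (by omega)⟩
      have := h (m - J) (by omega)
      rwa [Nat.add_sub_cancel' hm] at this
    rw [← key]
    cases (Y.all (v e) && (List.range (e + 1 - J)).all fun j => Y'.all (v (J + j))) <;> simp

end Program

/-! ### The finitely many views far from the roots -/

section CommonViews
variable {Q Γ : Type} (M : Machine Q Γ)

/-- The views in tables of halting runs which show no root and only counters of value at most
`C`. -/
def commonViews (r C : ℕ) : Set (List (Option (ℕ × Sym Q Γ)) × List (List Bool)) :=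
  {τ | ∃ m D t i, M.stopped (M.conf m D).1 = true ∧ t ≤ D ∧ i < 2 ^ t ∧ r < t ∧
    HasView (netSet 0 (fun _ => D) 0) (netType M (fun _ => m) fun _ => D) r (.cell 0 t i) τ ∧
    ∀ x ∈ τ.1, ∃ j a, x = some (j, a) ∧ j ≤ C}

theorem finite_commonViews [Finite Q] [Finite Γ] (r C : ℕ) : (commonViews M r C).Finite := by
  have hfin : (⋃ n ∈ Finset.range (6 ^ r + 1),
      Set.range fun p : (Fin n → Fin (C + 1) × Sym Q Γ) × (Fin n → Fin n → Bool) =>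
        (List.ofFn fun i => some ((p.1 i).1.val, (p.1 i).2),
          List.ofFn fun i => List.ofFn (p.2 i))).Finite :=
    (Finset.range (6 ^ r + 1)).finite_toSet.biUnion fun n _ => Set.finite_range _
  refine hfin.subset ?_
  rintro _ ⟨m, D, t, i, -, ht, hi, hr, ⟨pts, hpts, rfl⟩, hC⟩
  classical
  obtain ⟨B, hB, hBw⟩ := exists_ball_bound D r (u := .cell 0 t i)
    (cell_mem_netSet.2 ⟨le_rfl, ht, hi⟩)
  have hlen : pts.length ≤ 6 ^ r := by
    rw [← List.toFinset_card_of_nodup hpts.nodup]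
    refine (Finset.card_le_card fun w hw => ?_).trans hB
    exact hBw w ((hpts.mem_iff w).1 (List.mem_toFinset.1 hw))
  have hC' : ∀ k : Fin pts.length, ∃ p : Fin (C + 1) × Sym Q Γ,
      netType M (fun _ => m) (fun _ => D) pts[k] = some (p.1.val, p.2) := by
    intro k
    obtain ⟨j, a, h, hj⟩ := hC (netType M (fun _ => m) (fun _ => D) pts[k])
      (List.mem_map_of_mem (List.getElem_mem _))
    exact ⟨(⟨j, by omega⟩, a), h⟩
  choose p hp using hC'
  simp only [Set.mem_iUnion]
  refine ⟨pts.length, by simpa [Nat.lt_succ_iff] using hlen,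
    (p, fun k k' => decide (grid.Adj pts[k] pts[k'])), Prod.ext ?_ ?_⟩
  · refine List.ext_getElem (by simp [viewType]) fun k h1 h2 => ?_
    have := hp ⟨k, by simpa using h1⟩
    simpa [viewType] using this.symm
  · refine List.ext_getElem (by simp [viewType]) fun k h1 h2 => ?_
    refine List.ext_getElem (by simp [viewType]) fun k' h3 h4 => ?_
    simp [viewType]

/-- Finitely many halting runs show all common views. -/
theorem exists_inputs [Finite Q] [Finite Γ] (r C : ℕ) : ∃ (K : ℕ) (g T : ℕ → ℕ),
    (∀ k, 0 < k → k ≤ K → M.stopped (M.conf (g k) (T k)).1 = true) ∧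
    ∀ τ ∈ commonViews M r C, ∃ k t i, 0 < k ∧ k ≤ K ∧ t ≤ T k ∧ i < 2 ^ t ∧ r < t ∧
      HasView (netSet 0 (fun _ => T k) 0) (netType M (fun _ => g k) fun _ => T k) r
        (.cell 0 t i) τ := by
  let l := (finite_commonViews M r C).toFinset.toList
  have hl : ∀ τ, τ ∈ l ↔ τ ∈ commonViews M r C := by simp [l]
  have hw : ∀ τ, ∃ m D, τ ∈ commonViews M r C → M.stopped (M.conf m D).1 = true ∧
      ∃ t i, t ≤ D ∧ i < 2 ^ t ∧ r < t ∧
        HasView (netSet 0 (fun _ => D) 0) (netType M (fun _ => m) fun _ => D) r (.cell 0 t i) τ := by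
    intro τ
    by_cases hτ : τ ∈ commonViews M r C
    · obtain ⟨m, D, t, i, h1, h2, h3, h4, h5, -⟩ := hτ
      exact ⟨m, D, fun _ => ⟨h1, t, i, h2, h3, h4, h5⟩⟩
    · exact ⟨0, 0, fun h => absurd h hτ⟩
  choose m D hmD using hw
  refine ⟨l.length, fun k => m (l.getD (k - 1) ([], [])), fun k => D (l.getD (k - 1) ([], [])),
    fun k hk hkl => ?_, fun τ hτ => ?_⟩
  · refine (hmD _ ((hl _).1 ?_)).1
    rw [List.getD_eq_getElem _ _ (by omega)]
    exact List.getElem_mem _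
  · obtain ⟨k, hk, rfl⟩ := List.getElem_of_mem ((hl τ).2 hτ)
    obtain ⟨-, t, i, h⟩ := hmD _ hτ
    refine ⟨k + 1, t, i, k.succ_pos, hk, ?_⟩
    simp only [Nat.add_sub_cancel, List.getD_eq_getElem _ _ hk]
    exact h

end CommonViews

/-! ### The language is not in `LDO` -/

section Separation
variable {Q Γ : Type} {M : Machine Q Γ}

theorem Machine.conf_counter (m t : ℕ) : (M.conf m t).2.1 = m - t := by
  induction t with
  | zero => rfl
  | succ t ih => rw [Machine.conf_succ, Machine.step, ih]; rfl

theorem Machine.lt_of_stopped {m t : ℕ} (h : M.stopped (M.conf m t).1 = true) : m < t := by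
  by_contra hlt
  rw [(M.conf_loading (not_lt.1 hlt)).1] at h
  cases h

/-- The sequence `g` with its entry at `0` replaced by `a`. -/
def headed (a : ℕ) (g : ℕ → ℕ) (k : ℕ) : ℕ := if k = 0 then a else g k

theorem mem_netSet_of_farness {K P P' r : ℕ} {T : ℕ → ℕ} (hP' : 2 * r < P') {v : Pt}
    (hv : v ∈ netSet K T P) (hf : farness r v ≤ r) : v ∈ netSet K T P' := by
  rcases v with ⟨k, t, i⟩ | j
  · exact cell_mem_netSet.2 (cell_mem_netSet.1 hv)
  · simp only [farness] at hf
    exact pad_mem_netSet.2 (by omega)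

/-- The number `m` as a program that is run on itself. The program is coded by the first component
of `m`; the second component makes arbitrarily large numbers available for each program. -/
noncomputable def selfEval (m : ℕ) : Part ℕ :=
  (Denumerable.ofNat Nat.Partrec.Code m.unpair.1).eval m

theorem partrec_selfEval : Partrec selfEval :=
  Nat.Partrec.Code.eval_part.comp ((Computable.ofNat _).comp
    (Primrec.fst.comp Primrec.unpair).to_comp) Computable.id

theorem selfEval_pair (c : Nat.Partrec.Code) (a : ℕ) :
    selfEval (Nat.pair (Encodable.encode c) a) = c.eval (Nat.pair (Encodable.encode c) a) := by
  simp [selfEval]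

/-- An identifier-oblivious algorithm of radius `r` cannot decide the language. Let the other tables
of the network show all common views of radius `r`. The adversary `e` runs the algorithm on the
views near the roots, on all views in the other tables, and on the views near the left border while
an input is being loaded. Every other view in the complete run on `e` is common or shows pads only.
Hence the adversary knows whether all nodes answer *yes*, and it outputs `0` in this case, in which
the network is not in the language, and `1` otherwise, in which the network is in the language. -/
theorem tableLanguage_not_mem_LDOWith [Finite Q] [Finite Γ] {f : ScalarOracle} (hf : f.IsSmall)
    (hM : ∀ m, M.Halts m ↔ (selfEval m).Dom) : tableLanguage M selfEval ∉ LDOWith f := by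
  classical
  rintro ⟨A, hobl, hcor⟩
  obtain ⟨s, hs⟩ := hf.exists_repeated
  generalize hr : A.radius = r at *
  obtain ⟨K, g, T, hgT, hcommon⟩ := exists_inputs (M := M) r (2 * r + 1)
  -- the reference networks, in which table `0` only shows the loading of an input
  let T₀ := headed (4 * r + 2) T
  obtain ⟨P₀, hP₀, orc₀, horc₀, hs₀⟩ := exists_pads hs K T₀ (2 * r + 2)
  have hout₀ := fun e m => exists_out_view hobl hcor e K P₀ T₀ (loadType M g T m)
    (fun _ => rfl) orc₀ horc₀
  rw [hr] at hout₀
  choose out₀ _ hview₀ _ using hout₀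
  have hpts : ∀ v, ∃ pts, v ∈ netSet K T₀ P₀ → BallList grid (netSet K T₀ P₀) r v pts := by
    intro v
    by_cases hv : v ∈ netSet K T₀ P₀
    · obtain ⟨pts, h⟩ := exists_ballList (U := grid) r hv
      exact ⟨pts, fun _ => h⟩
    · exact ⟨[], fun h => absurd h hv⟩
  choose pts hpts using hpts
  let Y : Finset Pt := (netSet K T₀ P₀).filter fun v => farness r v = 0
  let Y' : List Pt := (List.range (2 ^ r)).map fun i => .cell 0 (3 * r + 1) i
  have hY : ∀ v, v ∈ Y.toList ↔ v ∈ netSet K T₀ P₀ ∧ farness r v = 0 := by simp [Y]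
  have hY' : ∀ v ∈ Y', v ∈ Y.toList := by
    intro v hv
    obtain ⟨i, hi, rfl⟩ := List.mem_map.1 hv
    rw [hY, cell_mem_netSet]
    refine ⟨⟨Nat.zero_le _, by simp only [T₀, headed, if_true]; omega, ?_⟩, by simp [farness]⟩
    exact (List.mem_range.1 hi).trans_le (Nat.pow_le_pow_right two_pos (by omega))
  have hrun₀ : ∀ e m, ∀ y ∈ Y.toList, ∀ τ, HasView (netSet K T₀ P₀) (loadType M g T m) r y τ →
      out₀ e m y ∈ A.run (fillView e s τ) := by
    intro e m y hy τ hτ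
    obtain ⟨hy, hfar⟩ := (hY y).1 hy
    refine hview₀ e m y hy τ hτ s fun u hu => hs₀ u ?_
    refine mem_netSet_of_farness (r := r) (by omega) (reach_mem hy hu) ?_
    have := farness_reach (r := r) hu
    omega
  obtain ⟨c, hc⟩ := exists_adversary (M := M) A s g T pts Y.toList Y' (4 * r + 2)
  let e := Nat.pair (Encodable.encode c) (4 * r + 2)
  have he : 4 * r + 2 ≤ e := Nat.right_le_pair _ _
  obtain ⟨b, hb, hb0⟩ := hc e (out₀ e)
    (fun y hy => hrun₀ e e y hy _ ⟨_, hpts y ((hY y).1 hy).1, rfl⟩)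
    (fun m _ _ y hy => hrun₀ e m y (hY' y hy) _ ⟨_, hpts y ((hY y).1 (hY' y hy)).1, rfl⟩)
  rw [← selfEval_pair] at hb
  change b ∈ selfEval e at hb
  -- the network with the complete run of the machine on `e` in table `0`
  obtain ⟨D, hD⟩ := (hM e).2 (Part.dom_iff_mem.2 ⟨b, hb⟩)
  have heD := Machine.lt_of_stopped hD
  let g₁ := headed e g
  let T₁ := headed D T
  have hg₁ : g₁ 0 = e := rfl
  have hT₁ : T₁ 0 = D := rfl
  have hT₀ : T₀ 0 = 4 * r + 2 := rfl
  have hg₁' : ∀ k, k ≠ 0 → g₁ k = g k := fun k hk => if_neg hk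
  have hT₁' : ∀ k, k ≠ 0 → T₁ k = T k := fun k hk => if_neg hk
  have hT₀' : ∀ k, k ≠ 0 → T₀ k = T k := fun k hk => if_neg hk
  obtain ⟨P₁, hP₁, orc₁, horc₁, hs₁⟩ := exists_pads hs K T₁ (2 * r + 2)
  obtain ⟨out₁, hL, hview₁, hpad₁⟩ := exists_out_view hobl hcor e K P₁ T₁ (netType M g₁ T₁)
    (fun _ => rfl) orc₁ horc₁
  rw [hr] at hview₁ hpad₁
  have hmemL : labNet e K P₁ T₁ (netType M g₁ T₁) ∈ tableLanguage M selfEval ↔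
      0 ∉ selfEval e := by
    have := network_mem_tableLanguage (M := M) (F := selfEval) (e := e) (K := K) (P := P₁)
      (g := g₁) (T := T₁) rfl (fun k hk => by
        rcases Nat.eq_zero_or_pos k with rfl | hk'
        · exact hD
        · rw [hg₁' k hk'.ne', hT₁' k hk'.ne']; exact hgT k hk' hk)
    rwa [netLabel_eq] at this
  -- all cells, and the pads near them, have oracle label `s`
  have hcell : ∀ {k t i u}, r < t → Pt.cell k t i ∈ netSet K T₁ P₁ →
      reach (adjIn grid (netSet K T₁ P₁)) r (.cell k t i) u → orc₁ u = s := by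
    intro k t i u ht hv hu
    have hmem := reach_mem hv hu
    obtain ⟨t', i', rfl, -⟩ := reach_cell ht.le hu
    exact hs₁ _ (cell_mem_netSet.2 (cell_mem_netSet.1 hmem))
  -- near the roots, the reference network looks the same
  have hnear : ∀ v ∈ Y.toList, v ∈ netSet K T₁ P₁ → out₁ v = out₀ e e v := by
    intro v hv hmem
    obtain ⟨hv₀, hfar⟩ := (hY v).1 hv
    obtain ⟨τ, hτ⟩ := exists_hasView (loadType M g T e) r hv₀
    have hτ₁ : HasView (netSet K T₁ P₁) (netType M g₁ T₁) r v τ := by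
      refine hτ.near hv₀ hfar (fun k hk => by rw [hT₁' k hk, hT₀' k hk]) hT₀.ge (by omega) hP₀ hP₁ ?_
      rintro (⟨k, t, i⟩ | j) hu hfu
      · rcases Nat.eq_zero_or_pos k with rfl | hk
        · simp only [farness, if_true] at hfu
          exact netType_loading (by omega) (by omega) (cell_mem_netSet.1 hu).2.2 g T
        · simp only [netType, loadType, hk.ne', if_false, hg₁' k hk.ne', hT₁' k hk.ne']
      · rfl
    refine Part.mem_unique (hview₁ v hmem τ hτ₁ s fun u hu => hs₁ u ?_) (hrun₀ e e v hv τ hτ)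
    refine mem_netSet_of_farness (r := r) (by omega) (reach_mem hmem hu) ?_
    have := farness_reach (r := r) hu
    omega
  -- near the left border, it looks the same with another input
  have hborder : ∀ m δ i, 4 * r + 2 ≤ m → m + δ = e → i < 2 ^ r →
      out₁ (.cell 0 (3 * r + 1 + δ) i) = out₀ e m (.cell 0 (3 * r + 1) i) ∧
        Pt.cell 0 (3 * r + 1 + δ) i ∈ netSet K T₁ P₁ := by
    intro m δ i hm hδ hi
    have hv : Pt.cell 0 (3 * r + 1) i ∈ Y' := List.mem_map.2 ⟨i, List.mem_range.2 hi, rfl⟩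
    have hv₀ := (hY _).1 (hY' _ hv)
    obtain ⟨τ, hτ⟩ := exists_hasView (loadType M g T m) r hv₀.1
    have hmem : Pt.cell 0 (3 * r + 1 + δ) i ∈ netSet K T₁ P₁ := by
      refine cell_mem_netSet.2 ⟨Nat.zero_le _, by omega, hi.trans_le ?_⟩
      exact Nat.pow_le_pow_right two_pos (by omega)
    refine ⟨?_, hmem⟩
    have hτ₁ : HasView (netSet K T₁ P₁) (netType M g₁ T₁) r (.cell 0 (3 * r + 1 + δ) i) τ := by
      refine hτ.shift hi hT₀.ge (by omega) fun t i ht ht' hi => ?_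
      have h2 : 2 ^ t ≤ 2 ^ (t + δ) := Nat.pow_le_pow_right two_pos (Nat.le_add_right _ _)
      rw [netType_loading (by omega) (by omega) (by omega) g T, hg₁, ← hδ]
      exact loadType_shift (by omega) hi
    exact Part.mem_unique (hview₁ _ hmem τ hτ₁ s fun u hu => hcell (by omega) hmem hu)
      (hrun₀ e m _ (hY' _ hv) τ hτ)
  -- elsewhere, the views of table `0` are common and thus occur in another table
  have hfar : ∀ t i, r < t → Pt.cell 0 t i ∈ netSet K T₁ P₁ →
      (∀ t' i', reach (adjIn grid (netSet K T₁ P₁)) r (.cell 0 t i) (.cell 0 t' i') →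
        tableIdx M e t' i' ≤ 2 * r + 1) →
      ∃ v ∈ Y.toList, v ∈ netSet K T₁ P₁ ∧ out₁ (.cell 0 t i) = out₁ v := by
    intro t i ht hmem hidx
    obtain ⟨τ, hτ⟩ := exists_hasView (netType M g₁ T₁) r hmem
    have hτ' : τ ∈ commonViews M r (2 * r + 1) := by
      have hmem' := cell_mem_netSet.1 hmem
      refine ⟨e, D, t, i, hD, hmem'.2.1, hmem'.2.2, ht,
        hτ.table (Nat.zero_le _) le_rfl rfl ht fun _ _ => rfl, fun x hx => ?_⟩
      obtain ⟨l, hl, rfl⟩ := hτ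
      obtain ⟨u, hu, rfl⟩ := List.mem_map.1 hx
      have hu := (hl.mem_iff u).1 hu
      obtain ⟨t', i', rfl, -⟩ := reach_cell ht.le hu
      exact ⟨_, _, rfl, hidx t' i' hu⟩
    obtain ⟨k, t', i', hk, hkK, ht', hi', hrt', hτk⟩ := hcommon τ hτ'
    have hτ₁ : HasView (netSet K T₁ P₁) (netType M g₁ T₁) r (.cell k t' i') τ :=
      hτk.table le_rfl hkK (hT₁' k hk.ne').symm hrt' fun t i => by
        simp only [netType, hg₁' k hk.ne', hT₁' k hk.ne']
    have hmem₁ : Pt.cell k t' i' ∈ netSet K T₁ P₁ :=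
      cell_mem_netSet.2 ⟨hkK, by rwa [hT₁' k hk.ne'], hi'⟩
    refine ⟨_, (hY _).2 ⟨cell_mem_netSet.2 ⟨hkK, by rwa [hT₀' k hk.ne'], hi'⟩,
      by simp [farness, hk.ne']⟩, hmem₁, ?_⟩
    exact Part.mem_unique (hview₁ _ hmem τ hτ s fun u hu => hcell ht hmem hu)
      (hview₁ _ hmem₁ τ hτ₁ s fun u hu => hcell hrt' hmem₁ hu)
  by_cases hb' : b = 0
  · -- all outputs that the program has seen are *yes*, hence all outputs are *yes*
    subst hb'
    obtain ⟨hacc, hacc'⟩ := hb0.1 rfl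
    refine hmemL.1 (hL.2 fun v hv => ?_) hb
    have hnear' : farness r v = 0 → out₁ v = true := by
      intro hfar
      have hvY : v ∈ Y.toList := by
        refine (hY v).2 ⟨?_, hfar⟩
        rcases v with ⟨k, t, i⟩ | j
        · have hv := cell_mem_netSet.1 hv
          refine cell_mem_netSet.2 ⟨hv.1, ?_, hv.2.2⟩
          rcases Nat.eq_zero_or_pos k with rfl | hk
          · simp only [farness, if_true] at hfar
            omega
          · rw [hT₀' k hk.ne', ← hT₁' k hk.ne']; exact hv.2.1
        · simp only [farness] at hfar
          exact pad_mem_netSet.2 (by omega)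
      rw [hnear v hvY hv, hacc v hvY]
    by_cases hfar0 : farness r v = 0
    · exact hnear' hfar0
    rcases v with ⟨k, t, i⟩ | j
    swap
    · simp only [farness] at hfar0
      exact hpad₁ j (by omega) hv
    obtain rfl : k = 0 := by
      by_contra hk
      simp [farness, hk] at hfar0
    simp only [farness, if_true] at hfar0
    by_cases hidx : ∀ t' i', reach (adjIn grid (netSet K T₁ P₁)) r (.cell 0 t i) (.cell 0 t' i') →
        tableIdx M e t' i' ≤ 2 * r + 1
    · obtain ⟨v, hvY, hv₁, h⟩ := hfar t i (by omega) hv hidx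
      rw [h, hnear v hvY hv₁, hacc v hvY]
    · push Not at hidx
      obtain ⟨t', i', hreach, hlt⟩ := hidx
      obtain ⟨t'', i'', heq, h1, h2, -, h4⟩ := reach_cell (by omega) hreach
      cases heq
      have hi' : i' = 0 := by
        by_contra hi'
        simp [tableIdx, hi'] at hlt
      subst hi'
      rw [tableIdx, if_pos rfl, Machine.conf_counter] at hlt
      obtain ⟨δ, rfl⟩ : ∃ δ, t = 3 * r + 1 + δ := ⟨t - (3 * r + 1), by omega⟩
      rw [(hborder (e - δ) δ i (by omega) (by omega) (by omega)).1]
      exact hacc' _ (by omega) (by omega) _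
        (List.mem_map.2 ⟨i, List.mem_range.2 (by omega), rfl⟩)
  · -- the program has seen a *no*, although all outputs are *yes*
    refine hb' (hb0.2 ?_)
    have hall := hL.1 (hmemL.2 fun h0 => hb' (Part.mem_unique hb h0))
    refine ⟨fun y hy => ?_, fun m hm hme y hy => ?_⟩
    · have hy₁ : y ∈ netSet K T₁ P₁ := by
        obtain ⟨hy₀, hfar⟩ := (hY y).1 hy
        rcases y with ⟨k, t, i⟩ | j
        · have hy₀ := cell_mem_netSet.1 hy₀
          refine cell_mem_netSet.2 ⟨hy₀.1, ?_, hy₀.2.2⟩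
          rcases Nat.eq_zero_or_pos k with rfl | hk
          · omega
          · rw [hT₁' k hk.ne', ← hT₀' k hk.ne']; exact hy₀.2.1
        · simp only [farness] at hfar
          exact pad_mem_netSet.2 (by omega)
      rw [← hnear y hy hy₁, hall y hy₁]
    · obtain ⟨i, hi, rfl⟩ := List.mem_map.1 hy
      obtain ⟨h1, h2⟩ := hborder m (e - m) i hm (by omega) (List.mem_range.1 hi)
      rw [← h1, hall _ h2]

end Separation
end LocalDecision

theorem lemma2 (f : LocalDecision.ScalarOracle) (hf : f.IsSmall) :
    ∃ L : LocalDecision.DistLanguage, L ∈ LocalDecision.LD ∧ L ∉ LocalDecision.LDOWith f := by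
  obtain ⟨Q, Γ, _, _, M, hM⟩ := LocalDecision.exists_machine LocalDecision.partrec_selfEval
  exact ⟨_, LocalDecision.tableLanguage_mem_LD M _ LocalDecision.partrec_selfEval hM,
    LocalDecision.tableLanguage_not_mem_LDOWith hf hM⟩
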